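/- \textbf{Setting.} Let $d\ge 1$, let $\mathsf Z$ be a Polish space with its Borel $\sigma$-field, and let $\mathrm P$ be a Markov kernel on $\mathsf Z$ with invariant probability measure $\pi$. Assume that for some integer $t_{\mathrm{mix}}\ge 1$ and all $k\ge 1$, $$\Delta(\mathrm P^k):=\sup_{z,z'\in\mathsf Z}\tfrac12\|\mathrm P^k(z,\cdot)-\mathrm P^k(z',\cdot)\|_{\mathrm{TV}}\le (1/4)^{\lfloor k/t_{\mathrm{mix}}\rfloor},\qquad \|\mu\|_{\mathrm{TV}}=|\mu|(\mathsf Z).$$ Let $\mathbf A:\mathsf Z\to\mathbb R^{d\times d}$ and $\mathbf b:\mathsf Z\to\mathbb R^d$ be measurable, and let $\bar{\mathbf A}\in\mathbb R^{d\times d}$, $\bar{\mathbf b}\in\mathbb R^d$, with $\int \mathbf A\,d\pi=\bar{\mathbf A}$, $\int\mathbf b\,d\pi=\bar{\mathbf b}$ and $-\bar{\mathbf A}$ Hurwitz (all eigenvalues have negative real part). Put $\theta^\star=\bar{\mathbf A}^{-1}\bar{\mathbf b}$, $\tilde{\mathbf A}(z)=\mathbf A(z)-\bar{\mathbf A}$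 and $\varepsilon(z)=\tilde{\mathbf A}(z)\theta^\star-(\mathbf b(z)-\bar{\mathbf b})$, and assume $$C_A=\sup_z\|\mathbf A(z)\|\vee\sup_z\|\tilde{\mathbf A}(z)\|<\infty,\qquad \|\varepsilon\|_\infty=\sup_z\|\varepsilon(z)\|<\infty,$$ where $\|\cdot\|$ is the Euclidean norm of a vector and the spectral norm of a matrix. Let $Q$ be the unique symmetric positive definite solution of $\bar{\mathbf A}^\top Q+Q\bar{\mathbf A}=\mathrm I$, let $\|x\|_Q=(x^\top Qx)^{1/2}$, $\|M\|_Q=\max_{\|x\|_Q=1}\|Mx\|_Q$, and $$\kappa_Q=\frac{\lambda_{\max}(Q)}{\lambda_{\min}(Q)},\qquad a=\frac{1}{2\|Q\|},\qquad \alpha_\infty=\Big(\tfrac12\|\bar{\mathbf A}\|_Q^{-2}\|Q\|^{-1}\Big)\wedge\|Q\| .$$ With $B=\lceil 8\kappa_Q^{1/2}C_A/a\rceil$, let $$\alpha_\infty^{(\mathrm M)}=\Big[\alpha_\infty\wedge\kappa_Q^{-1/2}C_A^{-1}\wedge\frac{a}{6\mathrm e\,\kappa_QC_A}\Big]B^{-1},\quad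 C_\Gamma=4\big(\kappa_Q^{1/2}C_A+a/6\big)^2B,\quad \alpha_{q,\infty}^{(\mathrm M)}=\alpha_\infty^{(\mathrm M)}\wedge\frac{a}{12\,C_\Gamma\,q}.$$ For a probability measure $\xi$ on $\mathsf Z$ let $(Z_k)_{k\ge0}$ be, under $\mathbb P_\xi$, the Markov chain with initial distribution $\xi$ and kernel $\mathrm P$. For $\alpha>0$ set $J_0^{(\ell,\alpha)}=H_0^{(\ell,\alpha)}=0$ and, for $n\ge1$, $$J_n^{(0,\alpha)}=(\mathrm I-\alpha\bar{\mathbf A})J_{n-1}^{(0,\alpha)}-\alpha\,\varepsilon(Z_n),\qquad J_n^{(\ell,\alpha)}=(\mathrm I-\alpha\bar{\mathbf A})J_{n-1}^{(\ell,\alpha)}-\alpha\tilde{\mathbf A}(Z_n)J_{n-1}^{(\ell-1,\alpha)}\ (\ell\ge1),$$ $$H_n^{(\ell,\alpha)}=(\mathrm I-\alpha\mathbf A(Z_n))H_{n-1}^{(\ell,\alpha)}-\alpha\tilde{\mathbf A}(Z_n)J_{n-1}^{(\ell,\alpha)}\ (\ell\ge 0).$$ \textbf{Constants.} Let $$\mathsf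 D_1=\frac{\kappa_Q^{3/2}(48\kappa_Q^{1/2}+1)C_A^2}{\log 2},\qquad \mathsf D_2=\kappa_Q(34\kappa_Q+1)C_A^2,\qquad \mathsf D=\mathsf D_1+\mathsf D_2,$$ $$c_1=\frac{\mathsf D\|\varepsilon\|_\infty}{a},\quad c_2=\frac{\kappa_Q^{1/2}\mathsf D\|\varepsilon\|_\infty}{a},\quad c_3=\frac{128\sqrt\pi\,\kappa_Q^2C_A^2\|\varepsilon\|_\infty}{a^{3/2}},$$ $$c_4=\frac{12\kappa_Q^{1/2}\mathsf D\|\varepsilon\|_\infty}{a^{3/2}},\quad c_5=\frac{2\kappa_Q^{1/2}\mathsf D\|\varepsilon\|_\infty}{a^{3/2}},\quad c_6=\frac{2\mathsf D\|\varepsilon\|_\infty}{a^{2}},$$ $$\mathsf D_J=\big(10c_5+2c_3+24c_5+4c_6\big)+\big(c_4+13\big)+2(c_1+c_2),\qquad \mathsf D_H=384\,\kappa_Q^{1/2}C_A\,a^{-1}\mathrm e^2\,\mathsf D_J .$$ \textbf{Statement.} (i) For every $2\le p<\infty$, every $\alpha\in(0,\alpha_\infty]$, every initial probability measure $\xi$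 on $\mathsf Z$ and every $n\in\mathbb N$, $$\mathbb E_\xi^{1/p}\big[\|J_n^{(2,\alpha)}\|^p\big]\le \mathsf D_J\,t_{\mathrm{mix}}^{5/2}\,p^{7/2}\,\alpha^{3/2}\log^{3/2}\!\big(1/(\alpha a)\big).$$ (ii) For all real $p,q$ with $2\le p\le q/2$, every $\alpha\in(0,\alpha_{q,\infty}^{(\mathrm M)}t_{\mathrm{mix}}^{-1})$, every initial probability measure $\xi$ on $\mathsf Z$ and every $n\in\mathbb N$, $$\mathbb E_\xi^{1/p}\big[\|H_n^{(2,\alpha)}\|^p\big]\le \mathsf D_H\,d^{1/q}\,t_{\mathrm{mix}}^{5/2}\,p^{7/2}\,\alpha^{3/2}\log^{3/2}\!\big(1/(\alpha a)\big).$$ -/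

import Mathlib

open MeasureTheory ProbabilityTheory
open scoped ENNReal Matrix.Norms.L2Operator

noncomputable section

namespace LSA

/-! ### Matrices, the Lyapunov equation and the associated norms

With `Matrix.Norms.L2Operator` open, `‖M‖` is the spectral norm of the matrix `M`. -/

/-- The vector `M x`, for a `d × d` matrix `M` and a vector `x` of the Euclidean space `ℝ^d`. -/
def act {d : ℕ} (M : Matrix (Fin d) (Fin d) ℝ) (x : EuclideanSpace ℝ (Fin d)) :
    EuclideanSpace ℝ (Fin d) :=
  Matrix.toEuclideanCLM (n := Fin d) (𝕜 := ℝ) M x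

/-- `M` is Hurwitz: all its complex eigenvalues have negative real part. -/
def IsHurwitz {d : ℕ} (M : Matrix (Fin d) (Fin d) ℝ) : Prop :=
  ∀ μ ∈ spectrum ℂ (M.map (algebraMap ℝ ℂ)), μ.re < 0

/-- `Q` is a symmetric positive definite solution of the Lyapunov equation `Mᵀ Q + Q M = I`. -/
def IsLyapunovSolution {d : ℕ} (M Q : Matrix (Fin d) (Fin d) ℝ) : Prop :=
  Q.PosDef ∧ M.transpose * Q + Q * M = 1

open Classical in
/-- The symmetric positive definite solution `Q` of `Mᵀ Q + Q M = I`
(it exists and is unique when `-M` is Hurwitz; the value is `0` if there is none). -/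
def lyapunov {d : ℕ} (M : Matrix (Fin d) (Fin d) ℝ) : Matrix (Fin d) (Fin d) ℝ :=
  if h : ∃ Q, IsLyapunovSolution M Q then h.choose else 0

/-- `‖x‖_Q = (xᵀ Q x)^{1/2}`. -/
def normQ {d : ℕ} (Q : Matrix (Fin d) (Fin d) ℝ) (x : EuclideanSpace ℝ (Fin d)) : ℝ :=
  Real.sqrt (inner ℝ x (act Q x))

/-- `‖M‖_Q = max {‖M x‖_Q : ‖x‖_Q = 1}`. -/
def opNormQ {d : ℕ} (Q M : Matrix (Fin d) (Fin d) ℝ) : ℝ :=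
  sSup ((fun x => normQ Q (act M x)) '' {x | normQ Q x = 1})

/-- `κ_Q = λ_max(Q) / λ_min(Q)`. -/
def condNumber {d : ℕ} (Q : Matrix (Fin d) (Fin d) ℝ) : ℝ :=
  sSup (spectrum ℝ Q) / sInf (spectrum ℝ Q)

/-! ### Linear stochastic approximation -/

/-- The data of the linear system `Ā θ = b̄` and of its stochastic estimates `A(z)`, `b(z)`. -/
structure Data (d : ℕ) (Z : Type*) where
  A : Z → Matrix (Fin d) (Fin d) ℝ
  b : Z → EuclideanSpace ℝ (Fin d)
  Abar : Matrix (Fin d) (Fin d) ℝ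
  bbar : EuclideanSpace ℝ (Fin d)

namespace Data

variable {d : ℕ} {Z : Type*} (S : Data d Z)

/-- `θ⋆ = Ā⁻¹ b̄`, the solution of `Ā θ = b̄`. -/
def thetaStar : EuclideanSpace ℝ (Fin d) := act S.Abar⁻¹ S.bbar

/-- `Ã(z) = A(z) - Ā`. -/
def Atilde (z : Z) : Matrix (Fin d) (Fin d) ℝ := S.A z - S.Abar

/-- `ε(z) = Ã(z) θ⋆ - (b(z) - b̄)`. -/
def noise (z : Z) : EuclideanSpace ℝ (Fin d) :=
  act (S.Atilde z) S.thetaStar - (S.b z - S.bbar)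

/-- `C_A = sup_z ‖A(z)‖ ∨ sup_z ‖Ã(z)‖`. -/
def CA : ℝ := max (⨆ z, ‖S.A z‖) (⨆ z, ‖S.Atilde z‖)

/-- `‖ε‖_∞ = sup_z ‖ε(z)‖`. -/
def noiseSup : ℝ := ⨆ z, ‖S.noise z‖

/-- The solution `Q` of the Lyapunov equation `Āᵀ Q + Q Ā = I`. -/
def Q : Matrix (Fin d) (Fin d) ℝ := lyapunov S.Abar

/-- `κ_Q`. -/
def kappa : ℝ := condNumber S.Q

/-- `a = ‖Q‖⁻¹ / 2`. -/
def a : ℝ := ‖S.Q‖⁻¹ / 2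

/-- `α_∞ = (1/2) ‖Ā‖_Q⁻² ‖Q‖⁻¹ ∧ ‖Q‖`. -/
def alphaInf : ℝ := min ((1 / 2) * (opNormQ S.Q S.Abar ^ 2)⁻¹ * ‖S.Q‖⁻¹) ‖S.Q‖

/-- `⌈8 κ_Q^{1/2} C_A / a⌉`. -/
def blockCeil : ℝ := (⌈8 * Real.sqrt S.kappa * S.CA / S.a⌉₊ : ℝ)

/-- `α_∞^{(M)}`. -/
def alphaInfM : ℝ :=
  min (min S.alphaInf ((Real.sqrt S.kappa)⁻¹ * S.CA⁻¹))
      (S.a / (6 * Real.exp 1 * S.kappa * S.CA)) * S.blockCeil⁻¹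

/-- `C_Γ = 4 (κ_Q^{1/2} C_A + a/6)² ⌈8 κ_Q^{1/2} C_A / a⌉`. -/
def CGamma : ℝ := 4 * (Real.sqrt S.kappa * S.CA + S.a / 6) ^ 2 * S.blockCeil

/-- `α_{q,∞}^{(M)} = α_∞^{(M)} ∧ a / (12 C_Γ q)`. -/
def alphaInfMq (q : ℝ) : ℝ := min S.alphaInfM (S.a / (12 * S.CGamma) / q)

/-! The constants of the moment bounds. -/

def D11 : ℝ :=
  S.kappa ^ (3 / 2 : ℝ) * (48 * Real.sqrt S.kappa + 1) * S.CA ^ 2 / Real.log 2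

def D21 : ℝ := S.kappa * (34 * S.kappa + 1) * S.CA ^ 2

def cJ1 : ℝ := (S.D11 + S.D21) * S.noiseSup / S.a

def cJ2 : ℝ := Real.sqrt S.kappa * (S.D11 + S.D21) * S.noiseSup / S.a

def cJ3 : ℝ :=
  128 * Real.sqrt Real.pi * S.kappa ^ 2 * S.CA ^ 2 * S.noiseSup / S.a ^ (3 / 2 : ℝ)

def cJ4 : ℝ :=
  12 * Real.sqrt S.kappa * (S.D11 + S.D21) * S.noiseSup / S.a ^ (3 / 2 : ℝ)

def cJ5 : ℝ :=
  2 * Real.sqrt S.kappa * (S.D11 + S.D21) * S.noiseSup / S.a ^ (3 / 2 : ℝ)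

def cJ6 : ℝ := 2 * (S.D11 + S.D21) * S.noiseSup / S.a ^ 2

def DJ1 : ℝ := 10 * S.cJ5 + 2 * S.cJ3 + 24 * S.cJ5 + 4 * S.cJ6

def DJ2 : ℝ := S.cJ4 + 13

def DJ3 : ℝ := 2 * (S.cJ1 + S.cJ2)

/-- The constant `D_J`. -/
def DJ : ℝ := S.DJ1 + S.DJ2 + S.DJ3

/-- The constant `D_H`. -/
def DH : ℝ := 384 * Real.sqrt S.kappa * S.CA * S.a⁻¹ * Real.exp 1 ^ 2 * S.DJ

/-! The expansion of the fluctuation term along a trajectory `z = (z_0, z_1, …)`. -/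

/-- `J S α z l n` is `J_n^{(l,α)}`:
`J_n^{(0)} = (I - α Ā) J_{n-1}^{(0)} - α ε(z_n)` and, for `l ≥ 1`,
`J_n^{(l)} = (I - α Ā) J_{n-1}^{(l)} - α Ã(z_n) J_{n-1}^{(l-1)}`, with `J_0^{(l)} = 0`. -/
def J (α : ℝ) (z : ℕ → Z) : ℕ → ℕ → EuclideanSpace ℝ (Fin d)
  | _, 0 => 0
  | 0, n + 1 => act (1 - α • S.Abar) (J α z 0 n) - α • S.noise (z (n + 1))
  | l + 1, n + 1 =>
      act (1 - α • S.Abar) (J α z (l + 1) n) - α • act (S.Atilde (z (n + 1))) (J α z l n)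

/-- `H S α z l n` is `H_n^{(l,α)}`:
`H_n^{(l)} = (I - α A(z_n)) H_{n-1}^{(l)} - α Ã(z_n) J_{n-1}^{(l)}`, with `H_0^{(l)} = 0`. -/
def H (α : ℝ) (z : ℕ → Z) (l : ℕ) : ℕ → EuclideanSpace ℝ (Fin d)
  | 0 => 0
  | n + 1 =>
      act (1 - α • S.A (z (n + 1))) (H α z l n) - α • act (S.Atilde (z (n + 1))) (S.J α z l n)

/-- `C_A < ∞` and `-Ā` is Hurwitz. -/
structure BoundedHurwitz : Prop where
  bdd_A : BddAbove (Set.range fun z => ‖S.A z‖)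
  bdd_Atilde : BddAbove (Set.range fun z => ‖S.Atilde z‖)
  hurwitz : IsHurwitz (-S.Abar)

/-- `A`, `b` are measurable with `π`-means `Ā`, `b̄`, and `‖ε‖_∞ < ∞`. -/
structure CenteredBoundedNoise [MeasurableSpace Z] (π : Measure Z) : Prop where
  measurable_A : ∀ i j, Measurable fun z => S.A z i j
  measurable_b : Measurable S.b
  integrable_A : ∀ i j, Integrable (fun z => S.A z i j) π
  integral_A : ∀ i j, ∫ z, S.A z i j ∂π = S.Abar i j
  integrable_b : Integrable S.b π
  integral_b : ∫ z, S.b z ∂π = S.bbar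
  bdd_noise : BddAbove (Set.range fun z => ‖S.noise z‖)

end Data

/-! ### The Markov chain -/

section Chain

variable {Z : Type*} [MeasurableSpace Z]

instance isMarkovKernel_pow (P : Kernel Z Z) [IsMarkovKernel P] (k : ℕ) :
    IsMarkovKernel (P ^ k) := by
  induction k with
  | zero => exact inferInstanceAs (IsMarkovKernel (Kernel.id : Kernel Z Z))
  | succ k ih =>
    rw [pow_succ]
    exact inferInstanceAs (IsMarkovKernel ((P ^ k) ∘ₖ P))

/-- The Dobrushin coefficient `sup_{z,z'} (1/2) ‖P(z,·) - P(z',·)‖_TV` of a Markov kernel, where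
`‖μ‖_TV = |μ|(Z)`. -/
def dobrushin (P : Kernel Z Z) [IsMarkovKernel P] : ℝ≥0∞ :=
  ⨆ (z : Z) (z' : Z),
    (1 / 2) * ((P z).toSignedMeasure - (P z').toSignedMeasure).totalVariation Set.univ

/-- `π` is invariant for the Markov kernel `P`, which is uniformly geometrically ergodic with
mixing time `t`: `Δ(P^k) ≤ (1/4)^⌊k/t⌋` for all `k ≥ 1`. -/
structure UniformlyErgodic (P : Kernel Z Z) [IsMarkovKernel P] (π : Measure Z) (t : ℕ) : Prop where
  invariant : Kernel.Invariant P π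
  one_le : 1 ≤ t
  mixing : ∀ k : ℕ, 1 ≤ k → dobrushin (P ^ k) ≤ (1 / 4 : ℝ≥0∞) ^ (k / t)

/-- `ℙ_ξ`: the law on the canonical space `Z^ℕ` of the Markov chain `(Z_k)_{k ≥ 0}` with initial
distribution `ξ` and Markov kernel `P`. -/
def chainLaw (P : Kernel Z Z) [IsMarkovKernel P] (ξ : Measure Z) : Measure (ℕ → Z) :=
  Kernel.trajMeasure (X := fun _ => Z) ξ fun n =>
    P.comap (fun h : (i : Finset.Iic n) → Z => h ⟨n, Finset.mem_Iic.2 le_rfl⟩)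
      (measurable_pi_apply _)

end Chain

end LSA

end

set_option linter.unusedSectionVars false

open MeasureTheory ProbabilityTheory
open scoped ENNReal Matrix.Norms.L2Operator

namespace LSA

/-! ### Moments of martingale-type sums in a Hilbert space -/

section Moments

/-! In the coordinates `T = Q^{1/2}` the Lyapunov equation makes `I - αĀ` a strict contraction of a
Euclidean space: `‖(I - αĀ)v‖² ≤ (1 - αa)‖v‖²` for `α ≤ α_∞`. What remains is to bound moments of
linear recursions with a contractive deterministic part, driven by a uniformly ergodic chain;
passing to these coordinates and back costs powers of `κ_Q`.

The probabilistic engine is a one-step inequality in Hilbert space,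
`MomentLE.add_of_condExp_eq_zero`: if `Y` is conditionally centred and `‖Y‖ ≤ w` with `w` known from
the past, then `‖X + Y‖_p² ≤ ‖X‖_p² + (2p+1)‖w‖_p²` for the `L^p` norms. Iterated along a
contraction of rate `x` it yields the factor `√((2p+1)/x)`.

For `J^{(0)}` (`momentLE_linear_part`) the noise is cut into `t`-step increments, which are
martingale differences along each residue class modulo `t`; the result is of order `√(pαt/a)`. Each
further level (`momentLE_poisson_step`) solves the Poisson equation for `Ã`, whose solution has size
of order `t C_A`, and thereby replaces `Ã(Z_n) J_{n-1}` by a martingale difference plus a drift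
smaller by a factor `α`; this gains `t √(pα/a)`. Three levels give `p^{3/2} t^{5/2} (α/a)^{3/2}`.
The additional `p²` and the logarithm in the claim are slack, and `D_J` is compared numerically.

For `H^{(2)}` (`momentLE_remainder`) time is cut into blocks of length `h` of order `t √κ_Q C_A /
a`. On a vector of the past, the random matrix product over a block acts in conditional mean as `I -
αhĀ`, up to a bias of size at most `3αt√κ_Q C_A` that does not grow with `h` and is therefore
dominated by the contraction. The fluctuation enters the one-step inequality squared, so it is
harmless for small steps. Each block thus contracts the `L^p` norm by `1 - αha/20`
(`momentLE_blockProd`), and summing the forcing by `J^{(2)}` costs a factor `40 √κ_Q C_A / a`, with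
no dependence on the dimension. -/

/-- The `p`-th moment bound `(E ‖X‖^p)^{1/p} ≤ A`. -/
def MomentLE {Ω F : Type*} [MeasurableSpace Ω] [NormedAddCommGroup F] (μ : Measure Ω) (p A : ℝ)
    (X : Ω → F) : Prop :=
  eLpNorm X (ENNReal.ofReal p) μ ≤ ENNReal.ofReal A

section Basic

variable {Ω F G : Type*} [MeasurableSpace Ω] [NormedAddCommGroup F] [NormedAddCommGroup G]
  {μ : Measure Ω} {p A B : ℝ} {X Y : Ω → F}

lemma MomentLE.mono (h : MomentLE μ p A X) (hAB : A ≤ B) : MomentLE μ p B X :=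
  le_trans h (ENNReal.ofReal_le_ofReal hAB)

lemma MomentLE.add (hX : MomentLE μ p A X) (hY : MomentLE μ p B Y) (hp : 1 ≤ p)
    (hA : 0 ≤ A) (hB : 0 ≤ B) (mX : AEStronglyMeasurable X μ) (mY : AEStronglyMeasurable Y μ) :
    MomentLE μ p (A + B) (fun ω => X ω + Y ω) := by
  unfold MomentLE
  rw [ENNReal.ofReal_add hA hB]
  refine (eLpNorm_add_le mX mY ?_).trans (add_le_add hX hY)
  simpa using hp

lemma MomentLE.of_norm_le {Y : Ω → G} {c : ℝ} (hX : MomentLE μ p A X) (hc : 0 ≤ c)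
    (h : ∀ ω, ‖Y ω‖ ≤ c * ‖X ω‖) : MomentLE μ p (c * A) Y := by
  unfold MomentLE
  rw [ENNReal.ofReal_mul hc]
  refine (eLpNorm_le_mul_eLpNorm_of_ae_le_mul (ae_of_all _ h) _).trans ?_
  exact mul_le_mul_right hX _

lemma MomentLE.of_bound [IsProbabilityMeasure μ] {c : ℝ} (h : ∀ ω, ‖X ω‖ ≤ c) :
    MomentLE μ p c X := by
  refine (eLpNorm_le_of_ae_bound (C := c) (ae_of_all _ h)).trans ?_
  simp

lemma MomentLE.zero : MomentLE μ p 0 (fun _ => (0 : F)) := by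
  simp [MomentLE]

lemma MomentLE.sum {ι : Type*} (s : Finset ι) {X : ι → Ω → F} {A : ι → ℝ} (hp : 1 ≤ p)
    (hA : ∀ i ∈ s, 0 ≤ A i) (mX : ∀ i ∈ s, AEStronglyMeasurable (X i) μ)
    (h : ∀ i ∈ s, MomentLE μ p (A i) (X i)) :
    MomentLE μ p (∑ i ∈ s, A i) (fun ω => ∑ i ∈ s, X i ω) := by
  unfold MomentLE
  rw [ENNReal.ofReal_sum_of_nonneg hA]
  have : (fun ω => ∑ i ∈ s, X i ω) = ∑ i ∈ s, X i := by
    ext ω; simp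
  rw [this]
  exact (eLpNorm_sum_le mX (by simpa using hp)).trans (Finset.sum_le_sum h)

lemma MomentLE.eLpNorm_sq_le {f : Ω → F} {a : ℝ} (ha : 0 ≤ a) (hf : MomentLE μ p a f) :
    eLpNorm (fun ω => ‖f ω‖ ^ 2) (ENNReal.ofReal (p / 2)) μ ≤ ENNReal.ofReal (a ^ 2) := by
  have hp2 : ENNReal.ofReal (p / 2) * ENNReal.ofReal 2 = ENNReal.ofReal p := by
    rw [← ENNReal.ofReal_mul' (by norm_num)]; congr 1; ring
  have := eLpNorm_norm_rpow (p := ENNReal.ofReal (p / 2)) (μ := μ) f (q := 2) two_pos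
  simp only [Real.rpow_two, ENNReal.rpow_two] at this
  rw [this, hp2, ENNReal.ofReal_pow ha]
  exact pow_le_pow_left' hf 2

end Basic

variable {E : Type*} [NormedAddCommGroup E] [InnerProductSpace ℝ E]

/-- The slope of the affine majorant of `y ↦ ‖x + y‖^p` on the ball of radius `b`, `s = ‖x‖`. -/
noncomputable def tilt (p s b : ℝ) : ℝ :=
  if s ^ 2 + b ^ 2 < p * b ^ 2 then 0
  else (s ^ 2 + b ^ 2) ^ (p / 2) * Real.sinh (p * s * b / (s ^ 2 + b ^ 2)) / (s * b)

/-- Convexity: the right-hand side is the chord of `exp` over `[-w, w]`. -/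
lemma exp_le_cosh_add {v w : ℝ} (hw : 0 < w) (hv : |v| ≤ w) :
    Real.exp v ≤ Real.cosh w + v / w * Real.sinh w := by
  obtain ⟨h1, h2⟩ := abs_le.1 hv
  have hconv := (convexOn_exp.2 (Set.mem_univ (-w)) (Set.mem_univ w) : ∀ ⦃a b : ℝ⦄, _)
    (a := (1 - v / w) / 2) (b := (1 + v / w) / 2)
    (by have : v / w ≤ 1 := (div_le_one hw).2 h2
        linarith)
    (by have : -1 ≤ v / w := by rw [le_div_iff₀ hw]; linarith
        linarith) (by ring)
  have e1 : ((1 - v / w) / 2) • (-w) + ((1 + v / w) / 2) • w = v := by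
    simp only [smul_eq_mul]; field_simp; ring
  rw [e1] at hconv
  refine hconv.trans (le_of_eq ?_)
  rw [Real.cosh_eq, Real.sinh_eq]
  simp only [smul_eq_mul]
  ring

/-- The majorant is affine in `y`, so its linear term disappears under conditioning. With `S = ‖x‖²
+ b²`, one has `‖x + y‖² ≤ S + 2⟪x, y⟫ ≤ S exp(2⟪x, y⟫ / S)`. Raising to the power `p/2`, replacing
the exponential by its chord and using `cosh w ≤ exp(w²/2)` leaves a constant term that the factor
`2p + 1` absorbs. -/
lemma norm_add_rpow_le {p b : ℝ} (hp : 2 ≤ p) {x y : E} (hy : ‖y‖ ≤ b) :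
    ‖x + y‖ ^ p ≤ (‖x‖ ^ 2 + (2 * p + 1) * b ^ 2) ^ (p / 2)
      + tilt p ‖x‖ b * inner ℝ x y := by
  have hb : 0 ≤ b := (norm_nonneg _).trans hy
  set s := ‖x‖ with hs
  have hs0 : 0 ≤ s := norm_nonneg _
  have hpow : ‖x + y‖ ^ p = (‖x + y‖ ^ 2) ^ (p / 2) := by
    rw [← Real.rpow_natCast, ← Real.rpow_mul (norm_nonneg _)]
    congr 1; push_cast; ring
  have hip : |inner ℝ x y| ≤ s * b :=
    (abs_real_inner_le_norm x y).trans (by gcongr)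
  have hsq : ‖x + y‖ ^ 2 ≤ s ^ 2 + b ^ 2 + 2 * inner ℝ x y := by
    rw [norm_add_sq_real]
    have : ‖y‖ ^ 2 ≤ b ^ 2 := by gcongr
    linarith
  have hr : 0 ≤ p / 2 := by linarith
  rw [hpow]
  unfold tilt
  split_ifs with hc
  -- Here `b` is large against `‖x‖` and no linear term is needed: `2‖x‖b ≤ ‖x‖² + b² < p b²`.
  · rw [zero_mul, add_zero]
    refine Real.rpow_le_rpow (by positivity) ?_ hr
    have := (abs_le.1 hip).2
    nlinarith [sq_nonneg (s - b)]
  · push Not at hc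
    set S := s ^ 2 + b ^ 2 with hS
    have hS0 : 0 ≤ S := by positivity
    rcases eq_or_lt_of_le (mul_nonneg hs0 hb) with h0 | hsb
    · rw [← h0] at hip
      have hin : inner ℝ x y = 0 := abs_nonpos_iff.1 hip
      rw [hin, mul_zero, add_zero]
      refine Real.rpow_le_rpow (by positivity) ?_ hr
      rw [hin] at hsq
      nlinarith [sq_nonneg b]
    · have hSpos : 0 < S := by nlinarith [sq_nonneg (s - b)]
      set w := p * s * b / S with hw
      have hwpos : 0 < w := by rw [hw, mul_assoc]; positivity
      set v := p / S * inner ℝ x y with hv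
      have hvw : |v| ≤ w := by
        rw [hv, abs_mul, abs_of_nonneg (by positivity), hw, mul_assoc, div_mul_eq_mul_div]
        gcongr
      have h1 : ‖x + y‖ ^ 2 ≤ S * Real.exp (2 / S * inner ℝ x y) := by
        have := Real.add_one_le_exp (2 / S * inner ℝ x y)
        calc ‖x + y‖ ^ 2 ≤ S + 2 * inner ℝ x y := hsq
          _ = S * (2 / S * inner ℝ x y + 1) := by field_simp; ring
          _ ≤ _ := by gcongr
      have h2 : (‖x + y‖ ^ 2) ^ (p / 2) ≤ S ^ (p / 2) * Real.exp v := by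
        refine (Real.rpow_le_rpow (by positivity) h1 hr).trans (le_of_eq ?_)
        rw [Real.mul_rpow hS0 (Real.exp_pos _).le, ← Real.exp_mul]
        congr 2
        rw [hv]; field_simp
      have h3 := exp_le_cosh_add hwpos hvw
      have h4 : S ^ (p / 2) * Real.cosh w ≤ (s ^ 2 + (2 * p + 1) * b ^ 2) ^ (p / 2) := by
        -- In this branch `p b² ≤ S`, so the quantity is at most `1`, where `exp u ≤ 1 + 2u`; the
        -- doubled term is the `2p` in `2p + 1`.
        have hu0 : 0 ≤ p * s ^ 2 * b ^ 2 / S ^ 2 := by positivity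
        have hu1 : p * s ^ 2 * b ^ 2 / S ^ 2 ≤ 1 := by
          rw [div_le_one (by positivity)]
          have : s ^ 2 ≤ S := by rw [hS]; nlinarith [sq_nonneg b]
          nlinarith [mul_le_mul this hc (by positivity) hS0]
        have hexp : Real.exp (p * s ^ 2 * b ^ 2 / S ^ 2) ≤ 1 + 2 * (p * s ^ 2 * b ^ 2 / S ^ 2) := by
          have := Real.abs_exp_sub_one_sub_id_le (x := p * s ^ 2 * b ^ 2 / S ^ 2)
            (by rw [abs_of_nonneg hu0]; exact hu1)
          have := (abs_le.1 this).2
          nlinarith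
        have hcosh : Real.cosh w ≤ (Real.exp (p * s ^ 2 * b ^ 2 / S ^ 2)) ^ (p / 2) := by
          refine (Real.cosh_le_exp_half_sq w).trans (le_of_eq ?_)
          rw [← Real.exp_mul]
          congr 1
          rw [hw]; field_simp
        calc S ^ (p / 2) * Real.cosh w
            ≤ S ^ (p / 2) * (Real.exp (p * s ^ 2 * b ^ 2 / S ^ 2)) ^ (p / 2) := by gcongr
          _ = (S * Real.exp (p * s ^ 2 * b ^ 2 / S ^ 2)) ^ (p / 2) :=
              (Real.mul_rpow hS0 (Real.exp_pos _).le).symm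
          _ ≤ (s ^ 2 + (2 * p + 1) * b ^ 2) ^ (p / 2) := by
            refine Real.rpow_le_rpow (by positivity) ?_ hr
            have e : S * (p * s ^ 2 * b ^ 2 / S ^ 2) ≤ p * b ^ 2 := by
              have : S * (p * s ^ 2 * b ^ 2 / S ^ 2) = (s ^ 2 / S) * (p * b ^ 2) := by
                field_simp
              rw [this]
              have h5 : s ^ 2 / S ≤ 1 := by
                rw [div_le_one hSpos, hS]; nlinarith [sq_nonneg b]
              have : 0 ≤ p * b ^ 2 := by positivity
              nlinarith
            calc S * Real.exp (p * s ^ 2 * b ^ 2 / S ^ 2)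
                ≤ S * (1 + 2 * (p * s ^ 2 * b ^ 2 / S ^ 2)) := by gcongr
              _ ≤ s ^ 2 + (2 * p + 1) * b ^ 2 := by rw [hS] at e ⊢; linarith
      calc (‖x + y‖ ^ 2) ^ (p / 2) ≤ S ^ (p / 2) * Real.exp v := h2
        _ ≤ S ^ (p / 2) * (Real.cosh w + v / w * Real.sinh w) := by gcongr
        _ = S ^ (p / 2) * Real.cosh w + S ^ (p / 2) * Real.sinh w / (s * b) * inner ℝ x y := by
            have hpne : p ≠ 0 := by linarith
            have hsne : s ≠ 0 := fun h => by simp [h] at hsb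
            have hbne : b ≠ 0 := fun h => by simp [h] at hsb
            have : v / w = inner ℝ x y / (s * b) := by
              rw [hv, hw]; field_simp
            rw [this]; ring
        _ ≤ _ := by gcongr

/-- Makes the linear correction integrable; `sinh (p / 2)` comes from `‖x‖b ≤ (‖x‖² + b²)/2`. -/
lemma abs_tilt_mul_inner_le {p b C : ℝ} (hp : 2 ≤ p) {x y : E} (hy : ‖y‖ ≤ b)
    (hx : ‖x‖ ≤ C) (hb : b ≤ C) :
    |tilt p ‖x‖ b * inner ℝ x y| ≤ (C ^ 2 + C ^ 2) ^ (p / 2) * Real.sinh (p / 2) := by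
  have hb0 : 0 ≤ b := (norm_nonneg _).trans hy
  have hC : 0 ≤ C := hb0.trans hb
  have hs0 := norm_nonneg x
  have hsinh : 0 ≤ Real.sinh (p / 2) := Real.sinh_nonneg_iff.2 (by linarith)
  have hip : |inner ℝ x y| ≤ ‖x‖ * b :=
    (abs_real_inner_le_norm x y).trans (by gcongr)
  unfold tilt
  split_ifs with hc
  · simp only [zero_mul, abs_zero]; positivity
  · rcases eq_or_lt_of_le (mul_nonneg hs0 hb0) with h0 | hsb
    · rw [← h0]; simp only [div_zero, zero_mul, abs_zero]; positivity
    · have hSpos : 0 < ‖x‖ ^ 2 + b ^ 2 := by nlinarith [sq_nonneg (‖x‖ - b)]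
      have harg : p * ‖x‖ * b / (‖x‖ ^ 2 + b ^ 2) ≤ p / 2 := by
        rw [div_le_iff₀ hSpos]; nlinarith [sq_nonneg (‖x‖ - b)]
      have hsinh' : 0 ≤ Real.sinh (p * ‖x‖ * b / (‖x‖ ^ 2 + b ^ 2)) :=
        Real.sinh_nonneg_iff.2 (by positivity)
      rw [abs_mul, abs_of_nonneg (by positivity)]
      calc _ ≤ (‖x‖ ^ 2 + b ^ 2) ^ (p / 2) * Real.sinh (p * ‖x‖ * b / (‖x‖ ^ 2 + b ^ 2))
            / (‖x‖ * b) * (‖x‖ * b) := by gcongr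
        _ = (‖x‖ ^ 2 + b ^ 2) ^ (p / 2) * Real.sinh (p * ‖x‖ * b / (‖x‖ ^ 2 + b ^ 2)) := by
            rw [div_mul_cancel₀ _ hsb.ne']
        _ ≤ _ := by
            gcongr
            exact Real.sinh_le_sinh.2 harg

lemma measurable_tilt (p : ℝ) : Measurable fun q : ℝ × ℝ => tilt p q.1 q.2 := by
  unfold tilt
  refine Measurable.ite (measurableSet_lt (by fun_prop) (by fun_prop)) measurable_const ?_
  exact ((by fun_prop : Measurable fun q : ℝ × ℝ => (q.1 ^ 2 + q.2 ^ 2) ^ (p / 2)).mul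
    (Real.measurable_sinh.comp (by fun_prop))).div (by fun_prop)

variable [CompleteSpace E] {Ω : Type*} {m : MeasurableSpace Ω} [mΩ : MeasurableSpace Ω]
  {μ : Measure Ω} [IsProbabilityMeasure μ]

lemma integral_inner_eq_zero {C Y : Ω → E} (hm : m ≤ mΩ) (hC : StronglyMeasurable[m] C)
    (hY : Integrable Y μ) (hYm : μ[Y | m] =ᵐ[μ] 0)
    (hint : Integrable (fun ω => inner ℝ (C ω) (Y ω)) μ) :
    ∫ ω, inner ℝ (C ω) (Y ω) ∂μ = 0 := by
  have h : μ[fun ω => inner ℝ (C ω) (Y ω) | m] =ᵐ[μ] fun ω => inner ℝ (C ω) (μ[Y | m] ω) :=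
    condExp_bilin_of_stronglyMeasurable_left (m := m) (μ := μ)
      (innerSL ℝ : E →L[ℝ] E →L[ℝ] ℝ) hC (g := Y) hint hY
  rw [← integral_condExp hm, integral_congr_ae h]
  have : (fun ω => inner ℝ (C ω) (μ[Y | m] ω)) =ᵐ[μ] 0 := by
    filter_upwards [hYm] with ω hω
    simp [hω]
  rw [integral_congr_ae this]; simp

-- Integrating the majorant of `norm_add_rpow_le` with radius `w` kills the linear term, because its
-- slope is known from the past. Minkowski's inequality in `L^{p/2}`, available since `p ≥ 2`, then
-- separates `‖X‖²` from `w²`. The constant `C` serves integrability only and does not enter the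
-- estimate.
set_option maxHeartbeats 1000000 in
lemma MomentLE.add_of_condExp_eq_zero {p A W : ℝ} (hp : 2 ≤ p) (hA : 0 ≤ A) (hW : 0 ≤ W)
    {X Y : Ω → E} {w : Ω → ℝ} (hm : m ≤ mΩ) (mX : StronglyMeasurable[m] X)
    (mw : StronglyMeasurable[m] w) (mY : StronglyMeasurable Y)
    {C : ℝ} (hXC : ∀ ω, ‖X ω‖ ≤ C) (hwC : ∀ ω, w ω ≤ C) (hYw : ∀ ω, ‖Y ω‖ ≤ w ω)
    (hY : μ[Y | m] =ᵐ[μ] 0) (hXA : MomentLE μ p A X) (hwW : MomentLE μ p W w) :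
    MomentLE μ p (Real.sqrt (A ^ 2 + (2 * p + 1) * W ^ 2)) (fun ω => X ω + Y ω) := by
  have hp0 : 0 < p := by linarith
  set V : Ω → ℝ := fun ω => ‖X ω‖ ^ 2 + (2 * p + 1) * (w ω) ^ 2 with hV
  have hw0 : ∀ ω, 0 ≤ w ω := fun ω => (norm_nonneg _).trans (hYw ω)
  have hV0 : ∀ ω, 0 ≤ V ω := fun ω => by positivity
  set c : Ω → E := fun ω => tilt p ‖X ω‖ (w ω) • X ω with hc
  have mc : StronglyMeasurable[m] c := by
    have h1 : @Measurable _ _ m _ fun ω => tilt p ‖X ω‖ (w ω) :=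
      (measurable_tilt p).comp (mX.norm.measurable.prodMk mw.measurable)
    exact h1.stronglyMeasurable.smul mX
  have hcY : ∀ ω, inner ℝ (c ω) (Y ω) = tilt p ‖X ω‖ (w ω) * inner ℝ (X ω) (Y ω) := fun ω => by
    rw [hc]; simp only [real_inner_smul_left]
  have mX' := mX.mono hm
  have mw' := mw.mono hm
  have hint : Integrable (fun ω => inner ℝ (c ω) (Y ω)) μ := by
    refine Integrable.of_bound ((mc.mono hm).inner mY).aestronglyMeasurable
      ((C ^ 2 + C ^ 2) ^ (p / 2) * Real.sinh (p / 2)) (ae_of_all _ fun ω => ?_)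
    rw [hcY, Real.norm_eq_abs]
    exact abs_tilt_mul_inner_le hp (hYw ω) (hXC ω) (hwC ω)
  have hYint : Integrable Y μ :=
    Integrable.of_bound mY.aestronglyMeasurable C (ae_of_all _ fun ω => (hYw ω).trans (hwC ω))
  have hzero := integral_inner_eq_zero hm mc hYint hY hint
  have mV : StronglyMeasurable V :=
    (mX'.norm.pow 2).add ((mw'.pow 2).const_mul _)
  have hVint : Integrable (fun ω => V ω ^ (p / 2)) μ := by
    refine Integrable.of_bound
      (mV.measurable.pow_const _).aestronglyMeasurable
      ((C ^ 2 + (2 * p + 1) * C ^ 2) ^ (p / 2)) (ae_of_all _ fun ω => ?_)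
    rw [Real.norm_of_nonneg (by have := hV0 ω; positivity)]
    refine Real.rpow_le_rpow (hV0 ω) ?_ (by linarith)
    have h1 := hXC ω
    have h2 := hwC ω
    have h3 := hw0 ω
    simp only [hV]
    gcongr
  have mS : StronglyMeasurable fun ω => X ω + Y ω := mX'.add mY
  have hSint : Integrable (fun ω => ‖X ω + Y ω‖ ^ p) μ := by
    refine Integrable.of_bound (mS.norm.measurable.pow_const _).aestronglyMeasurable
      ((C + C) ^ p) (ae_of_all _ fun ω => ?_)
    rw [Real.norm_of_nonneg (by positivity)]
    refine Real.rpow_le_rpow (norm_nonneg _) ?_ (by linarith)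
    exact (norm_add_le _ _).trans (add_le_add (hXC ω) ((hYw ω).trans (hwC ω)))
  have hmain : ∫ ω, ‖X ω + Y ω‖ ^ p ∂μ ≤ ∫ ω, V ω ^ (p / 2) ∂μ := by
    have h1 : ∫ ω, ‖X ω + Y ω‖ ^ p ∂μ ≤ ∫ ω, (V ω ^ (p / 2) + inner ℝ (c ω) (Y ω)) ∂μ := by
      refine integral_mono hSint (hVint.add hint) fun ω => ?_
      simp only [hcY]
      exact norm_add_rpow_le hp (hYw ω)
    rwa [integral_add hVint hint, hzero, add_zero] at h1
  have hle : eLpNorm (fun ω => X ω + Y ω) (ENNReal.ofReal p) μ ^ p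
      ≤ eLpNorm V (ENNReal.ofReal (p / 2)) μ ^ (p / 2) := by
    rw [eLpNorm_eq_lintegral_rpow_enorm_toReal (by simpa using hp0) (by simp),
      eLpNorm_eq_lintegral_rpow_enorm_toReal (by simpa using hp0) (by simp),
      ENNReal.toReal_ofReal hp0.le, ENNReal.toReal_ofReal (by linarith),
      ← ENNReal.rpow_mul, ← ENNReal.rpow_mul, one_div_mul_cancel hp0.ne',
      one_div_mul_cancel (by linarith), ENNReal.rpow_one, ENNReal.rpow_one]
    have e1 : ∫⁻ ω, ‖X ω + Y ω‖ₑ ^ p ∂μ = ENNReal.ofReal (∫ ω, ‖X ω + Y ω‖ ^ p ∂μ) := by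
      rw [ofReal_integral_eq_lintegral_ofReal hSint (ae_of_all _ fun ω => by positivity)]
      refine lintegral_congr fun ω => ?_
      rw [← ofReal_norm, ENNReal.ofReal_rpow_of_nonneg (norm_nonneg _) hp0.le]
    have e2 : ∫⁻ ω, ‖V ω‖ₑ ^ (p / 2) ∂μ = ENNReal.ofReal (∫ ω, V ω ^ (p / 2) ∂μ) := by
      rw [ofReal_integral_eq_lintegral_ofReal hVint
        (ae_of_all _ fun ω => Real.rpow_nonneg (hV0 ω) _)]
      refine lintegral_congr fun ω => ?_
      rw [← ofReal_norm, ENNReal.ofReal_rpow_of_nonneg (norm_nonneg _) (by linarith),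
        Real.norm_of_nonneg (hV0 ω)]
    rw [e1, e2]
    exact ENNReal.ofReal_le_ofReal hmain
  have hVnorm : eLpNorm V (ENNReal.ofReal (p / 2)) μ
      ≤ ENNReal.ofReal (A ^ 2 + (2 * p + 1) * W ^ 2) := by
    have hadd := eLpNorm_add_le (p := ENNReal.ofReal (p / 2)) (μ := μ)
      (f := fun ω => ‖X ω‖ ^ 2) (g := fun ω => (2 * p + 1) * (w ω) ^ 2)
      (mX'.norm.pow 2).aestronglyMeasurable ((mw'.pow 2).const_mul _).aestronglyMeasurable
      (by rw [← ENNReal.ofReal_one]; exact ENNReal.ofReal_le_ofReal (by linarith))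
    refine hadd.trans ?_
    rw [ENNReal.ofReal_add (by positivity) (by positivity)]
    refine add_le_add (hXA.eLpNorm_sq_le hA) ?_
    have hw2 : (fun ω => (2 * p + 1) * (w ω) ^ 2) = (2 * p + 1) • fun ω => ‖w ω‖ ^ 2 := by
      ext ω; simp
    rw [hw2, eLpNorm_const_smul, ENNReal.ofReal_mul (by positivity)]
    refine mul_le_mul' (le_of_eq ?_) (hwW.eLpNorm_sq_le hW)
    rw [← ofReal_norm, Real.norm_of_nonneg (by positivity)]
  unfold MomentLE
  rw [← ENNReal.rpow_le_rpow_iff hp0]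
  refine hle.trans ((ENNReal.rpow_le_rpow hVnorm (by linarith)).trans (le_of_eq ?_))
  rw [ENNReal.ofReal_rpow_of_nonneg (by positivity) (by linarith),
    ENNReal.ofReal_rpow_of_nonneg (Real.sqrt_nonneg _) (by linarith)]
  congr 1
  rw [Real.sqrt_eq_rpow, ← Real.rpow_mul (by positivity)]
  congr 1; ring

end Moments

/-! ### Iterates of a uniformly ergodic Markov kernel and the Poisson equation -/

section KernelIterates

variable {Z : Type*} [MeasurableSpace Z] {F : Type*} [NormedAddCommGroup F] [NormedSpace ℝ F]

/-- The function `P^k f`. -/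
noncomputable def iter (P : Kernel Z Z) (k : ℕ) (f : Z → F) (z : Z) : F := ∫ y, f y ∂(P ^ k) z

variable {P : Kernel Z Z} [IsMarkovKernel P] {f : Z → F} {β : ℝ}

lemma integrable_of_norm_le {Ω : Type*} [MeasurableSpace Ω] {μ : Measure Ω} [IsFiniteMeasure μ]
    {f : Ω → F} (hf : StronglyMeasurable f) (hβ : ∀ z, ‖f z‖ ≤ β) : Integrable f μ :=
  Integrable.of_bound hf.aestronglyMeasurable β (ae_of_all _ hβ)

lemma stronglyMeasurable_iter (k : ℕ) (hf : StronglyMeasurable f) :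
    StronglyMeasurable (iter P k f) :=
  StronglyMeasurable.integral_kernel hf

lemma norm_iter_le (k : ℕ) (hβ : ∀ z, ‖f z‖ ≤ β) (z : Z) : ‖iter P k f z‖ ≤ β := by
  have := norm_integral_le_of_norm_le_const (μ := (P ^ k) z) (ae_of_all _ hβ)
  simpa [iter] using this

variable [CompleteSpace F]

lemma iter_zero (hf : StronglyMeasurable f) : iter P 0 f = f := by
  ext z
  have : (P ^ 0) z = Measure.dirac z := by
    rw [pow_zero]; exact Kernel.id_apply z
  rw [iter, this, integral_dirac' _ _ hf]

lemma iter_one : iter P 1 f = fun z => ∫ y, f y ∂P z := by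
  ext z; rw [iter, pow_one]

lemma iter_iter (j k : ℕ) (hf : StronglyMeasurable f) (hβ : ∀ z, ‖f z‖ ≤ β) :
    iter P j (iter P k f) = iter P (j + k) f := by
  ext z
  have h : P ^ (j + k) = (P ^ k) ∘ₖ (P ^ j) := by
    rw [add_comm, pow_add]; rfl
  simp only [iter]
  rw [h, Kernel.integral_comp]
  rw [← h]
  exact integrable_of_norm_le hf hβ

/-- With `j` the Jordan decomposition of `μ - ν`, one has `μ + j⁻ = ν + j⁺` as measures, so the
integrals differ by those over the Jordan parts, whose masses add up to the total variation. -/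
lemma norm_integral_sub_le_totalVariation {μ ν : Measure Z} [IsProbabilityMeasure μ]
    [IsProbabilityMeasure ν] (hf : StronglyMeasurable f) (hβ : ∀ z, ‖f z‖ ≤ β) :
    ‖∫ y, f y ∂μ - ∫ y, f y ∂ν‖ ≤
      β * ((μ.toSignedMeasure - ν.toSignedMeasure).totalVariation Set.univ).toReal := by
  set s := μ.toSignedMeasure - ν.toSignedMeasure with hs
  set j := s.toJordanDecomposition with hj
  have hsj : j.posPart.toSignedMeasure - j.negPart.toSignedMeasure = s :=
    SignedMeasure.toSignedMeasure_toJordanDecomposition s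
  have hsum : μ + j.negPart = ν + j.posPart := by
    rw [← Measure.toSignedMeasure_eq_toSignedMeasure_iff, Measure.toSignedMeasure_add,
      Measure.toSignedMeasure_add]
    rw [hs, sub_eq_sub_iff_add_eq_add] at hsj
    rw [add_comm, add_comm ν.toSignedMeasure, ← hsj.symm, add_comm]
  have hi : ∀ (ρ : Measure Z) [IsFiniteMeasure ρ], Integrable f ρ := fun ρ _ =>
    integrable_of_norm_le hf hβ
  have heq : ∫ y, f y ∂μ - ∫ y, f y ∂ν = ∫ y, f y ∂j.posPart - ∫ y, f y ∂j.negPart := by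
    have := congrArg (fun ρ => ∫ y, f y ∂ρ) hsum
    simp only [integral_add_measure (hi _) (hi _)] at this
    rw [sub_eq_sub_iff_add_eq_add, this, add_comm]
  rw [heq]
  have h1 := norm_integral_le_of_norm_le_const (μ := j.posPart) (ae_of_all _ hβ)
  have h2 := norm_integral_le_of_norm_le_const (μ := j.negPart) (ae_of_all _ hβ)
  have htv : (s.totalVariation Set.univ).toReal
      = j.posPart.real Set.univ + j.negPart.real Set.univ := by
    rw [SignedMeasure.totalVariation, Measure.add_apply, ENNReal.toReal_add] <;>
      simp [Measure.real, ← hj]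
  rw [htv, mul_add]
  exact (norm_sub_le _ _).trans (add_le_add h1 h2)

lemma norm_integral_sub_le_dobrushin (hf : StronglyMeasurable f) (hβ : ∀ z, ‖f z‖ ≤ β)
    {r : ℝ≥0∞} (hr : dobrushin P ≤ r) (hr' : r ≠ ∞) (z z' : Z) :
    ‖∫ y, f y ∂P z - ∫ y, f y ∂P z'‖ ≤ 2 * r.toReal * β := by
  have hβ0 : 0 ≤ β := (norm_nonneg _).trans (hβ z)
  refine (norm_integral_sub_le_totalVariation hf hβ).trans ?_
  have h1 : (1 / 2) * ((P z).toSignedMeasure - (P z').toSignedMeasure).totalVariation Set.univ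
      ≤ r := (le_iSup₂ (f := fun z z' => (1 / 2) *
        ((P z).toSignedMeasure - (P z').toSignedMeasure).totalVariation Set.univ) z z').trans hr
  have h2 := ENNReal.toReal_mono hr' h1
  rw [ENNReal.toReal_mul] at h2
  norm_num at h2
  nlinarith

variable {π : Measure Z} [IsProbabilityMeasure π] {t : ℕ}

lemma invariant_pow (h : Kernel.Invariant P π) (k : ℕ) : Kernel.Invariant (P ^ k) π := by
  induction k with
  | zero =>
    rw [pow_zero]
    exact Measure.id_comp
  | succ k ih =>
    rw [pow_succ]
    exact ih.comp h

/-- By invariance `P^k f` has `π`-mean zero too, so `P^k f (z)` is the `π`-average over `z'` of `P^k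
f (z) - P^k f (z')`, which the Dobrushin coefficient controls. -/
lemma norm_iter_le_of_integral_eq_zero (hP : UniformlyErgodic P π t) (hf : StronglyMeasurable f)
    (hβ : ∀ z, ‖f z‖ ≤ β) (hπ : ∫ z, f z ∂π = 0) (k : ℕ) (z : Z) :
    ‖iter P k f z‖ ≤ 2 * β * (1 / 4) ^ (k / t) := by
  have hβ0 : 0 ≤ β := (norm_nonneg _).trans (hβ z)
  rcases Nat.eq_zero_or_pos k with rfl | hk
  -- The mixing hypothesis starts at `k = 1`; for `k = 0` the sup bound suffices.
  · refine (norm_iter_le 0 hβ z).trans ?_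
    simp; linarith
  · have hd : ∀ z', ‖iter P k f z - iter P k f z'‖ ≤ 2 * β * (1 / 4) ^ (k / t) := fun z' => by
      have := norm_integral_sub_le_dobrushin (P := P ^ k) hf hβ (hP.mixing k hk)
        (ENNReal.pow_ne_top (by simp)) z z'
      refine this.trans (le_of_eq ?_)
      rw [ENNReal.toReal_pow]
      simp; ring
    have hint : ∫ z', iter P k f z' ∂π = 0 := by
      have hinv : (P ^ k) ∘ₘ π = π := invariant_pow hP.invariant k
      rw [← hπ]
      conv_rhs => rw [← hinv]
      rw [Measure.comp_eq_comp_const_apply, Kernel.integral_comp]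
      · rfl
      · rw [← Measure.comp_eq_comp_const_apply, hinv]; exact integrable_of_norm_le hf hβ
    have : iter P k f z = ∫ z', (iter P k f z - iter P k f z') ∂π := by
      rw [integral_sub (integrable_const _)
        (integrable_of_norm_le (stronglyMeasurable_iter k hf) (norm_iter_le k hβ)), hint]
      simp
    rw [this]
    have := norm_integral_le_of_norm_le_const (μ := π) (ae_of_all _ hd)
    simpa using this

lemma sum_range_mul_add {M : Type*} [AddCommMonoid M] (g : ℕ → M) (t N : ℕ) :
    ∑ i ∈ Finset.range (t * N), g i =
      ∑ q ∈ Finset.range N, ∑ r ∈ Finset.range t, g (t * q + r) := by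
  induction N with
  | zero => simp
  | succ N ih => rw [Nat.mul_succ, Finset.sum_range_add, ih, Finset.sum_range_succ]

/-- The quotient `k / t` takes each value `t` times, so this is at most `t` times the geometric
series of ratio `1/4`. -/
lemma sum_geom_div_le (ht : 1 ≤ t) (N : ℕ) :
    ∑ k ∈ Finset.range N, (1 / 4 : ℝ) ^ (k / t) ≤ 4 / 3 * t := by
  have h1 : ∑ k ∈ Finset.range N, (1 / 4 : ℝ) ^ (k / t)
      ≤ ∑ k ∈ Finset.range (t * N), (1 / 4 : ℝ) ^ (k / t) :=
    Finset.sum_le_sum_of_subset_of_nonneg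
      (Finset.range_mono (Nat.le_mul_of_pos_left N ht)) fun _ _ _ => by positivity
  refine h1.trans ?_
  rw [sum_range_mul_add]
  have h2 : ∀ q ∈ Finset.range N, ∑ r ∈ Finset.range t, (1 / 4 : ℝ) ^ ((t * q + r) / t)
      = t * (1 / 4 : ℝ) ^ q := fun q _ => by
    rw [Finset.sum_congr rfl (g := fun _ => (1 / 4 : ℝ) ^ q)]
    · simp
    · intro r hr
      rw [Nat.mul_add_div ht, Nat.div_eq_of_lt (Finset.mem_range.1 hr), add_zero]
  rw [Finset.sum_congr rfl h2, ← Finset.mul_sum, geom_sum_eq (by norm_num)]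
  have e : ((1 / 4 : ℝ) ^ N - 1) / (1 / 4 - 1) = 4 / 3 * (1 - (1 / 4) ^ N) := by ring
  rw [e]
  have : (0 : ℝ) ≤ (1 / 4) ^ N := by positivity
  have ht0 : (0 : ℝ) ≤ t := by positivity
  nlinarith

/-- The solution `G = ∑_{k ≥ 0} P^k f` of the Poisson equation `G - P G = f`, with `K = P G`. -/
lemma exists_poisson (hP : UniformlyErgodic P π t) (hf : StronglyMeasurable f)
    (hβ : ∀ z, ‖f z‖ ≤ β) (hπ : ∫ z, f z ∂π = 0) :
    ∃ K : Z → F, StronglyMeasurable K ∧ (∀ z, ‖K z‖ ≤ 3 * t * β) ∧ (∀ z, ‖f z + K z‖ ≤ 3 * t * β) ∧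
      iter P 1 (fun z => f z + K z) = K := by
  have ht : 1 ≤ t := hP.one_le
  obtain ⟨z₀⟩ : Nonempty Z := nonempty_of_isProbabilityMeasure π
  have hβ0 : 0 ≤ β := (norm_nonneg _).trans (hβ z₀)
  have hb : ∀ k z, ‖iter P k f z‖ ≤ 2 * β * (1 / 4) ^ (k / t) := fun k z =>
    norm_iter_le_of_integral_eq_zero hP hf hβ hπ k z
  have hsum0 : Summable fun k : ℕ => (1 / 4 : ℝ) ^ (k / t) :=
    summable_of_sum_range_le (fun _ => by positivity) (sum_geom_div_le ht)
  have hsumb : Summable fun k : ℕ => 2 * β * (1 / 4 : ℝ) ^ (k / t) := hsum0.mul_left _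
  -- The sum is at most `2β · (4/3)t = (8/3)tβ`, rounded up.
  have htsum : ∑' k : ℕ, 2 * β * (1 / 4 : ℝ) ^ (k / t) ≤ 3 * t * β := by
    rw [tsum_mul_left]
    have := hsum0.tsum_le_of_sum_range_le (sum_geom_div_le ht)
    have ht0 : (0 : ℝ) ≤ t * β := by positivity
    nlinarith
  have hsum : ∀ z, Summable fun k => iter P k f z := fun z =>
    Summable.of_norm_bounded hsumb fun k => hb k z
  have hG : ∀ z, ‖∑' k, iter P k f z‖ ≤ 3 * t * β := fun z =>
    (tsum_of_norm_bounded hsumb.hasSum fun k => hb k z).trans htsum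
  have hsucc : ∀ z, f z + ∑' k, iter P (k + 1) f z = ∑' k, iter P k f z := fun z => by
    rw [(hsum z).tsum_eq_zero_add, iter_zero hf]
  refine ⟨fun z => ∑' k, iter P (k + 1) f z, ?_, fun z => ?_, fun z => ?_, ?_⟩
  · refine stronglyMeasurable_of_tendsto Filter.atTop
      (f := fun N z => ∑ k ∈ Finset.range N, iter P (k + 1) f z)
      (fun N => ?_) ?_
    · exact Finset.stronglyMeasurable_fun_sum _ fun k _ => stronglyMeasurable_iter (k + 1) hf
    · rw [tendsto_pi_nhds]
      exact fun z => ((summable_nat_add_iff 1).2 (hsum z)).hasSum.tendsto_sum_nat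
  · refine (tsum_of_norm_bounded hsumb.hasSum fun k => (hb (k + 1) z).trans ?_).trans htsum
    have : (1 / 4 : ℝ) ^ ((k + 1) / t) ≤ (1 / 4) ^ (k / t) :=
      pow_le_pow_of_le_one (by norm_num) (by norm_num) (Nat.div_le_div_right (Nat.le_succ k))
    gcongr
  · rw [hsucc]; exact hG z
  · ext z
    simp only [hsucc]
    have : HasSum (fun k => ∫ y, iter P k f y ∂(P ^ 1) z) (∫ y, ∑' k, iter P k f y ∂(P ^ 1) z) := by
      refine hasSum_integral_of_summable_integral_norm
        (fun k => integrable_of_norm_le (stronglyMeasurable_iter k hf) (hb k)) ?_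
      refine Summable.of_nonneg_of_le (fun _ => integral_nonneg fun _ => norm_nonneg _)
        (fun k => ?_) hsumb
      have := integral_mono (μ := (P ^ 1) z)
        (integrable_of_norm_le (stronglyMeasurable_iter k hf) (hb k)).norm
        (integrable_const _) (hb k)
      simpa using this
    rw [iter, ← this.tsum_eq]
    refine tsum_congr fun k => ?_
    have := congrFun (iter_iter (P := P) 1 k hf hβ) z
    rw [add_comm] at this
    exact this

end KernelIterates

/-! ### The Markov property of the canonical chain -/

section MarkovProperty

open Filtration

variable {Z : Type*} [MeasurableSpace Z] {F : Type*} [NormedAddCommGroup F] [NormedSpace ℝ F]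
  [CompleteSpace F] {P : Kernel Z Z} [IsMarkovKernel P] {f : Z → F} {β : ℝ}
  {ξ : Measure Z} [IsProbabilityMeasure ξ]

instance : IsProbabilityMeasure (chainLaw P ξ) := by
  unfold chainLaw; infer_instance

/-- The natural filtration of the canonical process. -/
abbrev hist (Z : Type*) [MeasurableSpace Z] (n : ℕ) : MeasurableSpace (ℕ → Z) :=
  piLE (X := fun _ : ℕ => Z) n

lemma hist_le (n : ℕ) : hist Z n ≤ MeasurableSpace.pi := piLE.le n

lemma stronglyMeasurable_eval {k n : ℕ} (hk : k ≤ n) (hf : StronglyMeasurable f) :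
    StronglyMeasurable[hist Z n] fun z : ℕ → Z => f (z k) := by
  refine hf.comp_measurable ?_
  rw [hist, piLE_eq_comap_frestrictLe]
  have h1 : Measurable fun h : (i : Finset.Iic n) → Z => h ⟨k, Finset.mem_Iic.2 hk⟩ :=
    measurable_pi_apply _
  exact h1.comp (comap_measurable (Preorder.frestrictLe (π := fun _ : ℕ => Z) n))

/-- The joint law of the history up to `m` and the next state is the composition-product of the law
of the history with the kernel, so over an event of the history the last coordinate can be
integrated out first. -/
lemma condExp_one (m : ℕ) (hf : StronglyMeasurable f) (hβ : ∀ z, ‖f z‖ ≤ β) :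
    (chainLaw P ξ)[fun z => f (z (m + 1)) | hist Z m] =ᵐ[chainLaw P ξ]
      fun z => iter P 1 f (z m) := by
  symm
  have hfm : StronglyMeasurable fun z : ℕ → Z => f (z (m + 1)) :=
    hf.comp_measurable (measurable_pi_apply _)
  have hg := stronglyMeasurable_iter (P := P) 1 hf
  refine ae_eq_condExp_of_forall_setIntegral_eq (hist_le m)
    (integrable_of_norm_le hfm fun _ => hβ _)
    (fun s _ _ => (integrable_of_norm_le (β := β) (hg.comp_measurable (measurable_pi_apply _))
      fun z => norm_iter_le 1 hβ _).integrableOn) ?_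
    (stronglyMeasurable_eval le_rfl hg).aestronglyMeasurable
  rw [hist, piLE_eq_comap_frestrictLe]
  rintro - ⟨s, ms, rfl⟩ -
  set κ : (n : ℕ) → Kernel ((i : Finset.Iic n) → Z) Z := fun n =>
    P.comap (fun h : (i : Finset.Iic n) → Z => h ⟨n, Finset.mem_Iic.2 le_rfl⟩)
      (measurable_pi_apply _) with hκ
  have hmap := Kernel.map_frestrictLe_trajMeasure_compProd_eq_map_trajMeasure (X := fun _ => Z)
    (μ₀ := ξ) (κ := κ) (a := m)
  change (chainLaw P ξ).map _ ⊗ₘ _ = (chainLaw P ξ).map _ at hmap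
  have mr : Measurable (Preorder.frestrictLe (π := fun _ : ℕ => Z) m) := by fun_prop
  have e1 : ∫ z in Preorder.frestrictLe m ⁻¹' s, f (z (m + 1)) ∂chainLaw P ξ
      = ∫ q, (s ×ˢ Set.univ).indicator (fun q => f q.2) q
        ∂(chainLaw P ξ).map (fun x => (Preorder.frestrictLe m x, x (m + 1))) := by
    rw [integral_map (by fun_prop), ← integral_indicator (mr ms)]
    · refine integral_congr_ae (ae_of_all _ fun z => ?_)
      by_cases h : Preorder.frestrictLe m z ∈ s <;>
        simp only [Set.indicator, Set.mem_preimage, Set.mem_prod, Set.mem_univ, and_true, h]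
    · exact ((hf.comp_measurable measurable_snd).indicator
        (ms.prod MeasurableSet.univ)).aestronglyMeasurable
  rw [e1, ← hmap, Measure.integral_compProd]
  · have e2 : ∀ h : (i : Finset.Iic m) → Z,
        ∫ y, (s ×ˢ Set.univ).indicator (fun q : ((i : Finset.Iic m) → Z) × Z => f q.2) (h, y) ∂κ m h
          = s.indicator (fun h => iter P 1 f (h ⟨m, Finset.mem_Iic.2 le_rfl⟩)) h := by
      intro h
      by_cases hs : h ∈ s
      · simp only [Set.indicator, Set.mem_prod, hs, Set.mem_univ, and_true, if_true, iter_one]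
        rfl
      · simp [Set.indicator, hs]
    simp_rw [e2]
    rw [integral_map mr.aemeasurable, ← integral_indicator (mr ms)]
    · rfl
    · exact ((hg.comp_measurable (measurable_pi_apply _)).indicator ms).aestronglyMeasurable
  · refine integrable_of_norm_le (β := β) ((hf.comp_measurable measurable_snd).indicator
        (ms.prod MeasurableSet.univ)) fun q => ?_
    exact (norm_indicator_le_norm_self _ _).trans (hβ _)

/-- The Markov property. -/
lemma condExp_eval_add (m s : ℕ) (hf : StronglyMeasurable f) (hβ : ∀ z, ‖f z‖ ≤ β) :
    (chainLaw P ξ)[fun z => f (z (m + s)) | hist Z m] =ᵐ[chainLaw P ξ]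
      fun z => iter P s f (z m) := by
  induction s generalizing f with
  | zero =>
    rw [iter_zero hf]
    have h := stronglyMeasurable_eval (Z := Z) (le_refl m) hf
    exact Filter.EventuallyEq.of_eq (condExp_of_stronglyMeasurable (hist_le m) h
      (integrable_of_norm_le (h.mono (hist_le m)) fun _ => hβ _))
  | succ s ih =>
    have h1 := condExp_one (P := P) (ξ := ξ) (m + s) hf hβ
    have h2 := ih (stronglyMeasurable_iter (P := P) 1 hf) (norm_iter_le 1 hβ)
    rw [iter_iter s 1 hf hβ] at h2
    have h3 : (chainLaw P ξ)[(chainLaw P ξ)[fun z => f (z (m + s + 1)) | hist Z (m + s)] | hist Z m]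
        =ᵐ[chainLaw P ξ] (chainLaw P ξ)[fun z => f (z (m + s + 1)) | hist Z m] :=
      condExp_condExp_of_le (piLE.mono (Nat.le_add_right m s)) (hist_le _)
    exact h3.symm.trans ((condExp_congr_ae h1).trans h2)

/-- Centered increments of functions of the chain have vanishing conditional mean. -/
lemma condExp_eval_sub_iter (m s : ℕ) (hf : StronglyMeasurable f) (hβ : ∀ z, ‖f z‖ ≤ β) :
    (chainLaw P ξ)[fun z => f (z (m + s)) - iter P s f (z m) | hist Z m] =ᵐ[chainLaw P ξ] 0 := by
  have hg := stronglyMeasurable_eval (Z := Z) (le_refl m) (stronglyMeasurable_iter (P := P) s hf)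
  have i1 : Integrable (fun z : ℕ → Z => f (z (m + s))) (chainLaw P ξ) :=
    integrable_of_norm_le (hf.comp_measurable (measurable_pi_apply _)) fun _ => hβ _
  have i2 : Integrable (fun z : ℕ → Z => iter P s f (z m)) (chainLaw P ξ) :=
    integrable_of_norm_le (hg.mono (hist_le m)) fun _ => norm_iter_le s hβ _
  have h1 := condExp_sub i1 i2 (hist Z m)
  have h2 := condExp_of_stronglyMeasurable (hist_le m) hg i2
  filter_upwards [h1, condExp_eval_add (P := P) (ξ := ξ) m s hf hβ] with z e1 e2
  have e3 : (chainLaw P ξ)[fun z => f (z (m + s)) - iter P s f (z m) | hist Z m] z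
    = ((chainLaw P ξ)[fun z => f (z (m + s)) | hist Z m]
      - (chainLaw P ξ)[fun z => iter P s f (z m) | hist Z m]) z := e1
  rw [e3, Pi.sub_apply, e2, h2]
  simp

end MarkovProperty

/-! ### Contractive recursions driven by the chain -/

section Recursions

variable {Z : Type*} [MeasurableSpace Z] {P : Kernel Z Z} [IsMarkovKernel P]
  {ξ : Measure Z} [IsProbabilityMeasure ξ]
  {E : Type*} [NormedAddCommGroup E] [InnerProductSpace ℝ E] [CompleteSpace E]

/-- `√((2p+1)/x) W` is the fixed point of the one-step inequality: `A² = (1 - x)A² + (2p+1)W²`. -/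
lemma momentLE_of_martingale_recursion {p x W : ℝ} (hp : 2 ≤ p) (hx : 0 < x) (hW : 0 ≤ W)
    {B : E →L[ℝ] E} (hB : ∀ v, ‖B v‖ ^ 2 ≤ (1 - x) * ‖v‖ ^ 2) (hB1 : ∀ v, ‖B v‖ ≤ ‖v‖)
    {X Y : ℕ → (ℕ → Z) → E} {w : ℕ → (ℕ → Z) → ℝ} (h0 : ∀ z, X 0 z = 0)
    (hX : ∀ n z, X (n + 1) z = B (X n z) + Y n z)
    (mY : ∀ n, StronglyMeasurable[hist Z (n + 1)] (Y n))
    (mw : ∀ n, StronglyMeasurable[hist Z n] (w n)) (hYw : ∀ n z, ‖Y n z‖ ≤ w n z)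
    (hw : ∀ n, ∃ C, ∀ z, w n z ≤ C)
    (hY : ∀ n, (chainLaw P ξ)[Y n | hist Z n] =ᵐ[chainLaw P ξ] 0)
    (hwW : ∀ n, MomentLE (chainLaw P ξ) p W (w n)) (n : ℕ) :
    MomentLE (chainLaw P ξ) p (Real.sqrt ((2 * p + 1) / x) * W) (X n) := by
  have hgood : ∀ n, StronglyMeasurable[hist Z n] (X n) ∧ ∃ C, ∀ z, ‖X n z‖ ≤ C := by
    intro n
    induction n with
    | zero =>
      have : X 0 = fun _ => 0 := funext h0
      rw [this]
      exact ⟨stronglyMeasurable_const, 0, fun z => by simp⟩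
    | succ n ih =>
      obtain ⟨m1, C, hC⟩ := ih
      obtain ⟨C', hC'⟩ := hw n
      have : X (n + 1) = fun z => B (X n z) + Y n z := funext (hX n)
      rw [this]
      refine ⟨?_, C + C', fun z => (norm_add_le _ _).trans ?_⟩
      · exact (B.continuous.comp_stronglyMeasurable
          (m1.mono (Filtration.piLE.mono (Nat.le_succ n)))).add (mY n)
      · exact add_le_add ((hB1 _).trans (hC z)) ((hYw n z).trans (hC' z))
  -- If `1 - x < 0`, the contraction hypothesis forces the space to be trivial.
  have hρ : 0 ≤ 1 - x ∨ ∀ v : E, v = 0 := by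
    by_contra! h
    obtain ⟨h1, v, hv⟩ := h
    have h2 := hB v
    have h3 : 0 < ‖v‖ := norm_pos_iff.2 hv
    have : (1 - x) * ‖v‖ ^ 2 < 0 := mul_neg_of_neg_of_pos h1 (by positivity)
    nlinarith [sq_nonneg ‖B v‖]
  rcases hρ with hρ | htriv
  swap
  · have : X n = fun _ => 0 := funext fun z => htriv _
    rw [this]
    exact MomentLE.zero.mono (by positivity)
  induction n with
  | zero =>
    have : X 0 = fun _ => 0 := funext h0
    rw [this]
    exact MomentLE.zero.mono (by positivity)
  | succ n ih =>
    obtain ⟨m1, C, hC⟩ := hgood n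
    obtain ⟨C', hC'⟩ := hw n
    have hBn : ∀ z, ‖B (X n z)‖ ≤ Real.sqrt (1 - x) * ‖X n z‖ := fun z => by
      refine le_of_sq_le_sq ?_ (by positivity)
      rw [mul_pow, Real.sq_sqrt hρ]
      exact hB _
    have h := MomentLE.add_of_condExp_eq_zero (μ := chainLaw P ξ) hp
      (A := Real.sqrt (1 - x) * (Real.sqrt ((2 * p + 1) / x) * W)) (by positivity) hW
      (hist_le n) (B.continuous.comp_stronglyMeasurable m1) (mw n) ((mY n).mono (hist_le _))
      (C := max C C') (fun z => ((hB1 _).trans (hC z)).trans (le_max_left _ _))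
      (fun z => (hC' z).trans (le_max_right _ _)) (hYw n) (hY n)
      (ih.of_norm_le (Real.sqrt_nonneg _) hBn) (hwW n)
    have : X (n + 1) = fun z => B (X n z) + Y n z := funext (hX n)
    rw [this]
    refine h.mono (le_of_eq ?_)
    rw [mul_pow, mul_pow, Real.sq_sqrt hρ, Real.sq_sqrt (by positivity)]
    have : (1 - x) * ((2 * p + 1) / x * W ^ 2) + (2 * p + 1) * W ^ 2
        = (2 * p + 1) / x * W ^ 2 := by field_simp; ring
    rw [this, Real.sqrt_mul (by positivity), Real.sqrt_sq hW]

lemma momentLE_of_contraction {Ω : Type*} [MeasurableSpace Ω] {μ : Measure Ω} {p x D : ℝ}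
    (hp : 2 ≤ p) (hx : 0 < x) (hx1 : x ≤ 1) (hD : 0 ≤ D)
    {B : E →L[ℝ] E} (hB : ∀ v, ‖B v‖ ≤ (1 - x) * ‖v‖)
    {X Y : ℕ → Ω → E} (h0 : ∀ z, X 0 z = 0) (hX : ∀ n z, X (n + 1) z = B (X n z) + Y n z)
    (mY : ∀ n, StronglyMeasurable (Y n)) (hYD : ∀ n, MomentLE μ p D (Y n)) (n : ℕ) :
    MomentLE μ p (D / x) (X n) := by
  have mX : ∀ n, StronglyMeasurable (X n) := by
    intro n
    induction n with
    | zero =>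
      have : X 0 = fun _ => 0 := funext h0
      rw [this]; exact stronglyMeasurable_const
    | succ n ih =>
      have : X (n + 1) = fun z => B (X n z) + Y n z := funext (hX n)
      rw [this]; exact (B.continuous.comp_stronglyMeasurable ih).add (mY n)
  induction n with
  | zero =>
    have : X 0 = fun _ => 0 := funext h0
    rw [this]; exact MomentLE.zero.mono (by positivity)
  | succ n ih =>
    have : X (n + 1) = fun z => B (X n z) + Y n z := funext (hX n)
    rw [this]
    have h := (ih.of_norm_le (c := 1 - x) (by linarith) fun z => hB (X n z)).add (hYD n)
      (by linarith) (mul_nonneg (by linarith) (by positivity)) hD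
      (B.continuous.comp_stronglyMeasurable (mX n)).aestronglyMeasurable
      (mY n).aestronglyMeasurable
    refine h.mono (le_of_eq ?_)
    field_simp; ring

/-- The process `M` runs the recursion without `R`, and `X - M` is driven by `R` alone, where the
triangle inequality suffices. The drift is divided by `x/2` and the martingale part only by `√x`, so
`R` has to be of smaller order to be harmless. -/
lemma momentLE_of_recursion {p x W D : ℝ} (hp : 2 ≤ p) (hx : 0 < x) (hx1 : x ≤ 1) (hW : 0 ≤ W)
    (hD : 0 ≤ D) {B : E →L[ℝ] E} (hB : ∀ v, ‖B v‖ ^ 2 ≤ (1 - x) * ‖v‖ ^ 2)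
    {X Y R : ℕ → (ℕ → Z) → E} {w : ℕ → (ℕ → Z) → ℝ} (h0 : ∀ z, X 0 z = 0)
    (hX : ∀ n z, X (n + 1) z = B (X n z) + Y n z + R n z)
    (mY : ∀ n, StronglyMeasurable[hist Z (n + 1)] (Y n)) (mR : ∀ n, StronglyMeasurable (R n))
    (mw : ∀ n, StronglyMeasurable[hist Z n] (w n)) (hYw : ∀ n z, ‖Y n z‖ ≤ w n z)
    (hw : ∀ n, ∃ C, ∀ z, w n z ≤ C)
    (hY : ∀ n, (chainLaw P ξ)[Y n | hist Z n] =ᵐ[chainLaw P ξ] 0)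
    (hwW : ∀ n, MomentLE (chainLaw P ξ) p W (w n))
    (hRD : ∀ n, MomentLE (chainLaw P ξ) p D (R n)) (n : ℕ) :
    MomentLE (chainLaw P ξ) p (Real.sqrt ((2 * p + 1) / x) * W + D / (x / 2)) (X n) := by
  have hBc : ∀ v, ‖B v‖ ≤ (1 - x / 2) * ‖v‖ := fun v => by
    refine le_of_sq_le_sq ((hB v).trans ?_) (mul_nonneg (by linarith) (norm_nonneg _))
    rw [mul_pow]
    gcongr
    nlinarith [sq_nonneg x]
  have hB1 : ∀ v, ‖B v‖ ≤ ‖v‖ := fun v => by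
    have := norm_nonneg v
    nlinarith [hBc v]
  let M : ℕ → (ℕ → Z) → E := fun n => n.rec (fun _ => 0) fun n Mn z => B (Mn z) + Y n z
  have hM0 : ∀ z, M 0 z = 0 := fun _ => rfl
  have hM : ∀ n z, M (n + 1) z = B (M n z) + Y n z := fun _ _ => rfl
  have mM : ∀ n, StronglyMeasurable (M n) := by
    intro n
    induction n with
    | zero => exact stronglyMeasurable_const
    | succ n ih =>
      exact (B.continuous.comp_stronglyMeasurable ih).add ((mY n).mono (hist_le _))
  have mX : ∀ n, StronglyMeasurable (X n) := by
    intro n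
    induction n with
    | zero =>
      have : X 0 = fun _ => 0 := funext h0
      rw [this]; exact stronglyMeasurable_const
    | succ n ih =>
      have : X (n + 1) = fun z => B (X n z) + Y n z + R n z := funext (hX n)
      rw [this]
      exact ((B.continuous.comp_stronglyMeasurable ih).add ((mY n).mono (hist_le _))).add (mR n)
  have h1 := momentLE_of_martingale_recursion hp hx hW hB hB1 hM0 hM mY mw hYw hw hY hwW n
  have h2 := momentLE_of_contraction (μ := chainLaw P ξ) hp (half_pos hx) (by linarith) hD hBc
    (X := fun n z => X n z - M n z) (fun z => by simp [h0, hM0])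
    (fun n z => by simp only [hX, hM, map_sub]; abel) mR hRD n
  have h3 := h1.add h2 (by linarith) (by positivity) (by positivity) (mM n).aestronglyMeasurable
    ((mX n).sub (mM n)).aestronglyMeasurable
  simpa using h3

end Recursions

/-! ### One level of the expansion, by the Poisson equation -/

section PoissonStep

variable {Z : Type*} [MeasurableSpace Z] {P : Kernel Z Z} [IsMarkovKernel P]
  {ξ : Measure Z} [IsProbabilityMeasure ξ] {π : Measure Z} [IsProbabilityMeasure π] {t : ℕ}
  {E : Type*} [NormedAddCommGroup E] [InnerProductSpace ℝ E] [CompleteSpace E]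

lemma stronglyMeasurable_clm_apply {Ω : Type*} {m : MeasurableSpace Ω} {L : Ω → E →L[ℝ] E}
    {U : Ω → E} (hL : StronglyMeasurable[m] L) (hU : StronglyMeasurable[m] U) :
    StronglyMeasurable[m] fun ω => L ω (U ω) :=
  Continuous.comp_stronglyMeasurable (g := fun q : (E →L[ℝ] E) × E => q.1 q.2) (by fun_prop)
    (hL.prodMk hU)

/-- The product of a centered increment of an operator-valued function of the chain with a bounded
past vector has vanishing conditional mean. -/
lemma condExp_clm_apply_eq_zero (m s : ℕ) {G : Z → E →L[ℝ] E} (hG : StronglyMeasurable G) {β : ℝ}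
    (hβ : ∀ z, ‖G z‖ ≤ β) {U : (ℕ → Z) → E} (mU : StronglyMeasurable[hist Z m] U) {C : ℝ}
    (hC : ∀ z, ‖U z‖ ≤ C) :
    (chainLaw P ξ)[fun z => (G (z (m + s)) - iter P s G (z m)) (U z) | hist Z m]
      =ᵐ[chainLaw P ξ] 0 := by
  set L : (ℕ → Z) → E →L[ℝ] E := fun z => G (z (m + s)) - iter P s G (z m) with hL
  have mL : StronglyMeasurable L :=
    (hG.comp_measurable (measurable_pi_apply _)).sub
      ((stronglyMeasurable_iter s hG).comp_measurable (measurable_pi_apply _))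
  have bL : ∀ z, ‖L z‖ ≤ β + β := fun z =>
    (norm_sub_le _ _).trans (add_le_add (hβ _) (norm_iter_le s hβ _))
  -- Evaluation is bilinear in vector and operator, so the past vector `U` is pulled out of the
  -- conditional expectation.
  have h := condExp_bilin_of_stronglyMeasurable_left (m := hist Z m) (μ := chainLaw P ξ)
    (ContinuousLinearMap.apply ℝ E : E →L[ℝ] (E →L[ℝ] E) →L[ℝ] E) mU (g := L)
    (by
      refine integrable_of_norm_le (β := (β + β) * C)
        (stronglyMeasurable_clm_apply mL (mU.mono (hist_le m))) fun z => ?_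
      refine ((L z).le_opNorm _).trans ?_
      have := (norm_nonneg _).trans (bL z)
      gcongr
      · exact bL z
      · exact hC z)
    (integrable_of_norm_le mL bL)
  simp only [ContinuousLinearMap.apply_apply] at h
  refine h.trans ?_
  filter_upwards [condExp_eval_sub_iter (P := P) (ξ := ξ) m s hG hβ] with z hz
  rw [show (chainLaw P ξ)[L | hist Z m] z = 0 from hz]
  simp

/-- Here `s = √(α/a)`, and `τ` stands for the norm of the mean operator. The three terms on the left
are the martingale part, the drift divided by half the contraction rate, and the corrector that is
added back. With `√(2p+1) ≤ 1.6√p`, `1.4 ≤ √p` and `α ≤ 0.75 s`, the coefficients of `√p s k u` add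
up to `9.6 + 12/1.4 + 2.25/1.4 < 20`. -/
lemma poisson_step_const_le {p α a τ s : ℝ} (hp : 2 ≤ p) (hs : 0 ≤ s) (ha : 0 < a)
    (hα : α = s ^ 2 * a) (hαa : α * a ≤ 1 / 2) (hτ : α * τ ≤ a * s) {k u r : ℝ} (hk : 0 ≤ k)
    (hu : 0 ≤ u) :
    √(2 * p + 1) * s * (6 * (k * u)) + 2 / (α * a) * (α ^ 2 * (6 * τ * (k * u) + 3 * (k * r)))
      + 3 * α * (k * u) ≤ 20 * √p * s * (k * u) + 6 * (α / a) * (k * r) := by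
  have hku : 0 ≤ k * u := by positivity
  have h1 : √(2 * p + 1) ≤ 1.6 * √p := by
    rw [Real.sqrt_le_left (by positivity), mul_pow, Real.sq_sqrt (by linarith)]
    linarith
  have h2 : 1.4 ≤ √p := by
    apply Real.le_sqrt_of_sq_le; linarith
  have h3 : a * s ≤ 0.75 := by
    have : (a * s) ^ 2 ≤ 0.75 ^ 2 := by
      calc (a * s) ^ 2 = α * a := by rw [hα]; ring
        _ ≤ 0.75 ^ 2 := by norm_num at *; linarith
    exact le_of_sq_le_sq this (by norm_num)
  rcases eq_or_lt_of_le hs with h0 | hs0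
  · subst h0
    have : α = 0 := by rw [hα]; ring
    simp [this]
  have hα0 : 0 < α := by rw [hα]; positivity
  have e : 2 / (α * a) * (α ^ 2 * (6 * τ * (k * u) + 3 * (k * r)))
      = 12 * (α * τ / a) * (k * u) + 6 * (α / a) * (k * r) := by
    field_simp; ring
  rw [e]
  have h4 : α * τ / a ≤ s := by rw [div_le_iff₀ ha]; linarith
  have h5 : α ≤ 0.75 * s := by rw [hα]; nlinarith
  have h6 : √(2 * p + 1) * s * 6 + 12 * (α * τ / a) + 3 * α ≤ 20 * √p * s := by
    nlinarith [mul_le_mul_of_nonneg_right h1 hs, mul_le_mul_of_nonneg_right h2 hs]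
  nlinarith [mul_le_mul_of_nonneg_right h6 hku]

/-- If `V` is driven by `Ã(Z_n) U_{n-1}` for a slowly varying `U`, then `V` gains a factor
`√(α / a)` on `U`. -/
lemma momentLE_poisson_step (hP : UniformlyErgodic P π t) {p α a c u r : ℝ} (hp : 2 ≤ p)
    (hα : 0 < α) (ha : 0 < a) (hαa : α * a ≤ 1 / 2) (hu : 0 ≤ u) (hr : 0 ≤ r)
    {Ab : E →L[ℝ] E} (hB : ∀ v, ‖v - α • Ab v‖ ^ 2 ≤ (1 - α * a) * ‖v‖ ^ 2)
    (hAb : α * ‖Ab‖ ^ 2 ≤ a) {At : Z → E →L[ℝ] E} (mAt : StronglyMeasurable At)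
    (hAt : ∀ z, ‖At z‖ ≤ c) (hπ : ∫ z, At z ∂π = 0) {U V R : ℕ → (ℕ → Z) → E}
    (mU : ∀ n, StronglyMeasurable[hist Z n] (U n)) (bU : ∀ n, ∃ C, ∀ z, ‖U n z‖ ≤ C)
    (mV : ∀ n, StronglyMeasurable[hist Z n] (V n))
    (mR : ∀ n, StronglyMeasurable (R n)) (U0 : ∀ z, U 0 z = 0) (V0 : ∀ z, V 0 z = 0)
    (hU : ∀ n z, U (n + 1) z = U n z - α • Ab (U n z) - α • R n z)
    (hV : ∀ n z, V (n + 1) z = V n z - α • Ab (V n z) - α • At (z (n + 1)) (U n z))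
    (hUu : ∀ n, MomentLE (chainLaw P ξ) p u (U n))
    (hRr : ∀ n, MomentLE (chainLaw P ξ) p r (R n)) (n : ℕ) :
    MomentLE (chainLaw P ξ) p
      (20 * √p * √(α / a) * (t * c * u) + 6 * (α / a) * (t * c * r)) (V n) := by
  obtain ⟨z₀⟩ : Nonempty Z := nonempty_of_isProbabilityMeasure π
  have hc : 0 ≤ c := (norm_nonneg _).trans (hAt z₀)
  obtain ⟨K, mK, bK, bG, hK⟩ := exists_poisson hP mAt hAt hπ
  set k : ℝ := t * c with hk
  have hk0 : 0 ≤ k := by positivity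
  have bK' : ∀ z, ‖K z‖ ≤ 3 * k := fun z => (bK z).trans (by rw [hk, mul_assoc])
  have bG' : ∀ z, ‖At z + K z‖ ≤ 3 * k := fun z => (bG z).trans (by rw [hk, mul_assoc])
  have mG : StronglyMeasurable fun z => At z + K z := mAt.add mK
  have ev : ∀ (j : ℕ), Measurable fun z : ℕ → Z => z j := fun j => measurable_pi_apply j
  have mU' : ∀ n, StronglyMeasurable (U n) := fun n => (mU n).mono (hist_le n)
  set B : E →L[ℝ] E := ContinuousLinearMap.id ℝ E - α • Ab with hBdef
  have hBv : ∀ v, B v = v - α • Ab v := fun v => by simp [hBdef]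
  -- Since `K = P(At + K)`, `At(z_{n+1}) = [(At + K)(z_{n+1}) - K(z_n)] - [K(z_{n+1}) - K(z_n)]`.
  -- The first bracket gives the martingale increment `Y`. The second telescopes: subtracting the
  -- corrector `α K(z_n) U_n` from `V_n` leaves only the `α²` terms `D`, because `U` moves by `O(α)`
  -- in one step.
  let X : ℕ → (ℕ → Z) → E := fun n z => V n z - α • K (z n) (U n z)
  let Y : ℕ → (ℕ → Z) → E := fun n z =>
    (-α) • ((At (z (n + 1)) + K (z (n + 1))) - iter P 1 (fun z => At z + K z) (z n)) (U n z)
  let D : ℕ → (ℕ → Z) → E := fun n z =>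
    α ^ 2 • (K (z (n + 1)) (Ab (U n z)) - Ab (K (z n) (U n z)) + K (z (n + 1)) (R n z))
  let w : ℕ → (ℕ → Z) → ℝ := fun n z => α * (6 * k) * ‖U n z‖
  have hX : ∀ n z, X (n + 1) z = B (X n z) + Y n z + D n z := fun n z => by
    simp only [X, Y, D, hBv, hV, hK]
    rw [hU]
    simp only [map_sub, map_smul, smul_sub, smul_add, sub_apply,
      add_apply, neg_smul, smul_smul, pow_two]
    abel
  have hX0 : ∀ z, X 0 z = 0 := fun z => by simp [X, U0, V0]
  have mDiff : ∀ n, StronglyMeasurable[hist Z (n + 1)] fun z : ℕ → Z =>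
      (At (z (n + 1)) + K (z (n + 1))) - iter P 1 (fun z => At z + K z) (z n) := fun n =>
    (stronglyMeasurable_eval le_rfl mG).sub
      (stronglyMeasurable_eval (Nat.le_succ n) (stronglyMeasurable_iter 1 mG))
  have mY : ∀ n, StronglyMeasurable[hist Z (n + 1)] (Y n) := fun n =>
    (stronglyMeasurable_clm_apply (mDiff n)
      ((mU n).mono (Filtration.piLE.mono (Nat.le_succ n)))).const_smul (-α)
  have mKU : ∀ j n, ∀ W : (ℕ → Z) → E, StronglyMeasurable W →
      StronglyMeasurable fun z : ℕ → Z => K (z (n + j)) (W z) := fun j n W hW =>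
    stronglyMeasurable_clm_apply (mK.comp_measurable (ev _)) hW
  have mD1 : ∀ n, StronglyMeasurable fun z => K (z (n + 1)) (Ab (U n z)) := fun n =>
    mKU 1 n _ (Ab.continuous.comp_stronglyMeasurable (mU' n))
  have mD2 : ∀ n, StronglyMeasurable fun z => Ab (K (z n) (U n z)) := fun n =>
    Ab.continuous.comp_stronglyMeasurable (mKU 0 n _ (mU' n))
  have mD3 : ∀ n, StronglyMeasurable fun z => K (z (n + 1)) (R n z) := fun n => mKU 1 n _ (mR n)
  have mD : ∀ n, StronglyMeasurable (D n) := fun n =>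
    (((mD1 n).sub (mD2 n)).add (mD3 n)).const_smul _
  have mw : ∀ n, StronglyMeasurable[hist Z n] (w n) := fun n => (mU n).norm.const_mul _
  have hYw : ∀ n z, ‖Y n z‖ ≤ w n z := fun n z => by
    simp only [Y, w, norm_smul, norm_neg, Real.norm_eq_abs, abs_of_pos hα, mul_assoc]
    gcongr
    refine (ContinuousLinearMap.le_opNorm _ _).trans ?_
    rw [← mul_assoc]
    gcongr
    refine (norm_sub_le _ _).trans ?_
    have := norm_iter_le (P := P) 1 bG' (z n)
    linarith [bG' (z (n + 1))]
  have bw : ∀ n, ∃ C, ∀ z, w n z ≤ C := fun n => by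
    obtain ⟨C, hC⟩ := bU n
    exact ⟨α * (6 * k) * C, fun z => mul_le_mul_of_nonneg_left (hC z) (by positivity)⟩
  have hY : ∀ n, (chainLaw P ξ)[Y n | hist Z n] =ᵐ[chainLaw P ξ] 0 := fun n => by
    obtain ⟨C, hC⟩ := bU n
    have h1 := condExp_clm_apply_eq_zero (P := P) (ξ := ξ) n 1 mG bG' (mU n) hC
    refine (condExp_smul (-α) _ (hist Z n)).trans ?_
    filter_upwards [h1] with z hz
    simp only [Pi.smul_apply]
    rw [show _ = (0 : E) from hz]
    simp
  have hwW : ∀ n, MomentLE (chainLaw P ξ) p (α * (6 * k) * u) (w n) := fun n =>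
    (hUu n).of_norm_le (by positivity) fun z => by
      simp only [w]
      rw [Real.norm_of_nonneg (by positivity)]
  have hD : ∀ n, MomentLE (chainLaw P ξ) p (α ^ 2 * (6 * ‖Ab‖ * (k * u) + 3 * (k * r))) (D n) := by
    intro n
    have hτ := norm_nonneg Ab
    have g1 : MomentLE (chainLaw P ξ) p ((3 * k * ‖Ab‖) * u) fun z => K (z (n + 1)) (Ab (U n z)) :=
      (hUu n).of_norm_le (by positivity) fun z => by
        refine (ContinuousLinearMap.le_opNorm _ _).trans ?_
        rw [mul_assoc]
        exact mul_le_mul (bK' _) (Ab.le_opNorm _) (norm_nonneg _) (by positivity)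
    have g2 : MomentLE (chainLaw P ξ) p ((3 * k * ‖Ab‖) * u) fun z => -Ab (K (z n) (U n z)) :=
      (hUu n).of_norm_le (by positivity) fun z => by
        rw [norm_neg]
        refine (Ab.le_opNorm _).trans ?_
        rw [mul_comm (3 * k), mul_assoc]
        gcongr
        exact (ContinuousLinearMap.le_opNorm _ _).trans (by gcongr; exact bK' _)
    have g3 : MomentLE (chainLaw P ξ) p ((3 * k) * r) fun z => K (z (n + 1)) (R n z) :=
      (hRr n).of_norm_le (by positivity) fun z =>
        (ContinuousLinearMap.le_opNorm _ _).trans (by gcongr; exact bK' _)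
    have g := (g1.add g2 (by linarith) (by positivity) (by positivity)
      (mD1 n).aestronglyMeasurable (mD2 n).neg.aestronglyMeasurable).add g3 (by linarith)
      (by positivity) (by positivity)
      ((mD1 n).add (mD2 n).neg).aestronglyMeasurable (mD3 n).aestronglyMeasurable
    refine (g.of_norm_le (Y := D n) (c := α ^ 2) (by positivity) fun z => ?_).mono (le_of_eq ?_)
    · simp only [D, norm_smul, ← sub_eq_add_neg]
      rw [Real.norm_of_nonneg (by positivity)]
    · ring
  have hmain := momentLE_of_recursion (P := P) (ξ := ξ) hp (x := α * a) (by positivity)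
    (by linarith) (W := α * (6 * k) * u) (D := α ^ 2 * (6 * ‖Ab‖ * (k * u) + 3 * (k * r))) (by positivity)
    (by positivity) (B := B) (fun v => by rw [hBv]; exact hB v) hX0 hX mY mD mw hYw bw hY hwW hD n
  have hbd : MomentLE (chainLaw P ξ) p ((α * (3 * k)) * u) fun z => α • K (z n) (U n z) :=
    (hUu n).of_norm_le (by positivity) fun z => by
      rw [norm_smul, Real.norm_of_nonneg hα.le, mul_assoc]
      gcongr
      exact (ContinuousLinearMap.le_opNorm _ _).trans (by gcongr; exact bK' _)
  have mKn : StronglyMeasurable fun z => α • K (z n) (U n z) := (mKU 0 n _ (mU' n)).const_smul _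
  have hfin := hmain.add hbd (by linarith) (by positivity) (by positivity)
    (((mV n).mono (hist_le n)).sub mKn).aestronglyMeasurable mKn.aestronglyMeasurable
  have hVX : (fun z => X n z + α • K (z n) (U n z)) = V n := by
    ext z; simp [X]
  rw [hVX] at hfin
  refine hfin.mono ?_
  set s := √(α / a) with hs
  have hs2 : α = s ^ 2 * a := by rw [hs, Real.sq_sqrt (by positivity)]; field_simp
  -- The bound `α‖Ab‖² ≤ a` keeps the drift comparable with the martingale part.
  have hτ : α * ‖Ab‖ ≤ a * s := by
    refine le_of_sq_le_sq ?_ (by positivity)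
    calc (α * ‖Ab‖) ^ 2 = α * (α * ‖Ab‖ ^ 2) := by ring
      _ ≤ α * a := by gcongr
      _ = (a * s) ^ 2 := by rw [hs2]; ring
  have hc := poisson_step_const_le hp (Real.sqrt_nonneg _) ha hs2 hαa hτ (r := r) hk0 hu
  refine le_trans (le_of_eq ?_) hc
  have e1 : √((2 * p + 1) / (α * a)) * α = √(2 * p + 1) * s := by
    rw [hs, Real.sqrt_div (by positivity), Real.sqrt_div hα.le, Real.sqrt_mul hα.le]
    have h1 : √α ≠ 0 := (Real.sqrt_pos.2 hα).ne'
    have h2 : √a ≠ 0 := (Real.sqrt_pos.2 ha).ne'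
    field_simp
    rw [Real.sq_sqrt hα.le]
  have e2 : √((2 * p + 1) / (α * a)) * (α * (6 * k) * u) = √(2 * p + 1) * s * (6 * (k * u)) := by
    rw [← e1]; ring
  rw [e2, hs]
  field_simp

end PoissonStep

/-! ### The linear recursion driven by a centered function of the chain -/

section LinearPart

variable {Z : Type*} [MeasurableSpace Z] {P : Kernel Z Z} [IsMarkovKernel P]
  {ξ : Measure Z} [IsProbabilityMeasure ξ] {π : Measure Z} [IsProbabilityMeasure π] {t : ℕ}
  {E : Type*} [NormedAddCommGroup E] [InnerProductSpace ℝ E] [CompleteSpace E]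

/-- The weighted sum `∑_{i < n} B^i f(z_{n-i})`. -/
noncomputable def wsum (B : E →L[ℝ] E) (f : Z → E) (n : ℕ) (z : ℕ → Z) : E :=
  ∑ i ∈ Finset.range n, (B ^ i) (f (z (n - i)))

/-- The centered `t`-step increment `f(z_k) - P^t f(z_{k-t})`, put to zero for `k < t`. -/
noncomputable def lagDiff (P : Kernel Z Z) (t : ℕ) (f : Z → E) (k : ℕ) (z : ℕ → Z) : E :=
  if t ≤ k then f (z k) - iter P t f (z (k - t)) else 0

/-- The weighted sum of the `t`-step increments along a residue class modulo `t`. -/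
noncomputable def lagSum (P : Kernel Z Z) (t : ℕ) (B : E →L[ℝ] E) (f : Z → E) (N k : ℕ)
    (z : ℕ → Z) : E :=
  ∑ q ∈ Finset.range N, (B ^ (t * q)) (lagDiff P t f (k - t * q) z)

variable {B : E →L[ℝ] E} {f : Z → E} {β : ℝ}

lemma lagSum_succ (N k : ℕ) (z : ℕ → Z) :
    lagSum P t B f (N + 1) k z = (B ^ t) (lagSum P t B f N (k - t) z) + lagDiff P t f k z := by
  unfold lagSum
  rw [Finset.sum_range_succ', map_sum]
  congr 1
  · refine Finset.sum_congr rfl fun q _ => ?_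
    rw [← mul_apply_eq_comp, ← pow_add, Nat.sub_sub]
    congr 2 <;> ring_nf

lemma norm_lagDiff_le (hβ : ∀ z, ‖f z‖ ≤ β) (k : ℕ) (z : ℕ → Z) :
    ‖lagDiff P t f k z‖ ≤ 2 * β := by
  unfold lagDiff
  split_ifs
  · refine (norm_sub_le _ _).trans ?_
    linarith [hβ (z k), norm_iter_le (P := P) t hβ (z (k - t))]
  · have := (norm_nonneg _).trans (hβ (z k))
    simpa using this

lemma stronglyMeasurable_lagDiff (hf : StronglyMeasurable f) (k : ℕ) :
    StronglyMeasurable[hist Z k] (lagDiff P t f k) := by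
  unfold lagDiff
  split_ifs
  · exact (stronglyMeasurable_eval le_rfl hf).sub
      (stronglyMeasurable_eval (Nat.sub_le k t) (stronglyMeasurable_iter t hf))
  · exact stronglyMeasurable_const

lemma condExp_lagDiff (hf : StronglyMeasurable f) (hβ : ∀ z, ‖f z‖ ≤ β) (k : ℕ) :
    (chainLaw P ξ)[lagDiff P t f k | hist Z (k - t)] =ᵐ[chainLaw P ξ] 0 := by
  by_cases h : t ≤ k
  · have h1 := condExp_eval_sub_iter (P := P) (ξ := ξ) (k - t) t hf hβ
    rw [Nat.sub_add_cancel h] at h1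
    have : lagDiff P t f k = fun z => f (z k) - iter P t f (z (k - t)) := by
      ext z; simp [lagDiff, h]
    rw [this]; exact h1
  · have : lagDiff P t f k = 0 := by
      ext z; simp [lagDiff, h]
    rw [this]
    exact Filter.EventuallyEq.of_eq condExp_zero

lemma stronglyMeasurable_lagSum (hf : StronglyMeasurable f) (N k : ℕ) :
    StronglyMeasurable[hist Z k] (lagSum P t B f N k) := by
  unfold lagSum
  refine Finset.stronglyMeasurable_fun_sum _ fun q _ => ?_
  exact (B ^ (t * q)).continuous.comp_stronglyMeasurable
    ((stronglyMeasurable_lagDiff hf _).mono (Filtration.piLE.mono (Nat.sub_le _ _)))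

lemma norm_pow_apply_le (hB1 : ∀ v, ‖B v‖ ≤ ‖v‖) (i : ℕ) (v : E) : ‖(B ^ i) v‖ ≤ ‖v‖ := by
  induction i generalizing v with
  | zero => simp
  | succ i ih =>
    rw [pow_succ, mul_apply_eq_comp]
    exact (ih _).trans (hB1 v)

/-- Along one residue class modulo `t` the increments are martingale differences: all that precedes
`lagDiff P t f k` is known at time `k - t`. The bound is again the fixed point of the one-step
inequality, with contraction rate `y` per `t` steps. -/
lemma momentLE_lagSum {p y : ℝ} (hp : 2 ≤ p) (hy : 0 < y) (hy1 : y ≤ 1)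
    (hB1 : ∀ v, ‖B v‖ ≤ ‖v‖) (hB : ∀ v, ‖(B ^ t) v‖ ^ 2 ≤ (1 - y) * ‖v‖ ^ 2)
    (hf : StronglyMeasurable f) (hβ : ∀ z, ‖f z‖ ≤ β) (hβ0 : 0 ≤ β) (N k : ℕ) :
    MomentLE (chainLaw P ξ) p (√((2 * p + 1) / y) * (2 * β)) (lagSum P t B f N k) := by
  induction N generalizing k with
  | zero =>
    have : lagSum P t B f 0 k = fun _ => 0 := by ext z; simp [lagSum]
    rw [this]; exact MomentLE.zero.mono (by positivity)
  | succ N ih =>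
    have hBn : ∀ v, ‖(B ^ t) v‖ ≤ √(1 - y) * ‖v‖ := fun v => by
      refine le_of_sq_le_sq ?_ (by positivity)
      rw [mul_pow, Real.sq_sqrt (by linarith)]
      exact hB v
    have hbd : ∀ z, ‖lagSum P t B f N (k - t) z‖ ≤ N * (2 * β) := fun z => by
      unfold lagSum
      refine (norm_sum_le _ _).trans ?_
      refine (Finset.sum_le_card_nsmul _ _ (2 * β) fun q _ => ?_).trans (by simp)
      exact (norm_pow_apply_le hB1 _ _).trans (norm_lagDiff_le hβ _ _)
    have h := MomentLE.add_of_condExp_eq_zero (μ := chainLaw P ξ) hp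
      (A := √(1 - y) * (√((2 * p + 1) / y) * (2 * β))) (W := 2 * β) (by positivity) (by positivity)
      (hist_le (k - t)) ((B ^ t).continuous.comp_stronglyMeasurable
        (stronglyMeasurable_lagSum (P := P) (t := t) (B := B) hf N (k - t)))
      (w := fun _ => 2 * β) stronglyMeasurable_const
      ((stronglyMeasurable_lagDiff (P := P) (t := t) hf k).mono (hist_le k))
      (C := max (N * (2 * β)) (2 * β))
      (fun z => ((norm_pow_apply_le hB1 _ _).trans (hbd z)).trans (le_max_left _ _))
      (fun z => le_max_right _ _) (norm_lagDiff_le hβ k) (condExp_lagDiff hf hβ k)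
      ((ih (k - t)).of_norm_le (Real.sqrt_nonneg _) fun z => hBn _)
      (MomentLE.of_bound fun z => by rw [Real.norm_of_nonneg (by positivity)])
    have : lagSum P t B f (N + 1) k
        = fun z => (B ^ t) (lagSum P t B f N (k - t) z) + lagDiff P t f k z :=
      funext (lagSum_succ N k)
    rw [this]
    refine h.mono (le_of_eq ?_)
    rw [mul_pow, mul_pow, Real.sq_sqrt (by linarith), Real.sq_sqrt (by positivity)]
    have : (1 - y) * ((2 * p + 1) / y * (2 * β) ^ 2) + (2 * p + 1) * (2 * β) ^ 2
        = (2 * p + 1) / y * (2 * β) ^ 2 := by field_simp; ring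
    rw [this, Real.sqrt_mul (by positivity), Real.sqrt_sq (by positivity)]

/-- Splitting of the weighted sum into centered increments along residue classes, a weighted sum
for `P^t f`, and at most `t` boundary terms. -/
lemma wsum_eq (ht : 1 ≤ t) {n : ℕ} (hn : t ≤ n) (z : ℕ → Z) :
    wsum B f n z = ∑ r ∈ Finset.range t, (B ^ r) (lagSum P t B f n (n - r) z)
      + wsum B (iter P t f) (n - t) z
      + ∑ j ∈ Finset.range t, (B ^ (n - t + j))
          (if j = 0 then iter P t f (z 0) else f (z (t - j))) := by
  have h1 : ∑ r ∈ Finset.range t, (B ^ r) (lagSum P t B f n (n - r) z)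
      = ∑ i ∈ Finset.range n, (B ^ i) (lagDiff P t f (n - i) z) := by
    -- Surplus indices `i ≥ n` give `n - i = 0` in `ℕ`, where `lagDiff` vanishes because `t ≥ 1`.
    -- The longer range splits evenly into residue classes.
    have e1 : ∑ i ∈ Finset.range n, (B ^ i) (lagDiff P t f (n - i) z)
        = ∑ i ∈ Finset.range (t * n), (B ^ i) (lagDiff P t f (n - i) z) := by
      refine Finset.sum_subset (Finset.range_mono (Nat.le_mul_of_pos_left n ht)) fun i _ hi => ?_
      have : n - i = 0 := Nat.sub_eq_zero_of_le (by simpa using hi)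
      have ht0 : ¬ t ≤ 0 := by omega
      simp [this, lagDiff, ht0]
    rw [e1, sum_range_mul_add, Finset.sum_comm]
    refine Finset.sum_congr rfl fun r _ => ?_
    rw [lagSum, map_sum]
    refine Finset.sum_congr rfl fun q _ => ?_
    rw [← mul_apply_eq_comp, ← pow_add, Nat.sub_sub, add_comm r]
  rw [h1]
  have h2 : ∑ i ∈ Finset.range n, (B ^ i) (f (z (n - i)) - lagDiff P t f (n - i) z)
      = wsum B (iter P t f) (n - t) z + ∑ j ∈ Finset.range t, (B ^ (n - t + j))
          (if j = 0 then iter P t f (z 0) else f (z (t - j))) := by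
    conv_lhs => rw [← Nat.sub_add_cancel hn, Finset.sum_range_add]
    congr 1
    · refine Finset.sum_congr rfl fun i hi => ?_
      have hi := Finset.mem_range.1 hi
      have h3 : t ≤ n - t + t - i := by omega
      have h4 : n - t + t - i - t = n - t - i := by omega
      simp only [lagDiff, h3, if_true, h4, sub_sub_cancel]
    · refine Finset.sum_congr rfl fun j hj => ?_
      have hj := Finset.mem_range.1 hj
      have h3 : n - t + t - (n - t + j) = t - j := by omega
      rw [h3]
      rcases Nat.eq_zero_or_pos j with rfl | hj0
      -- At `j = 0` the time index is exactly `t`: the increment is complete, but its correction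
      -- sits at `z 0`, a time that `wsum` does not contain.
      · simp [lagDiff]
      · have h4 : ¬ t ≤ t - j := by omega
        simp [lagDiff, h4, hj0.ne']
  rw [add_assoc, ← h2, ← Finset.sum_add_distrib, wsum]
  refine Finset.sum_congr rfl fun i _ => ?_
  rw [← map_add]; congr 1; abel

lemma stronglyMeasurable_wsum (hf : StronglyMeasurable f) (n : ℕ) :
    StronglyMeasurable (wsum B f n) := by
  unfold wsum
  refine Finset.stronglyMeasurable_fun_sum _ fun i _ => ?_
  exact (B ^ i).continuous.comp_stronglyMeasurable (hf.comp_measurable (measurable_pi_apply _))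

/-- The splitting `wsum_eq` replaces `f` by `P^t f`, which satisfies the same decay hypothesis with
`β/4`. The costs of successive rounds are dominated by a geometric series, whence the factor `4/3`.
-/
lemma momentLE_wsum (ht : 1 ≤ t) {p y : ℝ} (hp : 2 ≤ p) (hy : 0 < y) (hy1 : y ≤ 1)
    (hB1 : ∀ v, ‖B v‖ ≤ ‖v‖) (hB : ∀ v, ‖(B ^ t) v‖ ^ 2 ≤ (1 - y) * ‖v‖ ^ 2) (n : ℕ) (β : ℝ)
    (hβ0 : 0 ≤ β) (f : Z → E) (hf : StronglyMeasurable f)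
    (hβ : ∀ j z, ‖iter P (j * t) f z‖ ≤ β * (1 / 4) ^ j) :
    MomentLE (chainLaw P ξ) p (4 / 3 * (t * (√((2 * p + 1) / y) * (2 * β)) + t * β))
      (wsum B f n) := by
  induction n using Nat.strong_induction_on generalizing β f with
  | _ n ih =>
  have hfβ : ∀ z, ‖f z‖ ≤ β := fun z => by
    have := hβ 0 z
    rwa [zero_mul, iter_zero hf, pow_zero, mul_one] at this
  set ω := √((2 * p + 1) / y) with hω
  have hω0 : 0 ≤ ω := Real.sqrt_nonneg _
  have ht0 : (0 : ℝ) ≤ t := by positivity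
  have hp1 : 1 ≤ p := by linarith
  by_cases hn : t ≤ n
  · have hlag : MomentLE (chainLaw P ξ) p (t * (ω * (2 * β)))
        fun z => ∑ r ∈ Finset.range t, (B ^ r) (lagSum P t B f n (n - r) z) := by
      have := MomentLE.sum (μ := chainLaw P ξ) (p := p) (Finset.range t)
        (X := fun r z => (B ^ r) (lagSum P t B f n (n - r) z)) (A := fun _ => 1 * (ω * (2 * β)))
        hp1 (fun _ _ => by positivity)
        (fun r _ => ((B ^ r).continuous.comp_stronglyMeasurable
          ((stronglyMeasurable_lagSum hf n (n - r)).mono (hist_le _))).aestronglyMeasurable)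
        (fun r _ => (momentLE_lagSum hp hy hy1 hB1 hB hf hfβ hβ0 n (n - r)).of_norm_le zero_le_one
          fun z => by rw [one_mul]; exact norm_pow_apply_le hB1 _ _)
      simpa using this
    have hrec := ih (n - t) (by omega) (β / 4) (by positivity) (iter P t f)
      (stronglyMeasurable_iter t hf) fun j z => by
        rw [iter_iter _ _ hf hfβ]
        have := hβ (j + 1) z
        rw [add_mul, one_mul] at this
        refine this.trans (le_of_eq ?_)
        rw [pow_succ]; ring
    have hbd : MomentLE (chainLaw P ξ) p (t * β) fun z : ℕ → Z =>
        ∑ j ∈ Finset.range t, (B ^ (n - t + j))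
          (if j = 0 then iter P t f (z 0) else f (z (t - j))) := by
      refine MomentLE.of_bound fun z => (norm_sum_le _ _).trans ?_
      refine (Finset.sum_le_card_nsmul _ _ β fun j _ => ?_).trans (by simp)
      refine (norm_pow_apply_le hB1 _ _).trans ?_
      split_ifs
      · exact norm_iter_le t hfβ _
      · exact hfβ _
    have m1 : StronglyMeasurable fun z : ℕ → Z =>
        ∑ r ∈ Finset.range t, (B ^ r) (lagSum P t B f n (n - r) z) :=
      Finset.stronglyMeasurable_fun_sum _ fun r _ => (B ^ r).continuous.comp_stronglyMeasurable
          ((stronglyMeasurable_lagSum hf n (n - r)).mono (hist_le _))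
    have m2 := stronglyMeasurable_wsum (B := B) (stronglyMeasurable_iter (P := P) t hf) (n - t)
    have m3 : StronglyMeasurable fun z : ℕ → Z =>
        ∑ j ∈ Finset.range t, (B ^ (n - t + j))
          (if j = 0 then iter P t f (z 0) else f (z (t - j))) := by
      refine Finset.stronglyMeasurable_fun_sum _ fun j _ =>
        (B ^ (n - t + j)).continuous.comp_stronglyMeasurable ?_
      split_ifs
      · exact (stronglyMeasurable_iter t hf).comp_measurable (measurable_pi_apply _)
      · exact hf.comp_measurable (measurable_pi_apply _)
    have h := (hlag.add hrec hp1 (by positivity) (by positivity) m1.aestronglyMeasurable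
      m2.aestronglyMeasurable).add hbd hp1 (by positivity) (by positivity)
      (m1.add m2).aestronglyMeasurable m3.aestronglyMeasurable
    have e : wsum B f n = fun z => ∑ r ∈ Finset.range t, (B ^ r) (lagSum P t B f n (n - r) z)
      + wsum B (iter P t f) (n - t) z
      + ∑ j ∈ Finset.range t, (B ^ (n - t + j))
          (if j = 0 then iter P t f (z 0) else f (z (t - j))) := funext (wsum_eq ht hn)
    rw [e]
    refine h.mono (le_of_eq ?_)
    ring
  · refine (MomentLE.of_bound (c := t * β) fun z => ?_).mono ?_
    · unfold wsum
      refine (norm_sum_le _ _).trans ?_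
      refine (Finset.sum_le_card_nsmul _ _ β fun i _ =>
        (norm_pow_apply_le hB1 _ _).trans (hfβ _)).trans ?_
      rw [Finset.card_range, nsmul_eq_mul]
      have : (n : ℝ) ≤ t := by exact_mod_cast (not_le.1 hn).le
      gcongr
    · have : 0 ≤ t * (ω * (2 * β)) := by positivity
      have : 0 ≤ t * β := by positivity
      linarith

lemma one_sub_pow_le {x : ℝ} (hx0 : 0 ≤ x) (hx1 : x ≤ 1) (hxt : x * t ≤ 1) :
    (1 - x) ^ t ≤ 1 - x * t / 2 := by
  have h1 : (1 - x) ^ t ≤ Real.exp (-(x * t)) := by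
    calc (1 - x) ^ t ≤ (Real.exp (-x)) ^ t :=
          pow_le_pow_left₀ (by linarith) (Real.one_sub_le_exp_neg x) t
      _ = Real.exp (-(x * t)) := by rw [← Real.exp_nat_mul]; congr 1; ring
  refine h1.trans ?_
  have hy : 0 ≤ x * t := by positivity
  rw [Real.exp_neg, inv_le_comm₀ (Real.exp_pos _) (by linarith)]
  refine le_trans ?_ (Real.add_one_le_exp _)
  rw [inv_le_iff_one_le_mul₀ (by linarith)]
  nlinarith

/-- Increments at lag `t` save a factor `√t` over the Poisson equation: each of the `t` residue
classes contributes a martingale sum of order `√(p/(αat))`, in total `√(pt/(αa))`, whereas the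
Poisson solution already has size of order `t`. This half power is what makes the final exponent
`5/2`. -/
lemma momentLE_linear_part (hP : UniformlyErgodic P π t) {p α a e : ℝ} (hp : 2 ≤ p)
    (hα : 0 < α) (ha : 0 < a) (hαa : α * a ≤ 1 / 2)
    {Ab : E →L[ℝ] E} (hB : ∀ v, ‖v - α • Ab v‖ ^ 2 ≤ (1 - α * a) * ‖v‖ ^ 2)
    {ε : Z → E} (mε : StronglyMeasurable ε)
    (hε : ∀ z, ‖ε z‖ ≤ e) (hπ : ∫ z, ε z ∂π = 0) {U : ℕ → (ℕ → Z) → E} (U0 : ∀ z, U 0 z = 0)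
    (hU : ∀ n z, U (n + 1) z = U n z - α • Ab (U n z) - α • ε (z (n + 1))) (n : ℕ) :
    MomentLE (chainLaw P ξ) p (16 * √p * √(α * t / a) * e) (U n) := by
  obtain ⟨z₀⟩ : Nonempty Z := nonempty_of_isProbabilityMeasure π
  have he : 0 ≤ e := (norm_nonneg _).trans (hε z₀)
  have ht := hP.one_le
  have ht1 : (1 : ℝ) ≤ t := by exact_mod_cast ht
  set x := α * a with hx
  have hx0 : 0 < x := by positivity
  set B : E →L[ℝ] E := ContinuousLinearMap.id ℝ E - α • Ab with hBdef
  have hBv : ∀ v, B v = v - α • Ab v := fun v => by simp [hBdef]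
  have hBsq : ∀ v, ‖B v‖ ^ 2 ≤ (1 - x) * ‖v‖ ^ 2 := fun v => by rw [hBv]; exact hB v
  have hBc : ∀ v, ‖B v‖ ≤ (1 - x / 2) * ‖v‖ := fun v => by
    refine le_of_sq_le_sq ((hBsq v).trans ?_) (mul_nonneg (by linarith) (norm_nonneg _))
    rw [mul_pow]
    gcongr
    nlinarith [sq_nonneg x]
  have hB1 : ∀ v, ‖B v‖ ≤ ‖v‖ := fun v => by
    have := norm_nonneg v
    nlinarith [hBc v]
  have hp14 : 1.4 ≤ √p := Real.le_sqrt_of_sq_le (by linarith)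
  by_cases hxt : x * t ≤ 1
  · have hUw : ∀ n z, U n z = (-α) • wsum B ε n z := by
      intro n z
      induction n with
      | zero => simp [wsum, U0]
      | succ n ih =>
        have : wsum B ε (n + 1) z = B (wsum B ε n z) + ε (z (n + 1)) := by
          unfold wsum
          rw [Finset.sum_range_succ', map_sum]
          congr 1
          refine Finset.sum_congr rfl fun i _ => ?_
          rw [← mul_apply_eq_comp, ← pow_succ', Nat.succ_sub_succ]
        rw [hU, ← hBv, ih, this, map_smul, smul_add, neg_smul, neg_smul]
        abel
    have hy : ∀ v, ‖(B ^ t) v‖ ^ 2 ≤ (1 - x * t / 2) * ‖v‖ ^ 2 := fun v => by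
      have : ∀ j : ℕ, ∀ v, ‖(B ^ j) v‖ ^ 2 ≤ (1 - x) ^ j * ‖v‖ ^ 2 := by
        intro j
        induction j with
        | zero => simp
        | succ j ih =>
          intro v
          rw [pow_succ B j, mul_apply_eq_comp]
          refine (ih _).trans ?_
          rw [pow_succ (1 - x) j, mul_assoc]
          have : 0 ≤ (1 - x) ^ j := pow_nonneg (by linarith) _
          gcongr
          exact hBsq v
      refine (this t v).trans ?_
      gcongr
      exact one_sub_pow_le hx0.le (by linarith) hxt
    have hxt0 : 0 < x * t := by positivity
    have h := momentLE_wsum (P := P) (ξ := ξ) ht hp (y := x * t / 2) (by positivity) (by linarith)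
      hB1 hy n (2 * e) (by positivity) ε mε fun j z => by
        have := norm_iter_le_of_integral_eq_zero hP mε hε hπ (j * t) z
        rwa [Nat.mul_div_cancel _ ht] at this
    have h2 := h.of_norm_le (Y := U n) hα.le fun z => by
      rw [hUw, norm_smul, norm_neg, Real.norm_of_nonneg hα.le]
    refine h2.mono ?_
    set s := √(t / x) with hs
    have hs0 : 0 ≤ s := Real.sqrt_nonneg _
    have e1 : t * √((2 * p + 1) / (x * t / 2)) = √(2 * (2 * p + 1)) * s := by
      rw [hs, ← Real.sqrt_mul (by positivity)]
      nth_rewrite 1 [← Real.sqrt_sq (by positivity : (0 : ℝ) ≤ t)]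
      rw [← Real.sqrt_mul (by positivity)]
      congr 1; field_simp
    have e2 : √(2 * (2 * p + 1)) ≤ 2.24 * √p := by
      rw [Real.sqrt_le_left (by positivity), mul_pow, Real.sq_sqrt (by linarith)]
      linarith
    have e3 : (t : ℝ) ≤ s := by
      refine Real.le_sqrt_of_sq_le ?_
      rw [le_div_iff₀ hx0]; nlinarith
    have e4 : α * s = √(α * t / a) := by
      rw [hs]
      conv_lhs => rw [← Real.sqrt_sq hα.le]
      rw [← Real.sqrt_mul (by positivity)]
      congr 1; rw [hx]; field_simp
    rw [← e4]
    have e5 : t * (√((2 * p + 1) / (x * t / 2)) * (2 * (2 * e)))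
        = √(2 * (2 * p + 1)) * s * (4 * e) := by rw [← e1]; ring
    rw [e5]
    have e6 : √(2 * (2 * p + 1)) * s * 4 + 2 * t ≤ 12 * (√p * s) := by
      nlinarith [mul_le_mul_of_nonneg_right e2 hs0, mul_le_mul_of_nonneg_right hp14 hs0]
    nlinarith [mul_le_mul_of_nonneg_right e6 (mul_nonneg hα.le he)]
  -- When `αat > 1` the pathwise bound from contraction is enough, since then `1/a ≤ √(αt/a)`.
  · have hdet : ∀ z, ‖U n z‖ ≤ 2 * e / a := fun z => by
      induction n with
      | zero => rw [U0, norm_zero]; positivity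
      | succ n ih =>
        rw [hU, ← hBv]
        refine (norm_sub_le _ _).trans ?_
        rw [norm_smul, Real.norm_of_nonneg hα.le]
        have h1 : (1 - x / 2) * ‖U n z‖ ≤ (1 - x / 2) * (2 * e / a) :=
          mul_le_mul_of_nonneg_left ih (by linarith)
        have h2 : α * ‖ε (z (n + 1))‖ ≤ α * e := by gcongr; exact hε _
        have h3 : (1 - x / 2) * (2 * e / a) + α * e = 2 * e / a := by rw [hx]; field_simp; ring
        linarith [hBc (U n z)]
    refine (MomentLE.of_bound hdet).mono ?_
    have h1 : 1 / a ≤ √(α * t / a) := by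
      refine Real.le_sqrt_of_sq_le ?_
      rw [div_pow, div_le_div_iff₀ (by positivity) ha]
      push Not at hxt
      rw [hx] at hxt
      nlinarith
    have h2 : 2 * e / a = 2 * (1 / a) * e := by ring
    rw [h2]
    have h3 : 0 ≤ 1 / a := by positivity
    gcongr
    nlinarith

end LinearPart

/-! ### The second-order term and the remainder of the expansion -/

section Expansion

variable {Z : Type*} [MeasurableSpace Z] {P : Kernel Z Z} [IsMarkovKernel P]
  {ξ : Measure Z} [IsProbabilityMeasure ξ] {π : Measure Z} [IsProbabilityMeasure π] {t : ℕ}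
  {E : Type*} [NormedAddCommGroup E] [InnerProductSpace ℝ E] [CompleteSpace E]

lemma adapted_bounded_of_recursion {α : ℝ} {Ab : E →L[ℝ] E} {U F : ℕ → (ℕ → Z) → E}
    (mF : ∀ n, StronglyMeasurable[hist Z (n + 1)] (F n)) (bF : ∀ n, ∃ C, ∀ z, ‖F n z‖ ≤ C)
    (U0 : ∀ z, U 0 z = 0) (hU : ∀ n z, U (n + 1) z = U n z - α • Ab (U n z) - α • F n z) (n : ℕ) :
    StronglyMeasurable[hist Z n] (U n) ∧ ∃ C, ∀ z, ‖U n z‖ ≤ C := by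
  induction n with
  | zero =>
    have : U 0 = fun _ => 0 := funext U0
    rw [this]
    exact ⟨stronglyMeasurable_const, 0, fun z => by simp⟩
  | succ n ih =>
    obtain ⟨m1, C, hC⟩ := ih
    obtain ⟨D, hD⟩ := bF n
    have : U (n + 1) = fun z => U n z - α • Ab (U n z) - α • F n z := funext (hU n)
    rw [this]
    have m2 := m1.mono (Filtration.piLE.mono (Nat.le_succ n))
    refine ⟨(m2.sub ((Ab.continuous.comp_stronglyMeasurable m2).const_smul α)).sub
      ((mF n).const_smul α), C + |α| * (‖Ab‖ * C) + |α| * D, fun z => ?_⟩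
    refine (norm_sub_le _ _).trans (add_le_add ((norm_sub_le _ _).trans
      (add_le_add (hC z) ?_)) ?_)
    · rw [norm_smul, Real.norm_eq_abs]
      gcongr
      exact (Ab.le_opNorm _).trans (by gcongr; exact hC z)
    · rw [norm_smul, Real.norm_eq_abs]
      gcongr
      exact hD z

lemma clm_apply_adapted_bounded {c : ℝ} {At : Z → E →L[ℝ] E} (mAt : StronglyMeasurable At)
    (hAt : ∀ z, ‖At z‖ ≤ c) {U : ℕ → (ℕ → Z) → E}
    (hU : ∀ n, StronglyMeasurable[hist Z n] (U n) ∧ ∃ C, ∀ z, ‖U n z‖ ≤ C) (n : ℕ) :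
    StronglyMeasurable[hist Z (n + 1)] (fun z => At (z (n + 1)) (U n z)) ∧
      ∃ C, ∀ z : ℕ → Z, ‖At (z (n + 1)) (U n z)‖ ≤ C := by
  obtain ⟨m1, C, hC⟩ := hU n
  refine ⟨stronglyMeasurable_clm_apply (stronglyMeasurable_eval le_rfl mAt)
    (m1.mono (Filtration.piLE.mono (Nat.le_succ n))), c * C, fun z => ?_⟩
  have := (norm_nonneg _).trans (hAt (z 0))
  exact (ContinuousLinearMap.le_opNorm _ _).trans
    (mul_le_mul (hAt _) (hC z) (norm_nonneg _) this)

/-- The second-order term `J^{(2)}` has moments of order `(α / a)^{3/2} t^{5/2}`. -/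
lemma momentLE_second_order (hP : UniformlyErgodic P π t) {p α a c e : ℝ} (hp : 2 ≤ p)
    (hα : 0 < α) (ha : 0 < a) (hαa : α * a ≤ 1 / 2)
    {Ab : E →L[ℝ] E} (hB : ∀ v, ‖v - α • Ab v‖ ^ 2 ≤ (1 - α * a) * ‖v‖ ^ 2)
    (hAb : α * ‖Ab‖ ^ 2 ≤ a) {At : Z → E →L[ℝ] E} (mAt : StronglyMeasurable At)
    (hAt : ∀ z, ‖At z‖ ≤ c) (hπA : ∫ z, At z ∂π = 0) {ε : Z → E} (mε : StronglyMeasurable ε)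
    (hε : ∀ z, ‖ε z‖ ≤ e) (hπε : ∫ z, ε z ∂π = 0) {U V W : ℕ → (ℕ → Z) → E}
    (U0 : ∀ z, U 0 z = 0) (V0 : ∀ z, V 0 z = 0) (W0 : ∀ z, W 0 z = 0)
    (hU : ∀ n z, U (n + 1) z = U n z - α • Ab (U n z) - α • ε (z (n + 1)))
    (hV : ∀ n z, V (n + 1) z = V n z - α • Ab (V n z) - α • At (z (n + 1)) (U n z))
    (hW : ∀ n z, W (n + 1) z = W n z - α • Ab (W n z) - α • At (z (n + 1)) (V n z)) (n : ℕ) :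
    MomentLE (chainLaw P ξ) p (6600 * √p ^ 3 * √(α / a) ^ 3 * √t ^ 5 * c ^ 2 * e) (W n) := by
  obtain ⟨z₀⟩ : Nonempty Z := nonempty_of_isProbabilityMeasure π
  have he : 0 ≤ e := (norm_nonneg _).trans (hε z₀)
  have hc : 0 ≤ c := (norm_nonneg _).trans (hAt z₀)
  have ht1 : (1 : ℝ) ≤ t := by exact_mod_cast hP.one_le
  have gU := adapted_bounded_of_recursion (fun n => stronglyMeasurable_eval le_rfl mε)
    (fun n => ⟨e, fun z => hε _⟩) U0 hU
  have gAU := clm_apply_adapted_bounded mAt hAt gU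
  have gV := adapted_bounded_of_recursion (fun n => (gAU n).1) (fun n => (gAU n).2) V0 hV
  have gAV := clm_apply_adapted_bounded mAt hAt gV
  have gW := adapted_bounded_of_recursion (fun n => (gAV n).1) (fun n => (gAV n).2) W0 hW
  set j0 := 16 * √p * √(α * t / a) * e with hj0
  have h0 : ∀ n, MomentLE (chainLaw P ξ) p j0 (U n) :=
    momentLE_linear_part hP hp hα ha hαa hB mε hε hπε U0 hU
  have h1 := fun n => momentLE_poisson_step (ξ := ξ) hP hp hα ha hαa (u := j0) (r := e)
    (by positivity) he hB hAb mAt hAt hπA (fun n => (gU n).1) (fun n => (gU n).2) (fun n => (gV n).1)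
    (R := fun n z => ε (z (n + 1)))
    (fun n => mε.comp_measurable (measurable_pi_apply _)) U0 V0 hU hV h0
    (fun n => MomentLE.of_bound fun z => hε _) n
  set j1 := 20 * √p * √(α / a) * (t * c * j0) + 6 * (α / a) * (t * c * e) with hj1
  have hR : ∀ n, MomentLE (chainLaw P ξ) p (c * j0) fun z => At (z (n + 1)) (U n z) := fun n =>
    (h0 n).of_norm_le hc fun z =>
      (ContinuousLinearMap.le_opNorm _ _).trans (by gcongr; exact hAt _)
  have h2 := momentLE_poisson_step (ξ := ξ) hP hp hα ha hαa (u := j1) (r := c * j0) (by positivity)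
    (by positivity) hB hAb mAt hAt hπA (fun n => (gV n).1) (fun n => (gV n).2)
    (fun n => (gW n).1) (R := fun n z => At (z (n + 1)) (U n z))
    (fun n => (gAU n).1.mono (hist_le _)) V0 W0 hV hW h1 hR n
  refine h2.mono ?_
  set s := √(α / a) with hs
  set σ := √(t : ℝ) with hσ
  set q := √p with hq
  have hs0 : 0 ≤ s := Real.sqrt_nonneg _
  have hσ1 : 1 ≤ σ := Real.one_le_sqrt.2 ht1
  have hq0 : 0 ≤ q := Real.sqrt_nonneg _
  have hq2 : 2 ≤ q ^ 2 := by rw [hq, Real.sq_sqrt (by linarith)]; exact hp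
  have es : α / a = s ^ 2 := by rw [hs, Real.sq_sqrt (by positivity)]
  have et : (t : ℝ) = σ ^ 2 := by rw [hσ, Real.sq_sqrt (by positivity)]
  have est : √(α * t / a) = s * σ := by
    rw [hs, hσ, ← Real.sqrt_mul (by positivity)]; congr 1; ring
  rw [hj1, hj0, est, es, et]
  have hb : 0 ≤ s ^ 3 * σ ^ 5 * c ^ 2 * e := by positivity
  -- The main term carries `20 · 20 · 16 = 6400`; the lower-order ones are absorbed through `√p ≤
  -- √p³/2` and `t ≥ 1`, and `6400 + 60 + 48 ≤ 6600`.
  have k1 : q * 120 ≤ 60 * q ^ 3 := by nlinarith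
  have k2 : s ^ 3 * σ ^ 4 * c ^ 2 * e ≤ s ^ 3 * σ ^ 5 * c ^ 2 * e := by
    gcongr
    · norm_num
  have k3 : s ^ 3 * σ ^ 3 * c ^ 2 * e ≤ s ^ 3 * σ ^ 5 * c ^ 2 * e := by
    gcongr
    · norm_num
  calc 20 * q * s * (σ ^ 2 * c * (20 * q * s * (σ ^ 2 * c * (16 * q * (s * σ) * e))
        + 6 * s ^ 2 * (σ ^ 2 * c * e)))
        + 6 * s ^ 2 * (σ ^ 2 * c * (c * (16 * q * (s * σ) * e)))
      = 6400 * q ^ 3 * (s ^ 3 * σ ^ 5 * c ^ 2 * e) + q * 120 * (s ^ 3 * σ ^ 4 * c ^ 2 * e)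
        + q * 96 * (s ^ 3 * σ ^ 3 * c ^ 2 * e) := by ring
    _ ≤ 6400 * q ^ 3 * (s ^ 3 * σ ^ 5 * c ^ 2 * e) + q * 120 * (s ^ 3 * σ ^ 5 * c ^ 2 * e)
        + q * 96 * (s ^ 3 * σ ^ 5 * c ^ 2 * e) := by gcongr
    _ ≤ _ := by nlinarith [mul_le_mul_of_nonneg_right k1 hb]

/-- The product of the random matrices `I - α A(z_{n+i})`, `1 ≤ i ≤ l`, applied to `x`. -/
noncomputable def blockProd (α : ℝ) (A : Z → E →L[ℝ] E) (z : ℕ → Z) (n : ℕ) (x : E) : ℕ → E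
  | 0 => x
  | l + 1 => blockProd α A z n x l - α • A (z (n + l + 1)) (blockProd α A z n x l)

variable {α c : ℝ} {A : Z → E →L[ℝ] E}

lemma norm_blockProd_le (hα : 0 ≤ α) (hA : ∀ z, ‖A z‖ ≤ c) (z : ℕ → Z) (n : ℕ) (x : E) (l : ℕ) :
    ‖blockProd α A z n x l‖ ≤ (1 + α * c) ^ l * ‖x‖ := by
  have hc : 0 ≤ c := (norm_nonneg _).trans (hA (z 0))
  induction l with
  | zero => simp [blockProd]
  | succ l ih =>
    rw [blockProd, pow_succ]
    refine (norm_sub_le _ _).trans ?_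
    rw [norm_smul, Real.norm_of_nonneg hα]
    have h1 : ‖A (z (n + l + 1)) (blockProd α A z n x l)‖ ≤ c * ‖blockProd α A z n x l‖ :=
      (ContinuousLinearMap.le_opNorm _ _).trans (by gcongr; exact hA _)
    calc _ ≤ ‖blockProd α A z n x l‖ + α * (c * ‖blockProd α A z n x l‖) := by gcongr
      _ = (1 + α * c) * ‖blockProd α A z n x l‖ := by ring
      _ ≤ (1 + α * c) * ((1 + α * c) ^ l * ‖x‖) := by gcongr
      _ = _ := by ring

lemma one_add_pow_le_two {y : ℝ} (hy : 0 ≤ y) {l h : ℕ} (hl : l ≤ h) (hyh : h * y ≤ 1 / 2) :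
    (1 + y) ^ l ≤ 2 := by
  calc (1 + y) ^ l ≤ (1 + y) ^ h := pow_le_pow_right₀ (by linarith) hl
    _ ≤ (Real.exp y) ^ h := by
        gcongr
        linarith [Real.add_one_le_exp y]
    _ = Real.exp (h * y) := (Real.exp_nat_mul _ _).symm
    _ ≤ 2 := by
        have h0 : 0 ≤ h * y := by positivity
        have := (abs_le.1 (Real.abs_exp_sub_one_sub_id_le (x := h * y)
          (by rw [abs_of_nonneg h0]; linarith))).2
        nlinarith

lemma norm_blockProd_sub_le (hα : 0 ≤ α) (hA : ∀ z, ‖A z‖ ≤ c) {h : ℕ} (hh : h * (α * c) ≤ 1 / 2)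
    (z : ℕ → Z) (n : ℕ) (x : E) {l : ℕ} (hl : l ≤ h) :
    ‖blockProd α A z n x l - x‖ ≤ 2 * (l * (α * c)) * ‖x‖ := by
  have hc : 0 ≤ c := (norm_nonneg _).trans (hA (z 0))
  induction l with
  | zero => simp [blockProd]
  | succ l ih =>
    have ih := ih (by omega)
    have h1 : ‖A (z (n + l + 1)) (blockProd α A z n x l)‖ ≤ c * (2 * ‖x‖) := by
      refine (ContinuousLinearMap.le_opNorm _ _).trans ?_
      refine mul_le_mul (hA _) ((norm_blockProd_le hα hA z n x l).trans ?_) (norm_nonneg _) hc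
      gcongr
      exact one_add_pow_le_two (by positivity) (by omega : l ≤ h) hh
    rw [blockProd, sub_right_comm]
    refine (norm_sub_le _ _).trans ?_
    rw [norm_smul, Real.norm_of_nonneg hα]
    calc _ ≤ 2 * (l * (α * c)) * ‖x‖ + α * (c * (2 * ‖x‖)) := by gcongr
      _ = _ := by push_cast; ring

/-- Second-order Taylor bound for a block of the random matrix product. -/
lemma norm_blockProd_sub_linear_le (hα : 0 ≤ α) (hA : ∀ z, ‖A z‖ ≤ c) {h : ℕ}
    (hh : h * (α * c) ≤ 1 / 2) (z : ℕ → Z) (n : ℕ) (x : E) {l : ℕ} (hl : l ≤ h) :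
    ‖blockProd α A z n x l - (x - α • ∑ i ∈ Finset.range l, A (z (n + i + 1)) x)‖
      ≤ 2 * (h * (α * c)) * (l * (α * c)) * ‖x‖ := by
  have hc : 0 ≤ c := (norm_nonneg _).trans (hA (z 0))
  induction l with
  | zero => simp [blockProd]
  | succ l ih =>
    have ih := ih (by omega)
    have e : blockProd α A z n x (l + 1)
        - (x - α • ∑ i ∈ Finset.range (l + 1), A (z (n + i + 1)) x)
        = (blockProd α A z n x l - (x - α • ∑ i ∈ Finset.range l, A (z (n + i + 1)) x))
          - α • A (z (n + l + 1)) (blockProd α A z n x l - x) := by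
      rw [Finset.sum_range_succ, blockProd, map_sub, smul_add, smul_sub]
      abel
    rw [e]
    refine (norm_sub_le _ _).trans ?_
    rw [norm_smul, Real.norm_of_nonneg hα]
    have h1 : ‖A (z (n + l + 1)) (blockProd α A z n x l - x)‖ ≤ c * (2 * (h * (α * c)) * ‖x‖) := by
      refine (ContinuousLinearMap.le_opNorm _ _).trans ?_
      refine mul_le_mul (hA _)
        ((norm_blockProd_sub_le hα hA hh z n x (by omega : l ≤ h)).trans ?_) (norm_nonneg _) hc
      have : (l : ℝ) ≤ h := by exact_mod_cast (by omega : l ≤ h)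
      gcongr
    calc _ ≤ 2 * (h * (α * c)) * (l * (α * c)) * ‖x‖ + α * (c * (2 * (h * (α * c)) * ‖x‖)) := by
          gcongr
      _ = _ := by push_cast; ring

/-- Within a block the forcing adds at most `αcu` per step, and the homogeneous product amplifies it
by at most `(1 + αc)^l ≤ 2`. No cancellation is needed here. -/
lemma momentLE_sub_blockProd {μ : Measure (ℕ → Z)} {p u : ℝ} (hp : 2 ≤ p) (hα : 0 ≤ α)
    (hc : 0 ≤ c) (hA : ∀ z, ‖A z‖ ≤ c) {h : ℕ} (hh : h * (α * c) ≤ 1 / 2) (hu : 0 ≤ u)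
    (mA : StronglyMeasurable A) {H F : ℕ → (ℕ → Z) → E} (mH : ∀ n, StronglyMeasurable (H n))
    (mF : ∀ n, StronglyMeasurable (F n))
    (hH : ∀ n z, H (n + 1) z = H n z - α • A (z (n + 1)) (H n z) - α • F n z)
    (hF : ∀ n, MomentLE μ p (c * u) (F n)) (n : ℕ) {l : ℕ} (hl : l ≤ h) :
    StronglyMeasurable (fun z => blockProd α A z n (H n z) l) ∧
    MomentLE μ p (2 * (l * (α * c)) * u) (fun z => H (n + l) z - blockProd α A z n (H n z) l) := by
  have mb : ∀ l : ℕ, StronglyMeasurable (fun z => blockProd α A z n (H n z) l) := by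
    intro l
    induction l with
    | zero => exact mH n
    | succ l ih =>
      exact ih.sub ((stronglyMeasurable_clm_apply
        (mA.comp_measurable (measurable_pi_apply _)) ih).const_smul α)
  refine ⟨mb l, ?_⟩
  have key : ∀ l : ℕ, MomentLE μ p ((1 + α * c) ^ l * (l * (α * c) * u))
      (fun z => H (n + l) z - blockProd α A z n (H n z) l) := by
    intro l
    induction l with
    | zero => simpa [blockProd] using MomentLE.zero
    | succ l ih =>
      have e : (fun z => H (n + (l + 1)) z - blockProd α A z n (H n z) (l + 1))
          = fun z => ((H (n + l) z - blockProd α A z n (H n z) l)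
            - α • A (z (n + l + 1)) (H (n + l) z - blockProd α A z n (H n z) l))
            + -(α • F (n + l) z) := by
        ext1 z
        rw [← add_assoc, hH, blockProd, map_sub, smul_sub]
        abel
      rw [e]
      have md : StronglyMeasurable fun z => H (n + l) z - blockProd α A z n (H n z) l :=
        (mH _).sub (mb l)
      have g1 := ih.of_norm_le (c := 1 + α * c) (by positivity)
        (Y := fun z => (H (n + l) z - blockProd α A z n (H n z) l)
            - α • A (z (n + l + 1)) (H (n + l) z - blockProd α A z n (H n z) l)) fun z => by
          refine (norm_sub_le _ _).trans ?_
          rw [norm_smul, Real.norm_of_nonneg hα, add_mul, one_mul, mul_assoc]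
          gcongr
          exact (ContinuousLinearMap.le_opNorm _ _).trans (by gcongr; exact hA _)
      have g2 := (hF (n + l)).of_norm_le (c := α) hα (Y := fun z => -(α • F (n + l) z)) fun z => by
          rw [norm_neg, norm_smul, Real.norm_of_nonneg hα]
      refine (g1.add g2 (by linarith) (by positivity) (by positivity)
        (md.sub ((stronglyMeasurable_clm_apply
        (mA.comp_measurable (measurable_pi_apply _)) md).const_smul α)).aestronglyMeasurable
        ((mF _).const_smul α).neg.aestronglyMeasurable).mono ?_
      have h1 : 1 ≤ (1 + α * c) ^ (l + 1) := one_le_pow₀ (by nlinarith [mul_nonneg hα hc])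
      have h2 : 0 ≤ α * (c * u) := by positivity
      calc (1 + α * c) * ((1 + α * c) ^ l * (l * (α * c) * u)) + α * (c * u)
          = (1 + α * c) ^ (l + 1) * (l * (α * c) * u) + 1 * (α * (c * u)) := by ring
        _ ≤ (1 + α * c) ^ (l + 1) * (l * (α * c) * u) + (1 + α * c) ^ (l + 1) * (α * (c * u)) := by
            gcongr
        _ = _ := by push_cast; ring
  refine (key l).mono ?_
  rw [mul_assoc 2]
  have := one_add_pow_le_two (y := α * c) (by positivity) hl hh
  gcongr

end Expansion

/-! ### Contraction of random matrix products over blocks, and the remainder `H` -/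

section Remainder

variable {Z : Type*} [MeasurableSpace Z] {P : Kernel Z Z} [IsMarkovKernel P]
  {ξ : Measure Z} [IsProbabilityMeasure ξ] {π : Measure Z} [IsProbabilityMeasure π] {t : ℕ}
  {E : Type*} [NormedAddCommGroup E] [InnerProductSpace ℝ E] [CompleteSpace E]

/-- The accumulated bias does not grow with the length `h` of the block, whereas the contraction
over the block does. -/
lemma sum_norm_iter_le (hP : UniformlyErgodic P π t) {c : ℝ} {At : Z → E →L[ℝ] E}
    (mAt : StronglyMeasurable At) (hAt : ∀ z, ‖At z‖ ≤ c) (hπA : ∫ z, At z ∂π = 0) (h : ℕ)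
    (z : Z) : ∑ i ∈ Finset.range h, ‖iter P (i + 1) At z‖ ≤ 3 * (t * c) := by
  have hc : 0 ≤ c := (norm_nonneg _).trans (hAt z)
  have h1 : ∀ i ∈ Finset.range h, ‖iter P (i + 1) At z‖ ≤ 2 * c * (1 / 4) ^ (i / t) := fun i _ => by
    refine (norm_iter_le_of_integral_eq_zero hP mAt hAt hπA (i + 1) z).trans ?_
    have : (1 / 4 : ℝ) ^ ((i + 1) / t) ≤ (1 / 4) ^ (i / t) :=
      pow_le_pow_of_le_one (by norm_num) (by norm_num) (Nat.div_le_div_right (Nat.le_succ i))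
    gcongr
  refine (Finset.sum_le_sum h1).trans ?_
  rw [← Finset.mul_sum]
  have := sum_geom_div_le hP.one_le h
  have h2 : (0 : ℝ) ≤ t * c := by positivity
  nlinarith

/-- The fluctuation term is at most `(10/96)y`, which weakens `1 - y/8` to `1 - y/16`; the Taylor
remainder `2u² ≤ y/96` accounts for the rest. -/
lemma block_contraction_le {y u p : ℝ} (hp : 2 ≤ p) (hy0 : 0 ≤ y) (hy : y ≤ 1 / 192)
    (hu : 96 * p * u ^ 2 ≤ y) :
    √((1 - y / 8) ^ 2 + (2 * p + 1) * (2 * u) ^ 2) + 2 * u * u ≤ 1 - y / 20 := by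
  have h1 : √((1 - y / 8) ^ 2 + (2 * p + 1) * (2 * u) ^ 2) ≤ 1 - y / 16 := by
    rw [Real.sqrt_le_left (by linarith)]
    nlinarith [sq_nonneg u, mul_nonneg (by linarith : (0:ℝ) ≤ p - 2) (sq_nonneg u)]
  nlinarith [mul_nonneg (by linarith : (0:ℝ) ≤ p - 2) (sq_nonneg u)]

/-- Mean contraction of a block of random matrices acting on a vector of the past. -/
lemma momentLE_blockProd (hP : UniformlyErgodic P π t) {p α a c η : ℝ} (hp : 2 ≤ p)
    (hα : 0 < α) (ha : 0 < a) {h : ℕ} {Ab : E →L[ℝ] E}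
    (hBh : ∀ v, ‖v - (α * h) • Ab v‖ ^ 2 ≤ (1 - α * h * a) * ‖v‖ ^ 2)
    (hct : 8 * (t * c) ≤ h * a) (hstep : α * h * (96 * p * c ^ 2) ≤ a) (hac : a ≤ c)
    {At : Z → E →L[ℝ] E} (mAt : StronglyMeasurable At) (hAt : ∀ z, ‖At z‖ ≤ c)
    (hA : ∀ z, ‖Ab + At z‖ ≤ c) (hπA : ∫ z, At z ∂π = 0) (hη : 0 ≤ η) {n : ℕ}
    {X : (ℕ → Z) → E} (mX : StronglyMeasurable[hist Z n] X) {C : ℝ} (hC : ∀ z, ‖X z‖ ≤ C)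
    (hX : MomentLE (chainLaw P ξ) p η X) :
    MomentLE (chainLaw P ξ) p ((1 - α * h * a / 20) * η)
      (fun z => blockProd α (fun z => Ab + At z) z n (X z) h) := by
  have hc : 0 < c := ha.trans_le hac
  set u := h * (α * c) with hu
  set y := α * h * a with hy
  have hu0 : 0 ≤ u := by positivity
  have hy0 : 0 ≤ y := by positivity
  have huy : 96 * p * u ^ 2 ≤ y := by
    calc 96 * p * u ^ 2 = α * h * (α * h * (96 * p * c ^ 2)) := by rw [hu]; ring
      _ ≤ α * h * a := by gcongr
  have hyu : y ≤ u := by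
    calc y = α * h * a := rfl
      _ ≤ α * h * c := by gcongr
      _ = u := by rw [hu]; ring
  have hu1 : u ≤ 1 / 192 := by
    have h1 : 96 * p * u * c ≤ c := by
      calc 96 * p * u * c = α * h * (96 * p * c ^ 2) := by rw [hu]; ring
        _ ≤ c := hstep.trans hac
    have h2 : 96 * p * u ≤ 1 := by
      by_contra! hlt
      nlinarith
    nlinarith
  have hu2 : h * (α * c) ≤ 1 / 2 := by linarith
  set A : Z → E →L[ℝ] E := fun z => Ab + At z with hAdef
  set I : Z → E →L[ℝ] E := fun z => ∑ i ∈ Finset.range h, iter P (i + 1) At z with hI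
  have mI : StronglyMeasurable I :=
    Finset.stronglyMeasurable_fun_sum _ fun i _ => stronglyMeasurable_iter (i + 1) mAt
  have bI : ∀ z, ‖I z‖ ≤ 3 * (t * c) := fun z =>
    (norm_sum_le _ _).trans (sum_norm_iter_le hP mAt hAt hπA h z)
  -- The block product is linearized in `α`: `M` is the conditional mean given time `n`, and `Y` the
  -- centred rest. In `M`, the operator `I - αhĀ` is one contraction with step `αh`, and the bias is
  -- at most `3y/8` because `8tc ≤ ha`; this leaves `1 - y/2 + 3y/8 = 1 - y/8`.
  let M : (ℕ → Z) → E := fun z => (X z - (α * h) • Ab (X z)) - α • I (z n) (X z)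
  let Y : (ℕ → Z) → E := fun z =>
    ∑ i ∈ Finset.range h, (-α) • (At (z (n + (i + 1))) - iter P (i + 1) At (z n)) (X z)
  have mM : StronglyMeasurable[hist Z n] M :=
    (mX.sub ((Ab.continuous.comp_stronglyMeasurable mX).const_smul _)).sub
      ((stronglyMeasurable_clm_apply (stronglyMeasurable_eval le_rfl mI) mX).const_smul _)
  have mX' := mX.mono (hist_le n)
  have mYi : ∀ i, StronglyMeasurable fun z : ℕ → Z =>
      (-α) • (At (z (n + (i + 1))) - iter P (i + 1) At (z n)) (X z) := fun i =>
    (stronglyMeasurable_clm_apply ((mAt.comp_measurable (measurable_pi_apply _)).sub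
      ((stronglyMeasurable_iter (i + 1) mAt).comp_measurable (measurable_pi_apply _)))
      mX').const_smul _
  have bYi : ∀ i z, ‖(-α) • (At (z (n + (i + 1))) - iter P (i + 1) At (z n)) (X z)‖
      ≤ α * (2 * c) * ‖X z‖ := fun i z => by
    rw [norm_smul, norm_neg, Real.norm_of_nonneg hα.le, mul_assoc]
    gcongr
    refine (ContinuousLinearMap.le_opNorm _ _).trans ?_
    gcongr
    refine (norm_sub_le _ _).trans ?_
    linarith [hAt (z (n + (i + 1))), norm_iter_le (P := P) (i + 1) hAt (z n)]
  have mY : StronglyMeasurable Y := Finset.stronglyMeasurable_fun_sum _ fun i _ => mYi i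
  have bM : ∀ z, ‖M z‖ ≤ (1 - y / 8) * ‖X z‖ := fun z => by
    have h1 : ‖X z - (α * h) • Ab (X z)‖ ≤ (1 - y / 2) * ‖X z‖ := by
      refine le_of_sq_le_sq ((hBh _).trans ?_) (mul_nonneg (by linarith) (norm_nonneg _))
      rw [mul_pow]
      gcongr
      nlinarith [sq_nonneg y]
    have h2 : ‖α • I (z n) (X z)‖ ≤ 3 / 8 * y * ‖X z‖ := by
      rw [norm_smul, Real.norm_of_nonneg hα.le]
      calc α * ‖I (z n) (X z)‖ ≤ α * (3 * (t * c) * ‖X z‖) := by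
            gcongr
            exact (ContinuousLinearMap.le_opNorm _ _).trans (by gcongr; exact bI _)
        _ = 3 / 8 * (α * (8 * (t * c))) * ‖X z‖ := by ring
        _ ≤ 3 / 8 * (α * (h * a)) * ‖X z‖ := by gcongr
        _ = _ := by rw [hy]; ring
    refine (norm_sub_le _ _).trans ?_
    linarith
  have bY : ∀ z, ‖Y z‖ ≤ 2 * u * ‖X z‖ := fun z => by
    refine (norm_sum_le _ _).trans ((Finset.sum_le_card_nsmul _ _ _ fun i _ => bYi i z).trans ?_)
    rw [Finset.card_range, nsmul_eq_mul]
    exact le_of_eq (by rw [hu]; ring)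
  have hYc : (chainLaw P ξ)[Y | hist Z n] =ᵐ[chainLaw P ξ] 0 := by
    have e : Y = ∑ i ∈ Finset.range h, fun z : ℕ → Z =>
        (-α) • (At (z (n + (i + 1))) - iter P (i + 1) At (z n)) (X z) := by
      ext1 z; simp [Y]
    rw [e]
    refine (condExp_finsetSum (fun i _ => integrable_of_norm_le (mYi i) (β := α * (2 * c) * C)
      fun z => (bYi i z).trans (by gcongr; exact hC z)) _).trans ?_
    have h1 : ∀ i, (chainLaw P ξ)[fun z : ℕ → Z =>
        (-α) • (At (z (n + (i + 1))) - iter P (i + 1) At (z n)) (X z) | hist Z n]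
        =ᵐ[chainLaw P ξ] 0 := fun i => by
      refine (condExp_smul (-α) _ (hist Z n)).trans ?_
      filter_upwards [condExp_clm_apply_eq_zero (P := P) (ξ := ξ) n (i + 1) mAt hAt mX hC] with z hz
      simp only [Pi.smul_apply]
      rw [show _ = (0 : E) from hz]
      simp
    filter_upwards [ae_all_iff.2 h1] with z hz
    rw [Finset.sum_apply]
    exact Finset.sum_eq_zero fun i _ => hz i
  have hC0 : ∀ z : ℕ → Z, 0 ≤ C := fun z => (norm_nonneg _).trans (hC z)
  have hstep1 := MomentLE.add_of_condExp_eq_zero (μ := chainLaw P ξ) hp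
    (A := (1 - y / 8) * η) (W := 2 * u * η) (mul_nonneg (by linarith) hη) (by positivity)
    (hist_le n) mM (w := fun z => 2 * u * ‖X z‖) (mX.norm.const_mul _) mY (C := C)
    (fun z => (bM z).trans (by nlinarith [hC z, norm_nonneg (X z), hC0 z]))
    (fun z => by nlinarith [hC z, norm_nonneg (X z), hC0 z]) bY hYc
    (hX.of_norm_le (by linarith) bM)
    (hX.of_norm_le (by positivity) fun z => by rw [Real.norm_of_nonneg (by positivity)])
  have hMY : ∀ z, M z + Y z = X z - α • ∑ i ∈ Finset.range h, A (z (n + i + 1)) (X z) := fun z => by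
    have e1 : ∀ i ∈ Finset.range h,
        (-α) • (At (z (n + (i + 1))) - iter P (i + 1) At (z n)) (X z)
        = α • iter P (i + 1) At (z n) (X z) - α • A (z (n + i + 1)) (X z) + α • Ab (X z) := by
      intro i _
      rw [← add_assoc]
      simp only [hAdef, sub_apply, add_apply, neg_smul, smul_sub, smul_add]
      abel
    simp only [M, Y]
    rw [Finset.sum_congr rfl e1, Finset.sum_add_distrib, Finset.sum_sub_distrib, Finset.smul_sum]
    simp only [hI, sum_apply, Finset.smul_sum, Finset.sum_const,
      Finset.card_range]
    rw [← Nat.cast_smul_eq_nsmul ℝ, smul_smul, mul_comm (h : ℝ)]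
    abel
  have mA : StronglyMeasurable A := stronglyMeasurable_const.add mAt
  have hrem : MomentLE (chainLaw P ξ) p (2 * u * u * η) fun z =>
      blockProd α A z n (X z) h - (X z - α • ∑ i ∈ Finset.range h, A (z (n + i + 1)) (X z)) :=
    hX.of_norm_le (by positivity) fun z =>
      norm_blockProd_sub_linear_le hα.le hA hu2 z n (X z) le_rfl
  have mb : ∀ l : ℕ, StronglyMeasurable (fun z => blockProd α A z n (X z) l) := by
    intro l
    induction l with
    | zero => exact mX'
    | succ l ih =>
      exact ih.sub ((stronglyMeasurable_clm_apply
        (mA.comp_measurable (measurable_pi_apply _)) ih).const_smul α)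
  have mMY := (mM.mono (hist_le n)).add mY
  have mMY' : StronglyMeasurable fun z : ℕ → Z =>
      X z - α • ∑ i ∈ Finset.range h, A (z (n + i + 1)) (X z) := by
    rw [← show M + Y = _ from funext hMY]; exact mMY
  have hfin := hstep1.add hrem (by linarith) (Real.sqrt_nonneg _) (by positivity)
    mMY.aestronglyMeasurable
    ((mb h).sub mMY').aestronglyMeasurable
  have e : (fun z => (M z + Y z) + (blockProd α A z n (X z) h
      - (X z - α • ∑ i ∈ Finset.range h, A (z (n + i + 1)) (X z))))
      = fun z => blockProd α A z n (X z) h := by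
    ext1 z; rw [hMY]; abel
  rw [e] at hfin
  refine hfin.mono ?_
  have e2 : √(((1 - y / 8) * η) ^ 2 + (2 * p + 1) * (2 * u * η) ^ 2)
      = √((1 - y / 8) ^ 2 + (2 * p + 1) * (2 * u) ^ 2) * η := by
    rw [show ((1 - y / 8) * η) ^ 2 + (2 * p + 1) * (2 * u * η) ^ 2
      = ((1 - y / 8) ^ 2 + (2 * p + 1) * (2 * u) ^ 2) * η ^ 2 by ring,
      Real.sqrt_mul (by positivity), Real.sqrt_sq hη]
  rw [e2, ← add_mul]
  gcongr
  exact block_contraction_le hp hy0 (hyu.trans hu1) huy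

/-- The remainder `H` of the expansion is of the order of the last term `W` of the expansion. -/
lemma momentLE_remainder (hP : UniformlyErgodic P π t) {p α a c u : ℝ} (hp : 2 ≤ p)
    (hα : 0 < α) (ha : 0 < a) (hu : 0 ≤ u) {h : ℕ} (hh : 1 ≤ h) {Ab : E →L[ℝ] E}
    (hBh : ∀ v, ‖v - (α * h) • Ab v‖ ^ 2 ≤ (1 - α * h * a) * ‖v‖ ^ 2)
    (hct : 8 * (t * c) ≤ h * a) (hstep : α * h * (96 * p * c ^ 2) ≤ a) (hac : a ≤ c)
    {At : Z → E →L[ℝ] E} (mAt : StronglyMeasurable At) (hAt : ∀ z, ‖At z‖ ≤ c)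
    (hA : ∀ z, ‖Ab + At z‖ ≤ c) (hπA : ∫ z, At z ∂π = 0) {W H : ℕ → (ℕ → Z) → E}
    (gW : ∀ n, StronglyMeasurable[hist Z n] (W n) ∧ ∃ C, ∀ z, ‖W n z‖ ≤ C)
    (hW : ∀ n, MomentLE (chainLaw P ξ) p u (W n)) (H0 : ∀ z, H 0 z = 0)
    (hH : ∀ n z, H (n + 1) z = H n z - α • (Ab + At (z (n + 1))) (H n z)
      - α • At (z (n + 1)) (W n z)) (n : ℕ) :
    MomentLE (chainLaw P ξ) p (40 * (c / a) * u) (H n) := by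
  have hc : 0 < c := ha.trans_le hac
  set A : Z → E →L[ℝ] E := fun z => Ab + At z with hAdef
  have mA : StronglyMeasurable A := stronglyMeasurable_const.add mAt
  have gAW := clm_apply_adapted_bounded mAt hAt gW
  have gH : ∀ n, StronglyMeasurable[hist Z n] (H n) ∧ ∃ C, ∀ z, ‖H n z‖ ≤ C := by
    intro n
    induction n with
    | zero =>
      have : H 0 = fun _ => 0 := funext H0
      rw [this]
      exact ⟨stronglyMeasurable_const, 0, fun z => by simp⟩
    | succ n ih =>
      obtain ⟨m1, C, hC⟩ := ih
      obtain ⟨mF, D, hD⟩ := gAW n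
      have : H (n + 1) = fun z => H n z - α • (Ab + At (z (n + 1))) (H n z)
        - α • At (z (n + 1)) (W n z) := funext (hH n)
      rw [this]
      have m2 := m1.mono (Filtration.piLE.mono (Nat.le_succ n))
      refine ⟨(m2.sub ((stronglyMeasurable_clm_apply (stronglyMeasurable_eval le_rfl mA)
        m2).const_smul α)).sub (mF.const_smul α), C + α * (c * C) + α * D, fun z => ?_⟩
      refine (norm_sub_le _ _).trans (add_le_add ((norm_sub_le _ _).trans
        (add_le_add (hC z) ?_)) ?_)
      · rw [norm_smul, Real.norm_of_nonneg hα.le]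
        gcongr
        exact (ContinuousLinearMap.le_opNorm _ _).trans
          (mul_le_mul (hA _) (hC z) (norm_nonneg _) hc.le)
      · rw [norm_smul, Real.norm_of_nonneg hα.le]
        gcongr
        exact hD z
  have hF : ∀ n, MomentLE (chainLaw P ξ) p (c * u) fun z => At (z (n + 1)) (W n z) := fun n =>
    (hW n).of_norm_le hc.le fun z =>
      (ContinuousLinearMap.le_opNorm _ _).trans (by gcongr; exact hAt _)
  have hv : h * (α * c) ≤ 1 / 192 := by
    have h1 : α * h * (96 * p * c ^ 2) ≤ c := hstep.trans hac
    have h2 : 96 * p * (h * (α * c)) ≤ 1 := by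
      by_contra! hlt
      nlinarith
    have : 0 ≤ h * (α * c) := by positivity
    nlinarith
  have hy : α * h * a ≤ 1 / 192 := by
    refine le_trans ?_ hv
    rw [show h * (α * c) = α * h * c by ring]
    gcongr
  have hsub := fun n l (hl : l ≤ h) => momentLE_sub_blockProd (μ := chainLaw P ξ) hp hα.le hc.le hA
    (by linarith : h * (α * c) ≤ 1 / 2) hu mA (fun n => (gH n).1.mono (hist_le n))
    (fun n => (gAW n).1.mono (hist_le _)) hH hF n hl
  induction n using Nat.strong_induction_on with
  | _ n ih =>
  by_cases hn : h ≤ n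
  · obtain ⟨m, rfl⟩ := Nat.exists_eq_add_of_le' hn
    obtain ⟨m1, C, hC⟩ := gH m
    have h1 := momentLE_blockProd (ξ := ξ) hP hp hα ha hBh hct hstep hac mAt hAt hA hπA
      (by positivity) m1 hC (ih m (by omega))
    obtain ⟨mb, h2⟩ := hsub m h le_rfl
    have h3 := h1.add h2 (by linarith) (mul_nonneg (by linarith) (by positivity)) (by positivity)
      mb.aestronglyMeasurable (((gH _).1.mono (hist_le _)).sub mb).aestronglyMeasurable
    have e : (fun z => blockProd α A z m (H m z) h + (H (m + h) z - blockProd α A z m (H m z) h))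
        = H (m + h) := by ext1 z; abel
    rw [e] at h3
    -- `40(c/a)u` is the fixed point of `η ↦ (1 - αha/20)η + 2αhcu`.
    refine h3.mono (le_of_eq ?_)
    field_simp; ring
  -- Before the first full block, `H` starts at `0` and consists of accumulated forcing only.
  · obtain ⟨-, h2⟩ := hsub 0 n (not_le.1 hn).le
    have e : (fun z => H (0 + n) z - blockProd α A z 0 (H 0 z) n) = H n := by
      ext1 z
      have : ∀ l, blockProd α A z 0 (H 0 z) l = 0 := by
        intro l
        induction l with
        | zero => exact H0 z
        | succ l ih => rw [blockProd, ih]; simp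
      rw [this, zero_add, sub_zero]
    rw [e] at h2
    refine h2.mono ?_
    have hnh : (n : ℝ) ≤ h := by exact_mod_cast (not_le.1 hn).le
    have hca : 1 ≤ c / a := (one_le_div ha).2 hac
    have : n * (α * c) ≤ h * (α * c) := by gcongr
    have : 2 * (n * (α * c)) ≤ 40 * (c / a) := by linarith
    gcongr

end Remainder

/-! ### Existence of the solution of the Lyapunov equation -/

section Lyapunov

open Matrix

variable {d : ℕ}

lemma isUnit_sub_of_re_nonpos {A : Matrix (Fin d) (Fin d) ℝ} (hA : IsHurwitz (-A)) {w : ℂ}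
    (hw : w.re ≤ 0) : IsUnit (algebraMap ℂ _ w - A.map (algebraMap ℝ ℂ)) := by
  by_contra h
  have h1 : w ∈ spectrum ℂ (A.map (algebraMap ℝ ℂ)) := h
  have h2 : -w ∈ spectrum ℂ ((-A).map (algebraMap ℝ ℂ)) := by
    have : (-A).map (algebraMap ℝ ℂ) = -(A.map (algebraMap ℝ ℂ)) := by ext; simp
    rw [this, ← spectrum.neg_eq]
    simpa using h1
  have := hA _ h2
  simp at this
  linarith

lemma isUnit_one_add_map {A : Matrix (Fin d) (Fin d) ℝ} (hA : IsHurwitz (-A)) :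
    IsUnit (1 + A.map (algebraMap ℝ ℂ)) := by
  have := isUnit_sub_of_re_nonpos hA (w := -1) (by simp)
  rw [← IsUnit.neg_iff] at this
  convert this using 1
  rw [map_neg, map_one]
  abel

lemma isUnit_one_add {A : Matrix (Fin d) (Fin d) ℝ} (hA : IsHurwitz (-A)) : IsUnit (1 + A) := by
  have h := isUnit_one_add_map hA
  rw [isUnit_iff_isUnit_det, isUnit_iff_ne_zero] at h ⊢
  intro h0
  apply h
  have : (1 + A.map (algebraMap ℝ ℂ)) = (algebraMap ℝ ℂ).mapMatrix (1 + A) := by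
    rw [map_add, map_one]; rfl
  rw [this, ← RingHom.map_det, h0, map_zero]

/-- The Cayley transform `(1 - A)(1 + A)⁻¹` of `A`. -/
noncomputable def cayley (A : Matrix (Fin d) (Fin d) ℝ) : Matrix (Fin d) (Fin d) ℝ :=
  (1 - A) * (1 + A)⁻¹

lemma cayley_mul {A : Matrix (Fin d) (Fin d) ℝ} (hA : IsHurwitz (-A)) :
    cayley A * (1 + A) = 1 - A := by
  have := isUnit_one_add hA
  rw [cayley, mul_assoc, nonsing_inv_mul _ ((isUnit_iff_isUnit_det _).1 this), mul_one]

/-- For `|w| ≥ 1`, `w ≠ -1`, one has `(w - C)(1 + A) = -(w + 1)((1 - w)/(1 + w) - A)`, and `(1 -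
w)/(1 + w)` has real part `(1 - |w|²)/|1 + w|² ≤ 0`, so it is not an eigenvalue of `A`. For `w = -1`
the product is `-2`. -/
lemma norm_lt_one_of_mem_spectrum_cayley {A : Matrix (Fin d) (Fin d) ℝ} (hA : IsHurwitz (-A))
    {w : ℂ} (hw : w ∈ spectrum ℂ ((cayley A).map (algebraMap ℝ ℂ))) : ‖w‖ < 1 := by
  by_contra! h1
  apply hw
  set Ac := A.map (algebraMap ℝ ℂ) with hAc
  set Cc := (cayley A).map (algebraMap ℝ ℂ) with hCc
  have e1 : Cc * (1 + Ac) = 1 - Ac := by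
    have := congrArg (algebraMap ℝ ℂ).mapMatrix (cayley_mul hA)
    rw [map_mul, map_add, map_sub, map_one] at this
    exact this
  have e2 : (algebraMap ℂ _ w - Cc) * (1 + Ac)
      = algebraMap ℂ _ (w - 1) + algebraMap ℂ _ (w + 1) * Ac := by
    rw [sub_mul, e1, map_sub, map_add, map_one, mul_add, add_mul, mul_one, one_mul]
    abel
  have hunit := isUnit_one_add_map hA
  have key : IsUnit ((algebraMap ℂ (Matrix (Fin d) (Fin d) ℂ) w - Cc) * (1 + Ac)) := by
    rw [e2]
    by_cases hw1 : w + 1 = 0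
    · rw [hw1, map_zero, zero_mul, add_zero]
      refine IsUnit.map _ (isUnit_iff_ne_zero.2 ?_)
      rw [eq_neg_of_add_eq_zero_left hw1]; norm_num
    · have hre : ((1 - w) / (1 + w)).re ≤ 0 := by
        rw [Complex.div_re]
        have hsq : 1 ≤ Complex.normSq w := by
          rw [Complex.normSq_eq_norm_sq]; nlinarith
        rw [Complex.normSq_apply] at hsq
        have h0 : 0 ≤ Complex.normSq (1 + w) := Complex.normSq_nonneg _
        rw [← add_div]
        refine div_nonpos_of_nonpos_of_nonneg ?_ h0
        simp only [Complex.sub_re, Complex.one_re, Complex.add_re, Complex.sub_im,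
          Complex.one_im, Complex.add_im]
        nlinarith
      have h2 := isUnit_sub_of_re_nonpos hA hre
      have h3 : IsUnit (algebraMap ℂ (Matrix (Fin d) (Fin d) ℂ) (-(w + 1))) :=
        IsUnit.map _ (isUnit_iff_ne_zero.2 (neg_ne_zero.2 hw1))
      have e3 : algebraMap ℂ _ (w - 1) + algebraMap ℂ _ (w + 1) * Ac
          = algebraMap ℂ (Matrix (Fin d) (Fin d) ℂ) (-(w + 1)) *
            (algebraMap ℂ _ ((1 - w) / (1 + w)) - Ac) := by
        rw [mul_sub, ← map_mul]
        have : -(w + 1) * ((1 - w) / (1 + w)) = w - 1 := by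
          have : 1 + w ≠ 0 := by rwa [add_comm]
          field_simp; ring
        rw [this, map_neg, neg_mul, sub_neg_eq_add]
      rw [e3]
      exact h3.mul h2
  exact isUnit_of_mul_isUnit_left key

/-- Gelfand's formula over `ℂ`: the spectral radius is below `1`, and entries are dominated by the
operator norm. -/
lemma exists_geometric_bound_cayley (hd : 1 ≤ d) {A : Matrix (Fin d) (Fin d) ℝ}
    (hA : IsHurwitz (-A)) :
    ∃ r : ℝ, 0 ≤ r ∧ r < 1 ∧ ∃ N : ℕ, ∀ n ≥ N, ∀ i j, |((cayley A) ^ n) i j| ≤ r ^ n := by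
  have : Nonempty (Fin d) := ⟨⟨0, hd⟩⟩
  set Cc := (cayley A).map (algebraMap ℝ ℂ) with hCc
  have hr : spectralRadius ℂ Cc < (1 : NNReal) :=
    spectrum.spectralRadius_lt_of_forall_lt Cc fun w hw => by
      have := norm_lt_one_of_mem_spectrum_cayley hA hw
      exact_mod_cast this
  obtain ⟨r, hr1, hr2⟩ := ENNReal.lt_iff_exists_nnreal_btwn.1 hr
  have hlim := spectrum.pow_nnnorm_pow_one_div_tendsto_nhds_spectralRadius Cc
  obtain ⟨N, hN⟩ := Filter.eventually_atTop.1 (hlim.eventually (gt_mem_nhds hr1))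
  refine ⟨r, r.2, by exact_mod_cast hr2, N + 1, fun n hn i j => ?_⟩
  have hn0 : (n : ℝ) ≠ 0 := by
    have : n ≠ 0 := by omega
    exact_mod_cast this
  have h1 := (hN n (by omega)).le
  have h2 : (‖Cc ^ n‖₊ : ℝ≥0∞) ≤ (r : ℝ≥0∞) ^ n := by
    have := ENNReal.rpow_le_rpow h1 (Nat.cast_nonneg n)
    rwa [← ENNReal.rpow_mul, one_div_mul_cancel hn0, ENNReal.rpow_one, ENNReal.rpow_natCast] at this
  have h3 : ‖Cc ^ n‖ ≤ (r : ℝ) ^ n := by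
    have h4 : ‖Cc ^ n‖₊ ≤ r ^ n := by exact_mod_cast h2
    exact_mod_cast h4
  have h4 : (Cc ^ n) i j = (((cayley A) ^ n) i j : ℂ) := by
    have : Cc ^ n = (algebraMap ℝ ℂ).mapMatrix ((cayley A) ^ n) := by
      rw [map_pow]; rfl
    rw [this]; rfl
  have h5 : ‖(Cc ^ n) i j‖ ≤ ‖Cc ^ n‖ := by
    have h6 := (toEuclideanCLM (𝕜 := ℂ) (Cc ^ n)).le_opNorm (EuclideanSpace.single j 1)
    rw [PiLp.norm_single, norm_one, mul_one] at h6
    have h7 := PiLp.norm_apply_le (p := 2)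
      (toEuclideanCLM (𝕜 := ℂ) (Cc ^ n) (EuclideanSpace.single j 1)) i
    have h8 : (toEuclideanCLM (𝕜 := ℂ) (Cc ^ n) (EuclideanSpace.single j 1)) i = (Cc ^ n) i j := by
      rw [ofLp_toEuclideanCLM]
      simp
    rw [h8] at h7
    exact h7.trans h6
  rw [h4, Complex.norm_real] at h5
  exact h5.trans h3

lemma summable_conj_cayley (hd : 1 ≤ d) {A : Matrix (Fin d) (Fin d) ℝ} (hA : IsHurwitz (-A))
    (W : Matrix (Fin d) (Fin d) ℝ) :
    Summable fun k : ℕ => ((cayley A) ^ k)ᵀ * W * (cayley A) ^ k := by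
  obtain ⟨r, hr0, hr1, N, hN⟩ := exists_geometric_bound_cayley hd hA
  refine Pi.summable.2 fun i => Pi.summable.2 fun j => ?_
  have hterm : ∀ l m : Fin d, Summable fun k : ℕ =>
      ((cayley A) ^ k) m i * W m l * ((cayley A) ^ k) l j := by
    intro l m
    have hg : Summable fun k : ℕ => |W m l| * (r ^ 2) ^ k :=
      (summable_geometric_of_lt_one (by positivity) (by nlinarith)).mul_left _
    refine Summable.of_norm_bounded_eventually_nat hg ?_
    filter_upwards [Filter.eventually_ge_atTop N] with k hk
    rw [Real.norm_eq_abs, abs_mul, abs_mul]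
    have h1 := hN k hk m i
    have h2 := hN k hk l j
    calc _ ≤ r ^ k * |W m l| * r ^ k := by gcongr
      _ = _ := by ring
  have : (fun k : ℕ => (((cayley A) ^ k)ᵀ * W * (cayley A) ^ k) i j)
      = fun k => ∑ l, ∑ m, ((cayley A) ^ k) m i * W m l * ((cayley A) ^ k) l j := by
    ext k
    simp only [mul_apply, transpose_apply, Finset.sum_mul]
  rw [this]
  exact summable_sum fun l _ => summable_sum fun m _ => hterm l m

/-- Lyapunov's theorem. -/
theorem exists_isLyapunovSolution (hd : 1 ≤ d) {A : Matrix (Fin d) (Fin d) ℝ}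
    (hA : IsHurwitz (-A)) : ∃ Q, IsLyapunovSolution A Q := by
  set C := cayley A with hC
  set N := (1 + A)⁻¹ with hN
  have hu := isUnit_one_add hA
  have hNA : N * (1 + A) = 1 := nonsing_inv_mul _ ((isUnit_iff_isUnit_det _).1 hu)
  -- The Cayley transform turns the Lyapunov equation into the Stein equation `Q - CᵀQC = W`, solved
  -- by a convergent series. Conjugating by `1 + A` returns `(1 + A)ᵀQ(1 + A) - (1 - A)ᵀQ(1 - A) =
  -- 2(AᵀQ + QA)`, and `W` is chosen so that its conjugate is `2 · 1`.
  set W : Matrix (Fin d) (Fin d) ℝ := (2 : ℝ) • (Nᵀ * N) with hW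
  have hs : Summable fun k : ℕ => (C ^ k)ᵀ * W * C ^ k := summable_conj_cayley hd hA W
  set Q := ∑' k : ℕ, (C ^ k)ᵀ * W * C ^ k with hQ
  have hstein : Cᵀ * Q * C = Q - W := by
    rw [hQ, ← hs.tsum_mul_left, ← (hs.mul_left Cᵀ).tsum_mul_right, hs.tsum_eq_zero_add]
    simp only [pow_zero, transpose_one, one_mul, mul_one, add_sub_cancel_left]
    refine tsum_congr fun k => ?_
    rw [pow_succ, transpose_mul]
    simp only [mul_assoc]
  have hWpos : ∀ x : Fin d → ℝ, 0 ≤ x ⬝ᵥ W *ᵥ x := fun x => by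
    rw [hW, smul_mulVec, dotProduct_smul, ← mulVec_mulVec, dotProduct_mulVec, vecMul_transpose]
    have := dotProduct_star_self_nonneg (N *ᵥ x)
    simp only [star_trivial] at this
    simpa using this
  have hWpos' : ∀ x : Fin d → ℝ, x ≠ 0 → 0 < x ⬝ᵥ W *ᵥ x := fun x hx => by
    rw [hW, smul_mulVec, dotProduct_smul, ← mulVec_mulVec, dotProduct_mulVec, vecMul_transpose]
    have hNx : N *ᵥ x ≠ 0 := by
      intro h0
      apply hx
      have : (1 + A) * N = 1 := mul_nonsing_inv _ ((isUnit_iff_isUnit_det _).1 hu)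
      rw [← one_mulVec x, ← this, ← mulVec_mulVec, h0, mulVec_zero]
    have := dotProduct_star_self_pos_iff.2 hNx
    simp only [star_trivial] at this
    simpa using this
  have hQsum : ∀ x : Fin d → ℝ, HasSum (fun k : ℕ => (C ^ k *ᵥ x) ⬝ᵥ W *ᵥ (C ^ k *ᵥ x))
      (x ⬝ᵥ Q *ᵥ x) := fun x => by
    let φ : Matrix (Fin d) (Fin d) ℝ →+ ℝ :=
      { toFun := fun M => x ⬝ᵥ M *ᵥ x
        map_zero' := by simp
        map_add' := fun M M' => by rw [add_mulVec, dotProduct_add] }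
    have hφ : Continuous φ := by
      change Continuous fun M : Matrix (Fin d) (Fin d) ℝ => x ⬝ᵥ M *ᵥ x
      fun_prop
    have := hs.hasSum.map φ hφ
    change HasSum _ (x ⬝ᵥ Q *ᵥ x) at this
    refine this.congr_fun fun k => ?_
    change _ = x ⬝ᵥ ((C ^ k)ᵀ * W * C ^ k) *ᵥ x
    rw [← mulVec_mulVec, ← mulVec_mulVec, dotProduct_mulVec x, vecMul_transpose]
  have hWt : Wᵀ = W := by
    rw [hW, transpose_smul, transpose_mul, transpose_transpose]
  have hQt : Qᵀ = Q := by
    rw [hQ, transpose_tsum]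
    refine tsum_congr fun k => ?_
    rw [transpose_mul, transpose_mul, transpose_transpose, hWt, mul_assoc]
  refine ⟨Q, ?_, ?_⟩
  · rw [posDef_iff_dotProduct_mulVec]
    refine ⟨by rw [IsHermitian, conjTranspose_eq_transpose_of_trivial, hQt], fun x hx => ?_⟩
    rw [star_trivial]
    have h0 := le_hasSum (hQsum x) 0 fun k _ => hWpos _
    rw [pow_zero, one_mulVec] at h0
    exact (hWpos' x hx).trans_le h0
  · have hCA : C * (1 + A) = 1 - A := cayley_mul hA
    have e1 : (1 + A)ᵀ * (Cᵀ * Q * C) * (1 + A) = (1 - A)ᵀ * Q * (1 - A) := by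
      rw [← hCA, transpose_mul]; simp only [mul_assoc]
    have e2 : (1 + A)ᵀ * W * (1 + A) = (2 : ℝ) • 1 := by
      rw [hW, mul_smul_comm, smul_mul_assoc]
      congr 1
      have : (1 + A)ᵀ * (Nᵀ * N) * (1 + A) = (N * (1 + A))ᵀ * (N * (1 + A)) := by
        rw [transpose_mul]; simp only [mul_assoc]
      rw [this, hNA, transpose_one, mul_one]
    rw [hstein, mul_sub, sub_mul, e2] at e1
    have e3 : (2 : ℝ) • (Aᵀ * Q + Q * A) = (2 : ℝ) • 1 := by
      have e4 : (1 + A)ᵀ * Q * (1 + A) - (1 - A)ᵀ * Q * (1 - A) = (2 : ℝ) • 1 := by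
        rw [← e1]; abel
      rw [← e4, transpose_add, transpose_sub, transpose_one, two_smul]
      noncomm_ring
    exact smul_right_injective _ (two_ne_zero' ℝ) e3

lemma isLyapunovSolution_lyapunov (hd : 1 ≤ d) {A : Matrix (Fin d) (Fin d) ℝ}
    (hA : IsHurwitz (-A)) : IsLyapunovSolution A (lyapunov A) := by
  have h := exists_isLyapunovSolution hd hA
  rw [lyapunov, dif_pos h]
  exact h.choose_spec

end Lyapunov

/-! ### The norm defined by a positive definite matrix -/

section QNorm

open Matrix

variable {d : ℕ}

lemma spectrum_eq_range {Q : Matrix (Fin d) (Fin d) ℝ} (hQ : Q.PosDef) :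
    spectrum ℝ Q = Set.range hQ.1.eigenvalues :=
  hQ.1.spectrum_real_eq_range_eigenvalues

lemma finite_spectrum {Q : Matrix (Fin d) (Fin d) ℝ} (hQ : Q.PosDef) : (spectrum ℝ Q).Finite := by
  rw [spectrum_eq_range hQ]; exact Set.finite_range _

lemma sInf_spectrum_pos (hd : 1 ≤ d) {Q : Matrix (Fin d) (Fin d) ℝ} (hQ : Q.PosDef) :
    0 < sInf (spectrum ℝ Q) := by
  have hne : (spectrum ℝ Q).Nonempty := by
    rw [spectrum_eq_range hQ]; exact ⟨_, ⟨⟨0, hd⟩, rfl⟩⟩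
  have hm := hne.csInf_mem (finite_spectrum hQ)
  rw [spectrum_eq_range hQ] at hm ⊢
  obtain ⟨i, hi⟩ := hm
  rw [← hi]
  exact hQ.eigenvalues_pos i

lemma sInf_le_sSup_spectrum (hd : 1 ≤ d) {Q : Matrix (Fin d) (Fin d) ℝ} (hQ : Q.PosDef) :
    sInf (spectrum ℝ Q) ≤ sSup (spectrum ℝ Q) := by
  have hne : (spectrum ℝ Q).Nonempty := by
    rw [spectrum_eq_range hQ]; exact ⟨_, ⟨⟨0, hd⟩, rfl⟩⟩
  exact csInf_le_csSup hne (finite_spectrum hQ).bddBelow (finite_spectrum hQ).bddAbove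

open scoped MatrixOrder in
lemma inner_act_nonneg_of_le {M N : Matrix (Fin d) (Fin d) ℝ} (h : M ≤ N)
    (x : EuclideanSpace ℝ (Fin d)) : inner ℝ x (act M x) ≤ inner ℝ x (act N x) := by
  have := (Matrix.le_iff.1 h).dotProduct_mulVec_nonneg x.ofLp
  rw [sub_mulVec, dotProduct_sub, star_trivial] at this
  rw [act, act, inner_toEuclideanCLM, inner_toEuclideanCLM]
  linarith

lemma inner_act_algebraMap (r : ℝ) (x : EuclideanSpace ℝ (Fin d)) :
    inner ℝ x (act (algebraMap ℝ _ r) x) = r * ‖x‖ ^ 2 := by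
  rw [act, Algebra.algebraMap_eq_smul_one, map_smul, map_one, _root_.smul_apply,
    one_apply_eq_self, inner_smul_right, real_inner_self_eq_norm_sq]

open scoped MatrixOrder in
lemma sInf_spectrum_mul_le {Q : Matrix (Fin d) (Fin d) ℝ} (hQ : Q.PosDef)
    (x : EuclideanSpace ℝ (Fin d)) :
    sInf (spectrum ℝ Q) * ‖x‖ ^ 2 ≤ inner ℝ x (act Q x) := by
  rw [← inner_act_algebraMap]
  refine inner_act_nonneg_of_le ?_ x
  rw [algebraMap_le_iff_le_spectrum (ha := hQ.1)]
  exact fun y hy => csInf_le (finite_spectrum hQ).bddBelow hy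

open scoped MatrixOrder in
lemma inner_act_le_sSup_spectrum {Q : Matrix (Fin d) (Fin d) ℝ} (hQ : Q.PosDef)
    (x : EuclideanSpace ℝ (Fin d)) :
    inner ℝ x (act Q x) ≤ sSup (spectrum ℝ Q) * ‖x‖ ^ 2 := by
  rw [← inner_act_algebraMap]
  refine inner_act_nonneg_of_le ?_ x
  rw [le_algebraMap_iff_spectrum_le (ha := hQ.1)]
  exact fun y hy => le_csSup (finite_spectrum hQ).bddAbove hy

lemma inner_act_le_norm (Q : Matrix (Fin d) (Fin d) ℝ) (x : EuclideanSpace ℝ (Fin d)) :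
    inner ℝ x (act Q x) ≤ ‖Q‖ * ‖x‖ ^ 2 := by
  have h1 := real_inner_le_norm x (act Q x)
  have h2 : ‖act Q x‖ ≤ ‖Q‖ * ‖x‖ := (toEuclideanCLM (𝕜 := ℝ) Q).le_opNorm x
  nlinarith [norm_nonneg x]

lemma inner_act_left (M : Matrix (Fin d) (Fin d) ℝ) (x y : EuclideanSpace ℝ (Fin d)) :
    inner ℝ (act M x) y = inner ℝ x (act Mᵀ y) := by
  rw [real_inner_comm, act, act, inner_toEuclideanCLM, inner_toEuclideanCLM, dotProduct_mulVec,
    dotProduct_comm, ← mulVec_transpose]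

lemma act_act (M N : Matrix (Fin d) (Fin d) ℝ) (x : EuclideanSpace ℝ (Fin d)) :
    act M (act N x) = act (M * N) x := by
  rw [act, act, act, map_mul]; rfl

/-- A change of coordinates `T` with `‖T x‖ = ‖x‖_Q`. -/
structure IsQCoord (Q : Matrix (Fin d) (Fin d) ℝ)
    (T Ti : EuclideanSpace ℝ (Fin d) →L[ℝ] EuclideanSpace ℝ (Fin d)) : Prop where
  apply_inv : ∀ x, T (Ti x) = x
  inv_apply : ∀ x, Ti (T x) = x
  norm_sq : ∀ x, ‖T x‖ ^ 2 = inner ℝ x (act Q x)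

-- The positive square root of `Q` serves; it transfers the Hilbert space estimates, stated for the
-- standard inner product, to the `Q`-norm.
open scoped MatrixOrder in
lemma exists_isQCoord {Q : Matrix (Fin d) (Fin d) ℝ} (hQ : Q.PosDef) :
    ∃ T Ti, IsQCoord Q T Ti := by
  have hs : CFC.sqrt Q * CFC.sqrt Q = Q := CFC.sqrt_mul_sqrt_self Q hQ.posSemidef.nonneg
  have ht : (CFC.sqrt Q)ᵀ = CFC.sqrt Q := (CFC.sqrt_nonneg Q).isSelfAdjoint
  have hu : IsUnit (CFC.sqrt Q).det := by
    have h := hQ.det_pos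
    rw [← hs, det_mul] at h
    exact isUnit_iff_ne_zero.2 (left_ne_zero_of_mul h.ne')
  refine ⟨toEuclideanCLM (𝕜 := ℝ) (CFC.sqrt Q), toEuclideanCLM (𝕜 := ℝ) (CFC.sqrt Q)⁻¹,
    fun x => ?_, fun x => ?_, fun x => ?_⟩
  · rw [← mul_apply_eq_comp, ← map_mul, mul_nonsing_inv _ hu, map_one]; rfl
  · rw [← mul_apply_eq_comp, ← map_mul, nonsing_inv_mul _ hu, map_one]; rfl
  · rw [← real_inner_self_eq_norm_sq]
    change inner ℝ (act _ x) (act _ x) = _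
    rw [inner_act_left, act_act, ht, hs]

variable {Q M : Matrix (Fin d) (Fin d) ℝ}
  {T Ti : EuclideanSpace ℝ (Fin d) →L[ℝ] EuclideanSpace ℝ (Fin d)}

/-- The linear map `x ↦ M x` in the coordinates given by `T`. -/
noncomputable def conjAct (T Ti : EuclideanSpace ℝ (Fin d) →L[ℝ] EuclideanSpace ℝ (Fin d)) :
    Matrix (Fin d) (Fin d) ℝ →ₗ[ℝ] (EuclideanSpace ℝ (Fin d) →L[ℝ] EuclideanSpace ℝ (Fin d)) where
  toFun M := T ∘L (toEuclideanCLM (𝕜 := ℝ) M) ∘L Ti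
  map_add' M N := by ext x : 1; simp
  map_smul' r M := by ext x : 1; simp

lemma conjAct_apply (T Ti : EuclideanSpace ℝ (Fin d) →L[ℝ] EuclideanSpace ℝ (Fin d))
    (M : Matrix (Fin d) (Fin d) ℝ) (x : EuclideanSpace ℝ (Fin d)) :
    conjAct T Ti M x = T (act M (Ti x)) := rfl

lemma IsQCoord.conjAct_apply (h : IsQCoord Q T Ti) (x : EuclideanSpace ℝ (Fin d)) :
    conjAct T Ti M (T x) = T (act M x) := by
  rw [LSA.conjAct_apply, h.inv_apply]

lemma IsQCoord.norm_eq (h : IsQCoord Q T Ti) (x : EuclideanSpace ℝ (Fin d)) :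
    normQ Q x = ‖T x‖ := by
  rw [normQ, ← h.norm_sq, Real.sqrt_sq (norm_nonneg _)]

lemma IsQCoord.norm_le (h : IsQCoord Q T Ti) (hQ : Q.PosDef) (x : EuclideanSpace ℝ (Fin d)) :
    ‖T x‖ ≤ √(sSup (spectrum ℝ Q)) * ‖x‖ := by
  have h1 := inner_act_le_sSup_spectrum hQ x
  rw [← h.norm_sq] at h1
  have := Real.sqrt_le_sqrt h1
  rwa [Real.sqrt_sq (norm_nonneg _), Real.sqrt_mul' _ (sq_nonneg _),
    Real.sqrt_sq (norm_nonneg _)] at this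

lemma IsQCoord.norm_inv_le (hd : 1 ≤ d) (h : IsQCoord Q T Ti) (hQ : Q.PosDef)
    (x : EuclideanSpace ℝ (Fin d)) : ‖x‖ ≤ (√(sInf (spectrum ℝ Q)))⁻¹ * ‖T x‖ := by
  have h0 := sInf_spectrum_pos hd hQ
  have h1 := sInf_spectrum_mul_le hQ x
  rw [← h.norm_sq] at h1
  have := Real.sqrt_le_sqrt h1
  rw [Real.sqrt_sq (norm_nonneg _), Real.sqrt_mul' _ (sq_nonneg _),
    Real.sqrt_sq (norm_nonneg _)] at this
  rw [inv_mul_eq_div, le_div_iff₀ (Real.sqrt_pos.2 h0), mul_comm]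
  exact this

/-- `T` costs `√λ_max(Q)` and its inverse `1/√λ_min(Q)`; the powers of `κ_Q` in the bounds come from
such passages. -/
lemma IsQCoord.norm_conjAct_le (hd : 1 ≤ d) (h : IsQCoord Q T Ti) (hQ : Q.PosDef)
    (M : Matrix (Fin d) (Fin d) ℝ) : ‖conjAct T Ti M‖ ≤ √(condNumber Q) * ‖M‖ := by
  refine ContinuousLinearMap.opNorm_le_bound _ (by positivity) fun v => ?_
  have h1 := h.norm_inv_le hd hQ (Ti v)
  rw [h.apply_inv] at h1
  have h2 : ‖act M (Ti v)‖ ≤ ‖M‖ * ‖Ti v‖ := (toEuclideanCLM (𝕜 := ℝ) M).le_opNorm _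
  rw [LSA.conjAct_apply]
  calc _ ≤ √(sSup (spectrum ℝ Q)) * ‖act M (Ti v)‖ := h.norm_le hQ _
    _ ≤ √(sSup (spectrum ℝ Q)) * (‖M‖ * ((√(sInf (spectrum ℝ Q)))⁻¹ * ‖v‖)) := by
        gcongr; exact h2.trans (by gcongr)
    _ = _ := by
        rw [condNumber, Real.sqrt_div' _ (sInf_spectrum_pos hd hQ).le]
        ring

lemma IsQCoord.norm_conjAct_le_opNormQ (h : IsQCoord Q T Ti) (M : Matrix (Fin d) (Fin d) ℝ) :
    ‖conjAct T Ti M‖ ≤ opNormQ Q M := by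
  have hbdd : BddAbove ((fun x => normQ Q (act M x)) '' {x | normQ Q x = 1}) := by
    refine ⟨‖conjAct T Ti M‖, ?_⟩
    rintro _ ⟨x, hx, rfl⟩
    have hx' : ‖T x‖ = 1 := by rw [← h.norm_eq]; exact hx
    have := (conjAct T Ti M).le_opNorm (T x)
    rw [h.conjAct_apply, hx', mul_one] at this
    simpa only [h.norm_eq] using this
  have hnn : 0 ≤ opNormQ Q M := by
    refine Real.sSup_nonneg ?_
    rintro _ ⟨x, -, rfl⟩
    exact Real.sqrt_nonneg _
  refine ContinuousLinearMap.opNorm_le_bound _ hnn fun v => ?_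
  rcases eq_or_ne v 0 with rfl | hv
  · simp
  have hv' := norm_pos_iff.2 hv
  have h1 : ‖conjAct T Ti M (‖v‖⁻¹ • v)‖ ≤ opNormQ Q M := by
    refine le_csSup hbdd ⟨Ti (‖v‖⁻¹ • v), ?_, ?_⟩
    · rw [Set.mem_ofPred_eq, h.norm_eq, h.apply_inv, norm_smul, norm_inv, norm_norm,
        inv_mul_cancel₀ hv'.ne']
    · simp only [h.norm_eq, LSA.conjAct_apply]
  rwa [map_smul, norm_smul, norm_inv, norm_norm, inv_mul_le_iff₀ hv', mul_comm] at h1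

/-- By polarization of `‖T x‖² = xᵀQx`, the left-hand side equals `xᵀ(MᵀQ + QM)x`. -/
lemma IsQCoord.two_inner_conjAct (h : IsQCoord Q T Ti) (hM : IsLyapunovSolution M Q)
    (x : EuclideanSpace ℝ (Fin d)) :
    2 * inner ℝ (T x) (conjAct T Ti M (T x)) = ‖x‖ ^ 2 := by
  have hQt : Qᵀ = Q := hM.1.1
  have hpol : ∀ y, inner ℝ (T x) (T y) = inner ℝ x (act Q y) := by
    intro y
    have h1 := h.norm_sq (x + y)
    have hsym : inner ℝ y (act Q x) = inner ℝ x (act Q y) := by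
      rw [real_inner_comm, inner_act_left, hQt]
    have hadd : act Q (x + y) = act Q x + act Q y := map_add (toEuclideanCLM (𝕜 := ℝ) Q) x y
    rw [map_add, norm_add_sq_real, h.norm_sq, h.norm_sq, hadd] at h1
    rw [inner_add_left, inner_add_right, inner_add_right, hsym] at h1
    linarith
  have h1 : inner ℝ x (act Mᵀ (act Q x)) = inner ℝ x (act Q (act M x)) := by
    rw [← inner_act_left, real_inner_comm, inner_act_left, hQt]
  have h2 : act Mᵀ (act Q x) + act Q (act M x) = x := by
    rw [act_act, act_act, act, act, ← _root_.add_apply, ← map_add, hM.2, map_one]; rfl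
  have h3 : inner ℝ x (act Mᵀ (act Q x) + act Q (act M x)) = ‖x‖ ^ 2 := by
    rw [h2, real_inner_self_eq_norm_sq]
  rw [inner_add_right, h1] at h3
  rw [h.conjAct_apply, hpol]
  linarith

/-- `I - αM` is a contraction in the `Q`-norm. -/
lemma IsQCoord.norm_sub_conjAct_sq_le (h : IsQCoord Q T Ti) (hM : IsLyapunovSolution M Q)
    (hQ0 : 0 < ‖Q‖) {α : ℝ} (hα : 0 ≤ α) (hαM : α * ‖conjAct T Ti M‖ ^ 2 ≤ ‖Q‖⁻¹ / 2)
    (v : EuclideanSpace ℝ (Fin d)) :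
    ‖v - α • conjAct T Ti M v‖ ^ 2 ≤ (1 - α * (‖Q‖⁻¹ / 2)) * ‖v‖ ^ 2 := by
  have h1 := h.two_inner_conjAct hM (Ti v)
  have h2 := inner_act_le_norm Q (Ti v)
  rw [← h.norm_sq, h.apply_inv] at h2
  rw [h.apply_inv] at h1
  have h3 : ‖Q‖⁻¹ * ‖v‖ ^ 2 ≤ ‖Ti v‖ ^ 2 := by
    rwa [inv_mul_le_iff₀ hQ0]
  have h4 : ‖conjAct T Ti M v‖ ^ 2 ≤ ‖conjAct T Ti M‖ ^ 2 * ‖v‖ ^ 2 := by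
    rw [← mul_pow]
    exact pow_le_pow_left₀ (norm_nonneg _) ((conjAct T Ti M).le_opNorm v) 2
  rw [norm_sub_sq_real, inner_smul_right, norm_smul, mul_pow, Real.norm_eq_abs, sq_abs]
  -- The first-order term gives `-α‖Q‖⁻¹‖v‖²`; the condition on `α` lets the second-order term take
  -- back at most half of it.
  have h5 : α * (α * ‖conjAct T Ti M v‖ ^ 2) ≤ α * (‖Q‖⁻¹ / 2 * ‖v‖ ^ 2) := by
    refine mul_le_mul_of_nonneg_left ?_ hα
    calc _ ≤ α * (‖conjAct T Ti M‖ ^ 2 * ‖v‖ ^ 2) := by gcongr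
      _ = (α * ‖conjAct T Ti M‖ ^ 2) * ‖v‖ ^ 2 := by ring
      _ ≤ _ := by gcongr
  have h6 := mul_le_mul_of_nonneg_left h3 hα
  nlinarith

/-- Coercivity tested on a unit vector. Through `a_le` it shows that `C_A` is positive and that the
ratio `√κ_Q C_A / a` is at least `1`. -/
lemma IsQCoord.le_norm_conjAct (hd : 1 ≤ d) (h : IsQCoord Q T Ti) (hM : IsLyapunovSolution M Q)
    (hQ0 : 0 < ‖Q‖) : ‖Q‖⁻¹ / 2 ≤ ‖conjAct T Ti M‖ := by
  set v : EuclideanSpace ℝ (Fin d) := EuclideanSpace.single ⟨0, hd⟩ 1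
  have hv : ‖v‖ = 1 := by simp [v]
  have h1 := h.two_inner_conjAct hM (Ti v)
  have h2 := inner_act_le_norm Q (Ti v)
  rw [← h.norm_sq, h.apply_inv] at h2
  rw [h.apply_inv] at h1
  have h3 : ‖Q‖⁻¹ * ‖v‖ ^ 2 ≤ ‖Ti v‖ ^ 2 := by
    rwa [inv_mul_le_iff₀ hQ0]
  have h4 := real_inner_le_norm v (conjAct T Ti M v)
  have h5 := (conjAct T Ti M).le_opNorm v
  rw [hv] at h3 h4 h5
  linarith

lemma norm_pos_of_posDef (hd : 1 ≤ d) (hQ : Q.PosDef) : 0 < ‖Q‖ := by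
  rw [norm_pos_iff]
  rintro rfl
  have := hQ.diag_pos (i := ⟨0, hd⟩)
  simp at this

end QNorm

/-! ### Centred functions of the data -/

namespace Data

variable {d : ℕ} {Z : Type*} [MeasurableSpace Z] {S : Data d Z} {π : Measure Z}
  {G : Type*} [NormedAddCommGroup G] [NormedSpace ℝ G]

/-- The hypotheses on `A` are entrywise; expansion in matrix units transfers measurability and the
mean to every linear image of `Ã`, such as its conjugate by `T`. -/
lemma linearMap_Atilde_eq_sum (F : Matrix (Fin d) (Fin d) ℝ →ₗ[ℝ] G) (z : Z) :
    F (S.Atilde z) = ∑ i, ∑ j, (S.A z i j - S.Abar i j) • F (Matrix.single i j 1) := by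
  conv_lhs => rw [Matrix.matrix_eq_sum_single (S.Atilde z)]
  rw [map_sum]
  refine Finset.sum_congr rfl fun i _ => ?_
  rw [map_sum]
  refine Finset.sum_congr rfl fun j _ => ?_
  rw [← map_smul, Matrix.smul_single, smul_eq_mul, mul_one]
  rfl

lemma CenteredBoundedNoise.stronglyMeasurable_Atilde (h : S.CenteredBoundedNoise π)
    (F : Matrix (Fin d) (Fin d) ℝ →ₗ[ℝ] G) : StronglyMeasurable fun z => F (S.Atilde z) := by
  simp only [linearMap_Atilde_eq_sum]
  refine Finset.stronglyMeasurable_fun_sum _ fun i _ =>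
    Finset.stronglyMeasurable_fun_sum _ fun j _ => ?_
  exact ((h.measurable_A i j).sub_const _).stronglyMeasurable.smul_const _

variable [IsProbabilityMeasure π]

lemma CenteredBoundedNoise.integrable_Atilde (h : S.CenteredBoundedNoise π)
    (F : Matrix (Fin d) (Fin d) ℝ →ₗ[ℝ] G) : Integrable (fun z => F (S.Atilde z)) π := by
  simp only [linearMap_Atilde_eq_sum]
  refine integrable_finsetSum _ fun i _ => integrable_finsetSum _ fun j _ => ?_
  exact ((h.integrable_A i j).sub (integrable_const _)).smul_const _

lemma CenteredBoundedNoise.integral_Atilde [CompleteSpace G] (h : S.CenteredBoundedNoise π)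
    (F : Matrix (Fin d) (Fin d) ℝ →ₗ[ℝ] G) : ∫ z, F (S.Atilde z) ∂π = 0 := by
  simp only [linearMap_Atilde_eq_sum]
  have hi : ∀ i j, Integrable (fun z => (S.A z i j - S.Abar i j) • F (Matrix.single i j 1)) π :=
    fun i j => ((h.integrable_A i j).sub (integrable_const _)).smul_const _
  rw [integral_finsetSum _ fun i _ => integrable_finsetSum _ fun j _ => hi i j]
  refine Finset.sum_eq_zero fun i _ => ?_
  rw [integral_finsetSum _ fun j _ => hi i j]
  refine Finset.sum_eq_zero fun j _ => ?_
  rw [integral_smul_const, integral_sub (h.integrable_A i j) (integrable_const _), h.integral_A]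
  simp

/-- The map `M ↦ M x`. -/
noncomputable def actAt (x : EuclideanSpace ℝ (Fin d)) :
    Matrix (Fin d) (Fin d) ℝ →ₗ[ℝ] EuclideanSpace ℝ (Fin d) where
  toFun M := act M x
  map_add' M N := by simp [act]
  map_smul' r M := by simp [act]

lemma CenteredBoundedNoise.stronglyMeasurable_noise (h : S.CenteredBoundedNoise π) :
    StronglyMeasurable S.noise :=
  (h.stronglyMeasurable_Atilde (actAt S.thetaStar)).sub
    (h.measurable_b.stronglyMeasurable.sub stronglyMeasurable_const)

lemma CenteredBoundedNoise.integrable_noise (h : S.CenteredBoundedNoise π) :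
    Integrable S.noise π :=
  (h.integrable_Atilde (actAt S.thetaStar)).sub (h.integrable_b.sub (integrable_const _))

lemma CenteredBoundedNoise.integral_noise (h : S.CenteredBoundedNoise π) :
    ∫ z, S.noise z ∂π = 0 := by
  have h1 : ∫ z, act (S.Atilde z) S.thetaStar ∂π = 0 :=
    h.integral_Atilde (actAt S.thetaStar)
  have h2 : Integrable (fun z => act (S.Atilde z) S.thetaStar) π :=
    h.integrable_Atilde (actAt S.thetaStar)
  have h3 : Integrable (fun z => S.b z - S.bbar) π := h.integrable_b.sub (integrable_const _)
  unfold noise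
  rw [integral_sub h2 h3, h1, integral_sub h.integrable_b (integrable_const _), h.integral_b]
  simp

end Data

namespace Data

/-! ### The constants of the linear system -/

section Constants

variable {d : ℕ} {Z : Type*} {S : Data d Z}
  {T Ti : EuclideanSpace ℝ (Fin d) →L[ℝ] EuclideanSpace ℝ (Fin d)}

lemma BoundedHurwitz.isLyapunovSolution (hd : 1 ≤ d) (hA : S.BoundedHurwitz) :
    IsLyapunovSolution S.Abar S.Q := isLyapunovSolution_lyapunov hd hA.hurwitz

lemma BoundedHurwitz.one_le_kappa (hd : 1 ≤ d) (hA : S.BoundedHurwitz) : 1 ≤ S.kappa := by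
  have hQ := (hA.isLyapunovSolution hd).1
  rw [kappa, condNumber, one_le_div (sInf_spectrum_pos hd hQ)]
  exact sInf_le_sSup_spectrum hd hQ

lemma BoundedHurwitz.a_pos (hd : 1 ≤ d) (hA : S.BoundedHurwitz) : 0 < S.a := by
  have := norm_pos_of_posDef hd (hA.isLyapunovSolution hd).1
  rw [a]; positivity

lemma BoundedHurwitz.norm_A_le (hA : S.BoundedHurwitz) (z : Z) : ‖S.A z‖ ≤ S.CA :=
  (le_ciSup hA.bdd_A z).trans (le_max_left _ _)

lemma BoundedHurwitz.norm_Atilde_le (hA : S.BoundedHurwitz) (z : Z) : ‖S.Atilde z‖ ≤ S.CA :=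
  (le_ciSup hA.bdd_Atilde z).trans (le_max_right _ _)

lemma BoundedHurwitz.norm_conjAct_Atilde_le (hd : 1 ≤ d) (hA : S.BoundedHurwitz)
    (h : IsQCoord S.Q T Ti) (z : Z) : ‖conjAct T Ti (S.Atilde z)‖ ≤ √S.kappa * S.CA :=
  (h.norm_conjAct_le hd (hA.isLyapunovSolution hd).1 _).trans
    (mul_le_mul_of_nonneg_left (hA.norm_Atilde_le z) (Real.sqrt_nonneg _))

lemma conjAct_Abar_add_Atilde (z : Z) :
    conjAct T Ti S.Abar + conjAct T Ti (S.Atilde z) = conjAct T Ti (S.A z) := by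
  rw [← map_add, Atilde, add_sub_cancel]

lemma BoundedHurwitz.norm_conjAct_A_le (hd : 1 ≤ d) (hA : S.BoundedHurwitz)
    (h : IsQCoord S.Q T Ti) (z : Z) :
    ‖conjAct T Ti S.Abar + conjAct T Ti (S.Atilde z)‖ ≤ √S.kappa * S.CA := by
  rw [conjAct_Abar_add_Atilde]
  exact (h.norm_conjAct_le hd (hA.isLyapunovSolution hd).1 _).trans
    (mul_le_mul_of_nonneg_left (hA.norm_A_le z) (Real.sqrt_nonneg _))

/-- `Ā` is the `π`-mean of `A`, so in the coordinates `T` it inherits the uniform bound on `A(z)`,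
while coercivity bounds it below by `a`. -/
lemma BoundedHurwitz.a_le (hd : 1 ≤ d) (hA : S.BoundedHurwitz) [MeasurableSpace Z]
    {π : Measure Z} [IsProbabilityMeasure π] (hn : S.CenteredBoundedNoise π)
    (h : IsQCoord S.Q T Ti) : S.a ≤ √S.kappa * S.CA := by
  have hM := hA.isLyapunovSolution hd
  refine (h.le_norm_conjAct hd hM (norm_pos_of_posDef hd hM.1)).trans ?_
  have h1 : ∫ z, (conjAct T Ti S.Abar + conjAct T Ti (S.Atilde z)) ∂π = conjAct T Ti S.Abar := by
    rw [integral_add (integrable_const _) (hn.integrable_Atilde _), hn.integral_Atilde]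
    simp
  rw [← h1]
  refine (norm_integral_le_of_norm_le_const (ae_of_all _ (hA.norm_conjAct_A_le hd h))).trans ?_
  simp

lemma step_bounds (hd : 1 ≤ d) (hA : S.BoundedHurwitz) (h : IsQCoord S.Q T Ti) {α : ℝ}
    (hα : 0 < α) (hα' : α ≤ S.alphaInf) :
    α * S.a ≤ 1 / 2 ∧ α * ‖conjAct T Ti S.Abar‖ ^ 2 ≤ S.a ∧
      ∀ v, ‖v - α • conjAct T Ti S.Abar v‖ ^ 2 ≤ (1 - α * S.a) * ‖v‖ ^ 2 := by
  have hM := hA.isLyapunovSolution hd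
  have hQ0 := norm_pos_of_posDef hd hM.1
  have h1 : α ≤ ‖S.Q‖ := hα'.trans (min_le_right _ _)
  have h2 : α ≤ (1 / 2) * (opNormQ S.Q S.Abar ^ 2)⁻¹ * ‖S.Q‖⁻¹ := hα'.trans (min_le_left _ _)
  have h3 : α * ‖conjAct T Ti S.Abar‖ ^ 2 ≤ S.a := by
    have h4 := h.norm_conjAct_le_opNormQ S.Abar
    -- If this norm were `0`, its inverse would be `0` by convention and `α_∞ ≤ 0 < α`, a
    -- contradiction.
    have h5 : 0 < opNormQ S.Q S.Abar := by
      refine ((norm_nonneg _).trans h4).lt_of_ne' fun h0 => ?_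
      rw [h0] at h2
      norm_num at h2
      linarith
    calc α * ‖conjAct T Ti S.Abar‖ ^ 2 ≤ α * opNormQ S.Q S.Abar ^ 2 := by gcongr
      _ ≤ ((1 / 2) * (opNormQ S.Q S.Abar ^ 2)⁻¹ * ‖S.Q‖⁻¹) * opNormQ S.Q S.Abar ^ 2 := by gcongr
      _ = S.a := by rw [a]; field_simp
  refine ⟨?_, h3, h.norm_sub_conjAct_sq_le hM hQ0 hα.le h3⟩
  calc α * S.a ≤ ‖S.Q‖ * (‖S.Q‖⁻¹ / 2) := by rw [a]; gcongr
    _ = 1 / 2 := by field_simp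

lemma rpow_div_two {x : ℝ} (hx : 0 ≤ x) (k : ℕ) : x ^ ((k : ℝ) / 2) = √x ^ k := by
  rw [Real.sqrt_eq_rpow, ← Real.rpow_natCast, ← Real.rpow_mul hx]
  congr 1; ring

/-- The moment bound obtained for `J^{(2)}`. -/
noncomputable def boundJ (S : Data d Z) (p α t : ℝ) : ℝ :=
  6600 * √p ^ 3 * √(α / S.a) ^ 3 * √t ^ 5 * (√S.kappa * S.CA) ^ 2 * (√S.kappa * S.noiseSup)

/-- Only the terms in `c_4` and `c_5` are kept: they give `34 · 2 + 12 = 80` copies of `√κ_Q D‖ε‖_∞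
/ a^{3/2}`, and `D ≥ (70 + 35)κ_Q C_A²`, whence `8400`. The `70` rests on `70 log 2 ≤ 49`. -/
lemma mul_le_DJ (ha : 0 < S.a) (hκ : 1 ≤ S.kappa) (hε : 0 ≤ S.noiseSup) :
    8400 * √S.kappa ^ 3 * S.CA ^ 2 * S.noiseSup / √S.a ^ 3 ≤ S.DJ := by
  have hs1 : 1 ≤ √S.kappa := Real.one_le_sqrt.2 hκ
  have hlog : 0 < Real.log 2 := Real.log_pos one_lt_two
  have hsq : √S.kappa ^ 2 = S.kappa := Real.sq_sqrt (by linarith)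
  have hD1 : 70 * S.kappa * S.CA ^ 2 ≤ S.D11 := by
    rw [D11, show (3 / 2 : ℝ) = ((3 : ℕ) : ℝ) / 2 by norm_num, rpow_div_two (by linarith),
      le_div_iff₀ hlog]
    have h2 := Real.log_two_lt_d9
    have h3 : 70 * Real.log 2 ≤ √S.kappa * (48 * √S.kappa + 1) := by nlinarith
    calc 70 * S.kappa * S.CA ^ 2 * Real.log 2 = (S.kappa * S.CA ^ 2) * (70 * Real.log 2) := by ring
      _ ≤ (S.kappa * S.CA ^ 2) * (√S.kappa * (48 * √S.kappa + 1)) := by gcongr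
      _ = _ := by rw [← hsq]; simp only [Real.sqrt_sq (Real.sqrt_nonneg _)]; ring
  have hD2 : 35 * S.kappa * S.CA ^ 2 ≤ S.D21 := by
    rw [D21]
    have : 35 ≤ 34 * S.kappa + 1 := by linarith
    calc 35 * S.kappa * S.CA ^ 2 = S.kappa * 35 * S.CA ^ 2 := by ring
      _ ≤ _ := by gcongr
  have hD : 105 * S.kappa * S.CA ^ 2 ≤ S.D11 + S.D21 := by linarith
  have hD0 : 0 ≤ S.D11 + S.D21 := le_trans (by positivity) hD
  have h1 : 0 ≤ S.cJ1 := by unfold cJ1; positivity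
  have h2 : 0 ≤ S.cJ2 := by unfold cJ2; positivity
  have h3 : 0 ≤ S.cJ3 := by unfold cJ3; positivity
  have h6 : 0 ≤ S.cJ6 := by unfold cJ6; positivity
  have key : 8400 * √S.kappa ^ 3 * S.CA ^ 2 * S.noiseSup / √S.a ^ 3 ≤ 34 * S.cJ5 + S.cJ4 := by
    rw [cJ5, cJ4, show (3 / 2 : ℝ) = ((3 : ℕ) : ℝ) / 2 by norm_num, rpow_div_two ha.le]
    have : 34 * (2 * √S.kappa * (S.D11 + S.D21) * S.noiseSup / √S.a ^ 3) +
        12 * √S.kappa * (S.D11 + S.D21) * S.noiseSup / √S.a ^ 3 =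
        80 * √S.kappa * (S.D11 + S.D21) * S.noiseSup / √S.a ^ 3 := by ring
    rw [this]
    calc _ = 80 * √S.kappa * (105 * S.kappa * S.CA ^ 2) * S.noiseSup / √S.a ^ 3 := by
          nth_rewrite 3 [← hsq]; ring
      _ ≤ _ := by gcongr
  rw [DJ, DJ1, DJ2, DJ3]
  linarith

/-- Since `αa ≤ 1/2`, the logarithm is at least `log 2` and its power `3/2` at least `1/2`; the
spare `p²` is at least `4`. Hence `8400 · 4 · (1/2)` exceeds `6600`. -/
lemma boundJ_le (ha : 0 < S.a) (hκ : 1 ≤ S.kappa) (hε : 0 ≤ S.noiseSup)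
    {p α t : ℝ} (hp : 2 ≤ p) (hα : 0 < α) (hαa : α * S.a ≤ 1 / 2) (ht : 0 ≤ t) :
    S.boundJ p α t ≤ S.DJ * t ^ (5 / 2 : ℝ) * p ^ (7 / 2 : ℝ) * α ^ (3 / 2 : ℝ) *
      Real.log (1 / (α * S.a)) ^ (3 / 2 : ℝ) := by
  have hαa0 : 0 < α * S.a := mul_pos hα ha
  have hL : 0.64 ≤ Real.log (1 / (α * S.a)) := by
    have h1 : (2 : ℝ) ≤ 1 / (α * S.a) := by rw [le_div_iff₀ hαa0]; linarith
    have h2 := Real.log_le_log two_pos h1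
    have := Real.log_two_gt_d9
    linarith
  set L := Real.log (1 / (α * S.a))
  have hsL : 0.8 ≤ √L := Real.le_sqrt_of_sq_le (by norm_num; norm_num at hL; linarith)
  have hL3 : 1 / 2 ≤ √L ^ 3 := le_trans (by norm_num) (pow_le_pow_left₀ (by norm_num) hsL 3)
  have hp4 : 4 ≤ √p ^ 4 := by
    have : √p ^ 4 = p ^ 2 := by
      rw [show 4 = 2 * 2 by norm_num, pow_mul, Real.sq_sqrt (by linarith)]
    rw [this]; nlinarith
  have hDJ := mul_le_DJ ha hκ hε
  rw [show (3 / 2 : ℝ) = ((3 : ℕ) : ℝ) / 2 by norm_num,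
    show (5 / 2 : ℝ) = ((5 : ℕ) : ℝ) / 2 by norm_num,
    show (7 / 2 : ℝ) = ((7 : ℕ) : ℝ) / 2 by norm_num, rpow_div_two ht, rpow_div_two hα.le,
    rpow_div_two (by linarith : 0 ≤ p), rpow_div_two (by linarith : 0 ≤ L), boundJ,
    Real.sqrt_div hα.le]
  set X := √S.kappa ^ 3 * S.CA ^ 2 * S.noiseSup / √S.a ^ 3 * √t ^ 5 * √p ^ 3 * √α ^ 3 with hX
  have hX0 : 0 ≤ X := by positivity
  calc _ = 6600 * X := by rw [hX]; field_simp
    _ ≤ X * (8400 * (4 * (1 / 2))) := by linarith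
    _ ≤ X * (8400 * (√p ^ 4 * √L ^ 3)) := by gcongr
    _ = 8400 * √S.kappa ^ 3 * S.CA ^ 2 * S.noiseSup / √S.a ^ 3 * √t ^ 5 * √p ^ 7 * √α ^ 3 *
          √L ^ 3 := by rw [hX]; ring
    _ ≤ _ := by gcongr

end Constants

/-! ### Moment bounds for the expansion of the fluctuation term -/

section Expansion

variable {d : ℕ} {Z : Type*} {S : Data d Z}
  {T Ti : EuclideanSpace ℝ (Fin d) →L[ℝ] EuclideanSpace ℝ (Fin d)}

lemma coord_act_one_sub (h : IsQCoord S.Q T Ti) (α : ℝ) (M : Matrix (Fin d) (Fin d) ℝ)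
    (x : EuclideanSpace ℝ (Fin d)) :
    T (act (1 - α • M) x) = T x - α • conjAct T Ti M (T x) := by
  have h1 : act (1 - α • M) x = x - α • act M x := by
    rw [act, map_sub, map_one, map_smul]; rfl
  rw [h.conjAct_apply, h1, map_sub, map_smul]

lemma coord_J_zero_succ (h : IsQCoord S.Q T Ti) (α : ℝ) (z : ℕ → Z) (n : ℕ) :
    T (S.J α z 0 (n + 1)) = T (S.J α z 0 n) - α • conjAct T Ti S.Abar (T (S.J α z 0 n))
      - α • T (S.noise (z (n + 1))) := by
  rw [J, map_sub, coord_act_one_sub h, map_smul]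

lemma coord_J_succ_succ (h : IsQCoord S.Q T Ti) (α : ℝ) (z : ℕ → Z) (l n : ℕ) :
    T (S.J α z (l + 1) (n + 1)) = T (S.J α z (l + 1) n)
      - α • conjAct T Ti S.Abar (T (S.J α z (l + 1) n))
      - α • conjAct T Ti (S.Atilde (z (n + 1))) (T (S.J α z l n)) := by
  rw [J, map_sub, coord_act_one_sub h, map_smul, h.conjAct_apply (M := S.Atilde _)]

lemma coord_H_succ (h : IsQCoord S.Q T Ti) (α : ℝ) (z : ℕ → Z) (l n : ℕ) :
    T (S.H α z l (n + 1)) = T (S.H α z l n)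
      - α • (conjAct T Ti S.Abar + conjAct T Ti (S.Atilde (z (n + 1)))) (T (S.H α z l n))
      - α • conjAct T Ti (S.Atilde (z (n + 1))) (T (S.J α z l n)) := by
  rw [H, map_sub, coord_act_one_sub h, map_smul, conjAct_Abar_add_Atilde,
    h.conjAct_apply (M := S.Atilde _)]

lemma coord_J_at_zero (α : ℝ) (z : ℕ → Z) (l : ℕ) : T (S.J α z l 0) = 0 := by
  cases l <;> simp [J]

variable [MeasurableSpace Z] {P : Kernel Z Z} [IsMarkovKernel P] {ξ : Measure Z}
  [IsProbabilityMeasure ξ] {π : Measure Z} [IsProbabilityMeasure π] {t : ℕ}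

lemma norm_coord_noise_le (hd : 1 ≤ d) (hA : S.BoundedHurwitz) (hn : S.CenteredBoundedNoise π)
    (h : IsQCoord S.Q T Ti) (z : Z) :
    ‖T (S.noise z)‖ ≤ √(sSup (spectrum ℝ S.Q)) * S.noiseSup :=
  (h.norm_le (hA.isLyapunovSolution hd).1 _).trans
    (mul_le_mul_of_nonneg_left (le_ciSup hn.bdd_noise z) (Real.sqrt_nonneg _))

lemma momentLE_coord_J (hd : 1 ≤ d) (hA : S.BoundedHurwitz) (hn : S.CenteredBoundedNoise π)
    (hP : UniformlyErgodic P π t) (h : IsQCoord S.Q T Ti) {p α : ℝ} (hp : 2 ≤ p) (hα : 0 < α)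
    (hα' : α ≤ S.alphaInf) (n : ℕ) :
    MomentLE (chainLaw P ξ) p (6600 * √p ^ 3 * √(α / S.a) ^ 3 * √t ^ 5 * (√S.kappa * S.CA) ^ 2 *
      (√(sSup (spectrum ℝ S.Q)) * S.noiseSup)) (fun z => T (S.J α z 2 n)) := by
  obtain ⟨h1, h2, h3⟩ := step_bounds hd hA h hα hα'
  refine momentLE_second_order (U := fun n z => T (S.J α z 0 n)) (V := fun n z => T (S.J α z 1 n))
    (W := fun n z => T (S.J α z 2 n)) hP hp hα (hA.a_pos hd) h1 h3 h2
    (hn.stronglyMeasurable_Atilde (conjAct T Ti)) (hA.norm_conjAct_Atilde_le hd h)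
    (hn.integral_Atilde (conjAct T Ti)) (ε := fun z => T (S.noise z))
    (T.continuous.comp_stronglyMeasurable hn.stronglyMeasurable_noise)
    (norm_coord_noise_le hd hA hn h) ?_ (fun z => coord_J_at_zero α z 0)
    (fun z => coord_J_at_zero α z 1) (fun z => coord_J_at_zero α z 2)
    (fun n z => coord_J_zero_succ h α z n) (fun n z => coord_J_succ_succ h α z 0 n)
    (fun n z => coord_J_succ_succ h α z 1 n) n
  rw [T.integral_comp_comm hn.integrable_noise, hn.integral_noise, map_zero]

lemma adapted_bounded_coord_J (hd : 1 ≤ d) (hA : S.BoundedHurwitz) (hn : S.CenteredBoundedNoise π)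
    (h : IsQCoord S.Q T Ti) (α : ℝ) (l n : ℕ) :
    StronglyMeasurable[hist Z n] (fun z => T (S.J α z l n)) ∧
      ∃ C, ∀ z, ‖T (S.J α z l n)‖ ≤ C := by
  induction l generalizing n with
  | zero =>
    refine adapted_bounded_of_recursion (U := fun n z => T (S.J α z 0 n))
      (F := fun n z => T (S.noise (z (n + 1)))) (fun n => ?_) (fun n => ⟨_, fun z =>
      norm_coord_noise_le hd hA hn h _⟩) (fun z => coord_J_at_zero α z 0)
      (fun n z => coord_J_zero_succ h α z n) n
    exact stronglyMeasurable_eval le_rfl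
      (T.continuous.comp_stronglyMeasurable hn.stronglyMeasurable_noise)
  | succ l ih =>
    have := clm_apply_adapted_bounded (hn.stronglyMeasurable_Atilde (conjAct T Ti))
      (hA.norm_conjAct_Atilde_le hd h) ih
    exact adapted_bounded_of_recursion (U := fun n z => T (S.J α z (l + 1) n))
      (fun n => (this n).1) (fun n => (this n).2) (fun z => coord_J_at_zero α z _)
      (fun n z => coord_J_succ_succ h α z l n) n

lemma inv_sqrt_mul_sqrt_eq (hd : 1 ≤ d) (hA : S.BoundedHurwitz) :
    (√(sInf (spectrum ℝ S.Q)))⁻¹ * √(sSup (spectrum ℝ S.Q)) = √S.kappa := by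
  rw [kappa, condNumber, Real.sqrt_div' _
    (sInf_spectrum_pos hd (hA.isLyapunovSolution hd).1).le, inv_mul_eq_div]

theorem momentLE_J (hd : 1 ≤ d) (hA : S.BoundedHurwitz) (hn : S.CenteredBoundedNoise π)
    (hP : UniformlyErgodic P π t) {p α : ℝ} (hp : 2 ≤ p) (hα : 0 < α)
    (hα' : α ≤ S.alphaInf) (n : ℕ) :
    MomentLE (chainLaw P ξ) p (S.boundJ p α t) (fun z => S.J α z 2 n) := by
  have hQ := (hA.isLyapunovSolution hd).1
  obtain ⟨T, Ti, h⟩ := exists_isQCoord hQ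
  -- The factor `√λ_max(Q)` from the noise and `1/√λ_min(Q)` from undoing `T` combine into one
  -- `√κ_Q`.
  refine ((momentLE_coord_J hd hA hn hP h hp hα hα' n).of_norm_le (by positivity)
    fun z => h.norm_inv_le hd hQ _).mono (le_of_eq ?_)
  rw [boundJ, ← inv_sqrt_mul_sqrt_eq hd hA]
  ring

theorem momentLE_H (hd : 1 ≤ d) (hA : S.BoundedHurwitz) (hn : S.CenteredBoundedNoise π)
    (hP : UniformlyErgodic P π t) {p q α : ℝ} (hp : 2 ≤ p) (hq : p ≤ q / 2) (hα : 0 < α)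
    (hα' : α < S.alphaInfMq q * (t : ℝ)⁻¹) (n : ℕ) :
    α ≤ S.alphaInf ∧ MomentLE (chainLaw P ξ) p (40 * (√S.kappa * S.CA / S.a) * S.boundJ p α t)
      (fun z => S.H α z 2 n) := by
  have hQ := (hA.isLyapunovSolution hd).1
  obtain ⟨T, Ti, h⟩ := exists_isQCoord hQ
  have ha := hA.a_pos hd
  have hac := hA.a_le hd hn h
  set c := √S.kappa * S.CA with hc
  have hc0 : 0 < c := ha.trans_le hac
  have ht : (1 : ℝ) ≤ t := by exact_mod_cast hP.one_le
  have ht0 : (0 : ℝ) < t := by linarith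
  -- The ceiling is what makes blocks of length `h = N t` satisfy `8tc ≤ ha`.
  have hB : 8 * c ≤ S.blockCeil * S.a := by
    rw [← div_le_iff₀ ha, blockCeil, hc, ← mul_assoc]
    exact Nat.le_ceil _
  have hB0 : 0 < S.blockCeil := by
    by_contra! hB'
    nlinarith
  set N := ⌈8 * √S.kappa * S.CA / S.a⌉₊ with hN
  have hBN : S.blockCeil = N := rfl
  have hN1 : 1 ≤ N := by
    rw [hBN] at hB0
    exact_mod_cast hB0
  rw [← div_eq_mul_inv, lt_div_iff₀ ht0] at hα'
  have hh : ((N * t : ℕ) : ℝ) = S.blockCeil * t := by push_cast; rw [hBN]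
  -- The factors `B⁻¹` and `t⁻¹` in the step-size condition keep the step `αh` of a whole block
  -- admissible for the contraction.
  have h1 : α * (N * t : ℕ) ≤ S.alphaInf := by
    have h2 : α * t ≤ S.alphaInf * S.blockCeil⁻¹ := by
      refine (hα'.le.trans (min_le_left _ _)).trans ?_
      rw [alphaInfM]
      gcongr
      exact (min_le_left _ _).trans (min_le_left _ _)
    rw [← div_eq_mul_inv, le_div_iff₀ hB0] at h2
    rw [hh]
    linarith
  have hN1t : 1 ≤ N * t := Nat.one_le_iff_ne_zero.2 (Nat.mul_ne_zero (by omega) (by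
    have := hP.one_le; omega))
  have hh1 : (1 : ℝ) ≤ (N * t : ℕ) := by exact_mod_cast hN1t
  have h2 : α ≤ S.alphaInf := le_trans (by nlinarith) h1
  refine ⟨h2, ?_⟩
  -- From `C_Γ ≥ 4c²B` and `q ≥ 2p`: `12 C_Γ q αt ≥ 96 p c² αh`.
  have hstep : α * (N * t : ℕ) * (96 * p * c ^ 2) ≤ S.a := by
    have hq0 : 0 < q := by linarith
    have hG : 4 * c ^ 2 * S.blockCeil ≤ S.CGamma := by
      rw [CGamma, ← hc]
      gcongr
      linarith
    have hG0 : 0 < S.CGamma := lt_of_lt_of_le (by positivity) hG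
    have h3 : α * t < S.a / (12 * S.CGamma) / q := hα'.trans_le (min_le_right _ _)
    rw [lt_div_iff₀ hq0, lt_div_iff₀ (by positivity)] at h3
    refine le_trans ?_ h3.le
    calc α * (N * t : ℕ) * (96 * p * c ^ 2)
        = α * t * (2 * p) * (12 * (4 * c ^ 2 * S.blockCeil)) := by
          rw [hh]; ring
      _ ≤ α * t * q * (12 * S.CGamma) := by gcongr; linarith
  obtain ⟨-, -, h4⟩ := step_bounds hd hA h (α := α * (N * t : ℕ)) (by positivity) h1
  have hε0 : 0 ≤ S.noiseSup := Real.iSup_nonneg fun z => norm_nonneg _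
  have key := momentLE_remainder (ξ := ξ) (h := N * t) (H := fun n z => T (S.H α z 2 n)) hP hp hα ha
    (by positivity) hN1t h4 (by rw [hh]; nlinarith) hstep hac
    (hn.stronglyMeasurable_Atilde (conjAct T Ti)) (hA.norm_conjAct_Atilde_le hd h)
    (hA.norm_conjAct_A_le hd h) (hn.integral_Atilde (conjAct T Ti))
    (fun n => adapted_bounded_coord_J hd hA hn h α 2 n)
    (fun n => momentLE_coord_J hd hA hn hP h hp hα h2 n) (fun z => map_zero T)
    (fun n z => coord_H_succ h α z 2 n) n
  refine (key.of_norm_le (by positivity) fun z => h.norm_inv_le hd hQ _).mono (le_of_eq ?_)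
  rw [boundJ, ← hc, ← inv_sqrt_mul_sqrt_eq hd hA]
  ring

end Expansion

end Data

end LSA

/-! ### Comparison with the constants of the statement -/

theorem mainTheorem6 {d : ℕ} (hd : 1 ≤ d)
    {Z : Type*} [TopologicalSpace Z] [PolishSpace Z] [MeasurableSpace Z] [BorelSpace Z]
    (P : ProbabilityTheory.Kernel Z Z) [ProbabilityTheory.IsMarkovKernel P]
    (π : MeasureTheory.Measure Z) [MeasureTheory.IsProbabilityMeasure π]
    (t : ℕ) (S : LSA.Data d Z)
    (hA : S.BoundedHurwitz) (hnoise : S.CenteredBoundedNoise π)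
    (hmix : LSA.UniformlyErgodic P π t) :
    -- the bound on `J_n^{(2,α)}`
    (∀ (p α : ℝ) (ξ : MeasureTheory.Measure Z) [MeasureTheory.IsProbabilityMeasure ξ] (n : ℕ),
      2 ≤ p → 0 < α → α ≤ S.alphaInf →
      MeasureTheory.eLpNorm (fun z => S.J α z 2 n) (ENNReal.ofReal p) (LSA.chainLaw P ξ) ≤
        ENNReal.ofReal (S.DJ * (t : ℝ) ^ (5 / 2 : ℝ) * p ^ (7 / 2 : ℝ) * α ^ (3 / 2 : ℝ) *
          Real.log (1 / (α * S.a)) ^ (3 / 2 : ℝ))) ∧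
    -- the bound on `H_n^{(2,α)}`
    (∀ (p q α : ℝ) (ξ : MeasureTheory.Measure Z) [MeasureTheory.IsProbabilityMeasure ξ] (n : ℕ),
      2 ≤ p → p ≤ q / 2 → 0 < α → α < S.alphaInfMq q * (t : ℝ)⁻¹ →
      MeasureTheory.eLpNorm (fun z => S.H α z 2 n) (ENNReal.ofReal p) (LSA.chainLaw P ξ) ≤
        ENNReal.ofReal (S.DH * (d : ℝ) ^ (1 / q) * (t : ℝ) ^ (5 / 2 : ℝ) * p ^ (7 / 2 : ℝ) *
          α ^ (3 / 2 : ℝ) * Real.log (1 / (α * S.a)) ^ (3 / 2 : ℝ))) := by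
  have ha := hA.a_pos hd
  have hκ := hA.one_le_kappa hd
  have hε : 0 ≤ S.noiseSup := Real.iSup_nonneg fun z => norm_nonneg _
  have hC : 0 ≤ S.CA := le_max_of_le_left (Real.iSup_nonneg fun z => norm_nonneg _)
  obtain ⟨T, Ti, h⟩ := LSA.exists_isQCoord (hA.isLyapunovSolution hd).1
  have hbound : ∀ p α : ℝ, 2 ≤ p → 0 < α → α ≤ S.alphaInf →
      S.boundJ p α t ≤ S.DJ * (t : ℝ) ^ (5 / 2 : ℝ) * p ^ (7 / 2 : ℝ) * α ^ (3 / 2 : ℝ) *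
        Real.log (1 / (α * S.a)) ^ (3 / 2 : ℝ) := fun p α hp hα hα' =>
    LSA.Data.boundJ_le ha hκ hε hp hα (LSA.Data.step_bounds hd hA h hα hα').1 t.cast_nonneg
  refine ⟨fun p α ξ _ n hp hα hα' => ?_, fun p q α ξ _ n hp hq hα hα' => ?_⟩
  · exact (LSA.Data.momentLE_J hd hA hnoise hmix hp hα hα' n).mono (hbound p α hp hα hα')
  · obtain ⟨h1, h2⟩ := LSA.Data.momentLE_H (ξ := ξ) hd hA hnoise hmix hp hq hα hα' n
    refine h2.mono ?_
    have hb := hbound p α hp hα h1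
    have hb0 : 0 ≤ S.boundJ p α t := by unfold LSA.Data.boundJ; positivity
    set R := S.DJ * (t : ℝ) ^ (5 / 2 : ℝ) * p ^ (7 / 2 : ℝ) * α ^ (3 / 2 : ℝ) *
        Real.log (1 / (α * S.a)) ^ (3 / 2 : ℝ) with hR
    have hR0 : 0 ≤ R := hb0.trans hb
    have hd1 : 1 ≤ (d : ℝ) ^ (1 / q) :=
      Real.one_le_rpow (by exact_mod_cast hd) (one_div_nonneg.2 (by linarith))
    have he : 1 ≤ Real.exp 1 ^ 2 := one_le_pow₀ (Real.one_le_exp zero_le_one)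
    have hca : 0 ≤ √S.kappa * S.CA / S.a := by positivity
    -- The bound for `H` is dimension free; `384 ≥ 40`, while `e²` and `d^{1/q}` are at least `1`.
    calc 40 * (√S.kappa * S.CA / S.a) * S.boundJ p α t
        ≤ 384 * (√S.kappa * S.CA / S.a) * R := by gcongr; norm_num
      _ ≤ 384 * (√S.kappa * S.CA / S.a) * R * (Real.exp 1 ^ 2 * (d : ℝ) ^ (1 / q)) :=
          le_mul_of_one_le_right (by positivity) (one_le_mul_of_one_le_of_one_le he hd1)
      _ = _ := by rw [LSA.Data.DH, hR]; ring
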